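/- Let $n\ge 2$, let $\Omega\subset\mathbb R^n$ be a bounded domain (nonempty, open, connected) with boundary $\Gamma$, let $T\in(0,\infty)$, and put $Q=\Omega\times(0,T)$, $\Sigma=\Gamma\times(0,T)$. Assume: (A1) $Ay=-\sum_{i,j=1}^n\partial_{x_j}\big(a_{ij}(x)\,\partial_{x_i}y\big)+a_0(x)\,y$ with $a_{ij},a_0\in L^\infty(\Omega)$ such that, for some $\Lambda_A>0$ and almost every $x\in\Omega$, $\Lambda_A|\xi|^2\le\sum_{i,j=1}^n a_{ij}(x)\xi_i\xi_j$ for all $\xi\in\mathbb R^n$, and $a_0(x)\ge 0$. (A2) $f:\mathbb R\to\mathbb R$ is of class $C^1$, $f(0)=0$, and there is $\Lambda_f\ge 0$ with $f'(s)\ge-\Lambda_f$ for all $s\in\mathbb R$. (A3) $\alpha>0$, $y_0\in L^\infty(\Omega)$, and $y_d\in L^p(0,T;L^q(\Omega))$ with $p,q\in[2,\infty]$ and $\frac1p+\frac n{2q}<1$. Let $H^1_0(\Omega)$ be the closure of $C_c^\infty(\Omega)$ in the $H^1(\Omega)$ norm, let $H^{-1}(\Omega)$ be its dual, and let $W(0,T)=L^2(0,T;H^1_0(\Omega))\cap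 H^1(0,T;H^{-1}(\Omega))$. For $u\in L^2(Q)$, a solution of the state equation $$\frac{\partial y}{\partial t}+Ay+f(y)=u\ \text{ in }Q,\qquad y=0\ \text{ on }\Sigma,\qquad y(\cdot,0)=y_0\ \text{ in }\Omega$$ is a function $y\in W(0,T)$ with $f(y)\in L^2(Q)$ such that, for almost every $t\in(0,T)$, the differential equation holds in $H^{-1}(\Omega)$, and such that the representative of $y$ in $C([0,T];L^2(\Omega))$ takes the value $y_0$ at $t=0$. Then for every $u\in L^2(Q)$ the state equation has exactly one solution $y_u$, and the control problem $$\inf_{u\in L^2(Q)}J(u),\qquad J(u)=\frac12\int_Q\big[(y_u-y_d)^2+\alpha u^2\big]\,dx\,dt,\tag{P}$$ has a global solution: there is $\bar u\in L^2(Q)$ with $J(\bar u)\le J(u)$ for all $u\in L^2(Q)$. -/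

import Mathlib

open MeasureTheory Set
open scoped ENNReal

noncomputable section

namespace ParabolicControl

/-- Euclidean space `ℝⁿ`. -/
abbrev Space (n : ℕ) : Type := EuclideanSpace ℝ (Fin n)

variable {n : ℕ}

/-- Lebesgue measure on `Ω`. -/
abbrev volΩ (Ω : Set (Space n)) : Measure (Space n) := volume.restrict Ω

/-- Lebesgue measure on the time interval `(0, T)`. -/
abbrev volT (T : ℝ) : Measure ℝ := volume.restrict (Ioo 0 T)

/-- Lebesgue measure on the space-time cylinder `Q = Ω × (0, T)`. -/
abbrev volQ (Ω : Set (Space n)) (T : ℝ) : Measure (Space n × ℝ) :=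
  volume.restrict (Ω ×ˢ Ioo 0 T)

/-- The Lebesgue space `L²(Ω)`. -/
abbrev L2Ω (Ω : Set (Space n)) : Type := Lp ℝ 2 (volΩ Ω)

/-- The Lebesgue space `L²(Q)`. -/
abbrev L2Q (Ω : Set (Space n)) (T : ℝ) : Type := Lp ℝ 2 (volQ Ω T)

/-- The Hilbert space `L²(Ω) × L²(Ω; ℝⁿ)`, in which a Sobolev function `v` is represented by the
pair `(v, ∇v)`. -/
abbrev PairSpace (Ω : Set (Space n)) : Type :=
  WithLp 2 (Lp ℝ 2 (volΩ Ω) × Lp (Space n) 2 (volΩ Ω))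

/-- The linear subspace of all pairs `(φ, ∇φ)` with `φ ∈ C_c^∞(Ω)`. -/
def testPairs (Ω : Set (Space n)) : Submodule ℝ (PairSpace Ω) where
  carrier := {v | ∃ φ : Space n → ℝ, ContDiff ℝ (⊤ : ℕ∞) φ ∧ HasCompactSupport φ ∧ tsupport φ ⊆ Ω ∧
    v.fst =ᵐ[volΩ Ω] φ ∧ v.snd =ᵐ[volΩ Ω] gradient φ}
  zero_mem' := by
    refine ⟨fun _ => 0, contDiff_const, HasCompactSupport.zero, ?_, ?_, ?_⟩
    · rw [show (fun _ : Space n => (0 : ℝ)) = 0 from rfl, tsupport_zero]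
      exact empty_subset Ω
    · exact Lp.coeFn_zero _ _ _
    · filter_upwards [Lp.coeFn_zero (Space n) 2 (volΩ Ω)] with x hx
      refine Eq.trans hx ?_
      simp [gradient]
  add_mem' := by
    rintro v w ⟨φ, h1, h2, h3, h4, h5⟩ ⟨ψ, k1, k2, k3, k4, k5⟩
    refine ⟨φ + ψ, h1.add k1, h2.add k2, (tsupport_add φ ψ).trans (union_subset h3 k3), ?_, ?_⟩
    · filter_upwards [Lp.coeFn_add v.fst w.fst, h4, k4] with x hx hφ hψ
      refine Eq.trans hx ?_
      rw [Pi.add_apply, Pi.add_apply, hφ, hψ]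
    · filter_upwards [Lp.coeFn_add v.snd w.snd, h5, k5] with x hx hφ hψ
      have e1 := (h1.differentiable (by simp)) x
      have e2 := (k1.differentiable (by simp)) x
      refine Eq.trans hx ?_
      rw [Pi.add_apply, hφ, hψ]
      simp [gradient, fderiv_add e1 e2]
  smul_mem' := by
    rintro c v ⟨φ, h1, h2, h3, h4, h5⟩
    refine ⟨c • φ, contDiff_const.smul h1, h2.smul_left, ?_, ?_, ?_⟩
    · exact (closure_mono (Function.support_const_smul_subset c φ)).trans h3
    · filter_upwards [Lp.coeFn_smul c v.fst, h4] with x hx hφ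
      refine Eq.trans hx ?_
      rw [Pi.smul_apply, Pi.smul_apply, hφ]
    · filter_upwards [Lp.coeFn_smul c v.snd, h5] with x hx hφ
      have e1 := (h1.differentiable (by simp)) x
      refine Eq.trans hx ?_
      rw [Pi.smul_apply, hφ]
      simp [gradient, fderiv_const_smul e1 c]

/-- The closure of `C_c^∞(Ω)` in the `H¹` norm, as a closed subspace of `L²(Ω) × L²(Ω; ℝⁿ)`. -/
def H10Sub (Ω : Set (Space n)) : Submodule ℝ (PairSpace Ω) := (testPairs Ω).topologicalClosure

/-- The Sobolev space `H₀¹(Ω)`: the closure of `C_c^∞(Ω)` in the `H¹` norm. An element `v` is the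
pair of the function `v.1.fst ∈ L²(Ω)` and its weak gradient `v.1.snd ∈ L²(Ω; ℝⁿ)`. -/
def H10 (Ω : Set (Space n)) : Type := H10Sub Ω

/-- `H₀¹(Ω)` carries the `H¹` norm. -/
instance instNormedAddCommGroupH10 (Ω : Set (Space n)) : NormedAddCommGroup (H10 Ω) :=
  inferInstanceAs (NormedAddCommGroup (H10Sub Ω))

/-- `H₀¹(Ω)` carries the `H¹` inner product `∫_Ω (v w + ∇v · ∇w) dx`. -/
instance instInnerProductSpaceH10 (Ω : Set (Space n)) : InnerProductSpace ℝ (H10 Ω) :=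
  inferInstanceAs (InnerProductSpace ℝ (H10Sub Ω))

/-- `H₀¹(Ω)` is complete. -/
instance instCompleteSpaceH10 (Ω : Set (Space n)) : CompleteSpace (H10 Ω) := by
  have h : IsClosed (H10Sub Ω : Set (PairSpace Ω)) := Submodule.isClosed_topologicalClosure _
  exact h.completeSpace_coe

/-- The dual space `H⁻¹(Ω)` of `H₀¹(Ω)`. -/
abbrev Hm1 (Ω : Set (Space n)) : Type := StrongDual ℝ (H10 Ω)

/-- The inclusion of `H₀¹(Ω)` into `L²(Ω) × L²(Ω; ℝⁿ)`, `v ↦ (v, ∇v)`. -/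
def toPair (Ω : Set (Space n)) : H10 Ω →L[ℝ] PairSpace Ω := (H10Sub Ω).subtypeL

/-- The embedding `H₀¹(Ω) → L²(Ω)`. -/
def toL2 (Ω : Set (Space n)) : H10 Ω →L[ℝ] L2Ω Ω :=
  (WithLp.fstL 2 ℝ (Lp ℝ 2 (volΩ Ω)) (Lp (Space n) 2 (volΩ Ω))).comp (toPair Ω)

/-- The weak gradient `H₀¹(Ω) → L²(Ω; ℝⁿ)`. -/
def grad (Ω : Set (Space n)) : H10 Ω →L[ℝ] Lp (Space n) 2 (volΩ Ω) :=
  (WithLp.sndL 2 ℝ (Lp ℝ 2 (volΩ Ω)) (Lp (Space n) 2 (volΩ Ω))).comp (toPair Ω)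

/-- The canonical embedding `L²(Ω) → H⁻¹(Ω)`, `g ↦ (v ↦ ∫_Ω g v dx)`. -/
def toHm1 (Ω : Set (Space n)) (g : L2Ω Ω) : Hm1 Ω := (innerSL ℝ g).comp (toL2 Ω)

/-- `Y` belongs to `W(0,T) = L²(0,T; H₀¹(Ω)) ∩ H¹(0,T; H⁻¹(Ω))`, and `Y'` is its distributional
time derivative, with values in `H⁻¹(Ω)`. -/
structure MemW (Ω : Set (Space n)) (T : ℝ) (Y : ℝ → H10 Ω) (Y' : ℝ → Hm1 Ω) : Prop where
  memLp : MemLp Y 2 (volT T)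
  memLp_deriv : MemLp Y' 2 (volT T)
  weak_deriv : ∀ φ : ℝ → ℝ, ContDiff ℝ (⊤ : ℕ∞) φ → HasCompactSupport φ → tsupport φ ⊆ Ioo 0 T →
    ∫ t in Ioo 0 T, deriv φ t • toHm1 Ω (toL2 Ω (Y t)) = - ∫ t in Ioo 0 T, φ t • Y' t

/-- The bilinear form `⟨A y, v⟩` of the operator
`A y = - ∑_{i,j} ∂_{x_j} (a_{ij} ∂_{x_i} y) + a₀ y` on `H₀¹(Ω)`. -/
def formA (Ω : Set (Space n)) (a : Fin n → Fin n → Space n → ℝ) (a₀ : Space n → ℝ)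
    (y v : H10 Ω) : ℝ :=
  ∫ x in Ω, ((∑ i, ∑ j, a i j x * grad Ω y x i * grad Ω v x j) + a₀ x * toL2 Ω y x * toL2 Ω v x)

/-- `y ∈ L²(Q)` is a solution in `W(0,T)` of
`∂ₜ y + A y + f(y) = u` in `Q`, `y = 0` on `∂Ω × (0,T)`, `y(·,0) = y₀` in `Ω`.
The curve `t ↦ y(·,t)` is `Y`, and `Y'` is its time derivative. The equation holds in `H⁻¹(Ω)` for
almost every `t`, the boundary condition is contained in `H₀¹(Ω)`, and the initial
condition is that of the representative of `y` in `C([0,T]; L²(Ω))`. -/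
structure IsSolution (Ω : Set (Space n)) (T : ℝ) (a : Fin n → Fin n → Space n → ℝ)
    (a₀ : Space n → ℝ) (f : ℝ → ℝ) (y₀ : Space n → ℝ) (u y : L2Q Ω T) : Prop where
  memLp_f : MemLp (fun z => f (y z)) 2 (volQ Ω T)
  exists_curve : ∃ (Y : ℝ → H10 Ω) (Y' : ℝ → Hm1 Ω), MemW Ω T Y Y' ∧
    (∀ᵐ t ∂volT T, ∀ᵐ x ∂volΩ Ω, y (x, t) = toL2 Ω (Y t) x) ∧
    (∀ᵐ t ∂volT T, ∀ v : H10 Ω,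
      Y' t v + formA Ω a a₀ (Y t) v + ∫ x in Ω, f (y (x, t)) * toL2 Ω v x
        = ∫ x in Ω, u (x, t) * toL2 Ω v x) ∧
    ∃ c : ℝ → L2Ω Ω, ContinuousOn c (Icc 0 T) ∧ (∀ᵐ t ∂volT T, c t = toL2 Ω (Y t)) ∧
      c 0 =ᵐ[volΩ Ω] y₀

/-- The state `y_u` associated with the control `u`: the solution of the state equation
(an arbitrary function if there is none). -/
def state (Ω : Set (Space n)) (T : ℝ) (a : Fin n → Fin n → Space n → ℝ)
    (a₀ : Space n → ℝ) (f : ℝ → ℝ) (y₀ : Space n → ℝ) (u : L2Q Ω T) : L2Q Ω T :=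
  Classical.epsilon fun y => IsSolution Ω T a a₀ f y₀ u y

/-- The reduced cost `J(u) = ½ ∫_Q [(y_u - y_d)² + α u²] dx dt`. -/
def cost (Ω : Set (Space n)) (T : ℝ) (a : Fin n → Fin n → Space n → ℝ)
    (a₀ : Space n → ℝ) (f : ℝ → ℝ) (y₀ : Space n → ℝ) (yd : Space n × ℝ → ℝ) (α : ℝ)
    (u : L2Q Ω T) : ℝ :=
  (1 / 2 : ℝ) * ∫ z in Ω ×ˢ Ioo 0 T,
    ((state Ω T a a₀ f y₀ u z - yd z) ^ 2 + α * (u z) ^ 2)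

/-- The mixed-norm space `L^p(0,T; L^q(Ω))` of measurable functions on `Q`. -/
def MemMixedLp (Ω : Set (Space n)) (T : ℝ) (p q : ℝ≥0∞) (g : Space n × ℝ → ℝ) : Prop :=
  AEStronglyMeasurable g (volQ Ω T) ∧
    eLpNorm (fun t => eLpNorm (fun x => g (x, t)) q (volΩ Ω)) p (volT T) < ∞

end ParabolicControl

end

open ParabolicControl

/-!
Solutions of the state equation are obtained as limits of the implicit Euler scheme. Since
`f + Λ id` is nondecreasing, it can be approximated uniformly on bounded sets by smooth,
nondecreasing, globally Lipschitz functions `g` (`exists_smooth_approx`), and for such a `g` each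
step of the scheme is a strongly monotone equation in `H₀¹(Ω)` (`exists_eq_of_stronglyMonotone`).
Testing with the solution and a discrete Gronwall argument bound it in `L²(0,T; H₀¹(Ω))` and in
`L^∞(0,T; L²(Ω))`. Testing with `g(y)`, which lies in `H₀¹(Ω)` and pairs nonnegatively with the
elliptic form (`exists_comp`), bounds the nonlinear term in `L²(Q)` through the convex potential
`∫ G(y)`, which is finite at the initial time because `y₀` is bounded. All these bounds are uniform
in the approximation and in the control on bounded sets (`exists_euler_approx`,
`exists_uniform_isApprox`), without any growth condition on `f`.

For compactness, Friedrichs' inequality (`friedrichs`) reduces strong convergence in `L²(Q)` to the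
weak convergence in `L²(Ω)` of almost every time slice (`cauchySeq_of_tendsto_inner_slice`). The
latter follows from the equation in integrated form, whose integrands converge weakly along a
subsequence. Almost everywhere convergence then identifies the weak limit of the nonlinear terms, so
that the limit solves the equation (`exists_subseq_tendsto_isSolution`); this argument allows the
controls to converge only weakly.

The Hilbert space `H⁻¹(Ω)` is identified with `H₀¹(Ω)` by Riesz' theorem, so a curve in `W(0,T)` is
a curve `Y` in a Hilbert space `V` with a map `ι : V → H` such that `ι† ι Y` has an integrable
derivative. Steklov averages give the energy identity (`energy_identity`) and from it the
representative that is continuous with values in `H` (`exists_continuous_representative`). The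
energy identity for a difference of solutions, the one-sided bound on `f'` and Gronwall's inequality
give uniqueness (`IsSolution.unique`).

The optimal control is found by the direct method (`exists_optimal_control`). The controls of a
minimizing sequence are bounded because `α > 0`, hence converge weakly along a subsequence. The
states are replaced by approximate solutions at vanishing distance, so that the compactness result
gives strong convergence of the states, and the norm of the controls is weakly lower semicontinuous.
-/

open Filter Topology InnerProductSpace
open scoped NNReal

namespace ParabolicControl

/-! ### Weak convergence and monotone maps in Hilbert spaces -/

section Hilbert

variable {E : Type*} [NormedAddCommGroup E] [InnerProductSpace ℝ E]

/-- A bounded sequence in a real Hilbert space has a weakly convergent subsequence. Passing to the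
closed span of the sequence, which is separable, removes any separability assumption. -/
theorem exists_subseq_tendsto_inner [CompleteSpace E] {x : ℕ → E} {C : ℝ} (hx : ∀ k, ‖x k‖ ≤ C) :
    ∃ (z : E) (φ : ℕ → ℕ), StrictMono φ ∧
      ∀ w : E, Tendsto (fun k => ⟪x (φ k), w⟫_ℝ) atTop (𝓝 ⟪z, w⟫_ℝ) := by
  let K : Submodule ℝ E := (Submodule.span ℝ (range x)).topologicalClosure
  have hKsep : TopologicalSpace.SeparableSpace K := by
    have : TopologicalSpace.IsSeparable (K : Set E) := by
      have h1 : TopologicalSpace.IsSeparable (range x) :=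
        (countable_range x).isSeparable
      exact (h1.span (R := ℝ)).closure
    exact this.separableSpace
  have hKc : IsClosed (K : Set E) := Submodule.isClosed_topologicalClosure _
  have : CompleteSpace K := hKc.completeSpace_coe
  have hmem : ∀ k, x k ∈ K := fun k =>
    Submodule.le_topologicalClosure _ (Submodule.subset_span (mem_range_self k))
  let xK : ℕ → K := fun k => ⟨x k, hmem k⟩
  let ℓ : ℕ → WeakDual ℝ K := fun k => StrongDual.toWeakDual (InnerProductSpace.toDual ℝ K (xK k))
  have hball : ∀ k, ℓ k ∈ (WeakDual.toStrongDual ⁻¹'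
      Metric.closedBall (0 : StrongDual ℝ K) C : Set (WeakDual ℝ K)) := by
    intro k
    have : ‖InnerProductSpace.toDual ℝ K (xK k)‖ ≤ C := by
      rw [LinearIsometryEquiv.norm_map]; exact hx k
    exact mem_closedBall_zero_iff.2 this
  obtain ⟨a, -, φ, hφ, hlim⟩ := WeakDual.isSeqCompact_closedBall ℝ K (0 : StrongDual ℝ K) C hball
  refine ⟨((InnerProductSpace.toDual ℝ K).symm (WeakDual.toStrongDual a) : K), φ, hφ, fun w => ?_⟩
  have hproj : ∀ v : K, ⟪(v : E), w⟫_ℝ = ⟪v, K.orthogonalProjectionOnto w⟫_ℝ := fun v => by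
    rw [Submodule.coe_inner, ← Submodule.starProjection_apply,
      ← Submodule.inner_starProjection_left_eq_right,
      Submodule.starProjection_eq_self_iff.2 v.2]
  have h2 := ((WeakDual.eval_continuous (K.orthogonalProjectionOnto w)).tendsto a).comp hlim
  rw [hproj, InnerProductSpace.toDual_symm_apply]
  refine h2.congr fun k => ?_
  change ⟪xK (φ k), _⟫_ℝ = _
  rw [← hproj]

/-- Weak lower semicontinuity of the norm. -/
theorem norm_le_of_tendsto_inner {x : ℕ → E} {z : E} {r : ℕ → ℝ} {R : ℝ}
    (hx : Tendsto (fun k => ⟪x k, z⟫_ℝ) atTop (𝓝 ⟪z, z⟫_ℝ)) (hr : ∀ k, ‖x k‖ ≤ r k)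
    (hR : Tendsto r atTop (𝓝 R)) : ‖z‖ ≤ R := by
  have h1 : ⟪z, z⟫_ℝ ≤ R * ‖z‖ := le_of_tendsto_of_tendsto' hx (hR.mul_const ‖z‖) fun k =>
    (real_inner_le_norm _ _).trans (mul_le_mul_of_nonneg_right (hr k) (norm_nonneg _))
  rw [real_inner_self_eq_norm_sq] at h1
  rcases (norm_nonneg z).eq_or_lt with h | h
  · rw [← h]
    exact ge_of_tendsto' hR fun k => (norm_nonneg _).trans (hr k)
  · nlinarith

/-- Weak convergence of a bounded sequence can be tested on a dense set. -/
theorem tendsto_inner_of_dense {x : ℕ → E} {z : E} {C : ℝ} (hx : ∀ k, ‖x k‖ ≤ C) {S : Set E}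
    (hS : Dense S) (h : ∀ w ∈ S, Tendsto (fun k => ⟪x k, w⟫_ℝ) atTop (𝓝 ⟪z, w⟫_ℝ)) (w : E) :
    Tendsto (fun k => ⟪x k, w⟫_ℝ) atTop (𝓝 ⟪z, w⟫_ℝ) := by
  rw [Metric.tendsto_atTop]
  intro ε hε
  have hC : 0 ≤ C := (norm_nonneg _).trans (hx 0)
  have hD : 0 < C + ‖z‖ + 1 := by positivity
  obtain ⟨v, hvS, hv⟩ := Metric.dense_iff.1 hS w (ε / 2 / (C + ‖z‖ + 1)) (by positivity)
  have hwv : ‖w - v‖ < ε / 2 / (C + ‖z‖ + 1) := by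
    simpa [dist_eq_norm, norm_sub_rev] using hvS
  obtain ⟨N, hN⟩ := Metric.tendsto_atTop.1 (h v hv) (ε / 2) (by positivity)
  refine ⟨N, fun k hk => ?_⟩
  have h1 := hN k hk
  rw [Real.dist_eq] at h1 ⊢
  have h2 : ⟪x k, w⟫_ℝ - ⟪z, w⟫_ℝ = (⟪x k, v⟫_ℝ - ⟪z, v⟫_ℝ) + ⟪x k - z, w - v⟫_ℝ := by
    simp only [inner_sub_left, inner_sub_right]; ring
  have h3 : |⟪x k - z, w - v⟫_ℝ| ≤ (C + ‖z‖) * ‖w - v‖ := by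
    refine (abs_real_inner_le_norm _ _).trans (mul_le_mul_of_nonneg_right ?_ (norm_nonneg _))
    exact (norm_sub_le _ _).trans (by linarith [hx k])
  have h4 : (C + ‖z‖) * ‖w - v‖ ≤ ε / 2 := by
    rw [lt_div_iff₀ hD] at hwv
    nlinarith [norm_nonneg (w - v)]
  rw [h2]
  exact (abs_add_le _ _).trans_lt (by linarith)

/-- The pairing of a bounded weakly convergent and a strongly convergent sequence converges. -/
theorem tendsto_inner_of_tendsto {x w : ℕ → E} {z v : E} {C : ℝ} (hC : ∀ k, ‖x k‖ ≤ C)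
    (hx : ∀ w, Tendsto (fun k => ⟪x k, w⟫_ℝ) atTop (𝓝 ⟪z, w⟫_ℝ)) (hw : Tendsto w atTop (𝓝 v)) :
    Tendsto (fun k => ⟪x k, w k⟫_ℝ) atTop (𝓝 ⟪z, v⟫_ℝ) := by
  have h1 : Tendsto (fun k => ⟪x k, w k - v⟫_ℝ) atTop (𝓝 0) := by
    have h2 : Tendsto (fun k => C * ‖w k - v‖) atTop (𝓝 0) := by
      have h3 := (hw.sub_const v).norm.const_mul C
      rwa [sub_self, norm_zero, mul_zero] at h3
    exact squeeze_zero_norm (fun k => (norm_inner_le_norm _ _).trans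
      (mul_le_mul_of_nonneg_right (hC k) (norm_nonneg _))) h2
  have h4 := h1.add (hx v)
  rw [zero_add] at h4
  refine h4.congr fun k => ?_
  rw [inner_sub_right, sub_add_cancel]

/-- **Zarantonello's theorem**: a Lipschitz continuous and strongly monotone map of a Hilbert space
into itself is surjective, because `x ↦ x - ρ (N x - w)` is a contraction for small `ρ`. -/
theorem exists_eq_of_stronglyMonotone [CompleteSpace E] {N : E → E} {L m : ℝ} (hm : 0 < m)
    (hL : ∀ x y, ‖N x - N y‖ ≤ L * ‖x - y‖)
    (hmono : ∀ x y, m * ‖x - y‖ ^ 2 ≤ ⟪N x - N y, x - y⟫_ℝ) (w : E) : ∃ x, N x = w := by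
  -- enlarging the Lipschitz constant makes the contraction factor `1 - m² / M²` lie in `[0, 1)`
  obtain ⟨M, hM1, hMm, hMpos⟩ : ∃ M : ℝ, L ≤ M ∧ m ≤ M ∧ 0 < M :=
    ⟨max L m, le_max_left _ _, le_max_right _ _, hm.trans_le (le_max_right _ _)⟩
  have hM : ∀ x y, ‖N x - N y‖ ≤ M * ‖x - y‖ := fun x y =>
    (hL x y).trans (mul_le_mul_of_nonneg_right hM1 (norm_nonneg _))
  set ρ : ℝ := m / M ^ 2 with hρ
  set κ : ℝ := 1 - m ^ 2 / M ^ 2 with hκ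
  have hκ0 : 0 ≤ κ := by
    rw [hκ, sub_nonneg, div_le_one (by positivity)]
    exact pow_le_pow_left₀ hm.le hMm 2
  have hκ1 : κ < 1 := by
    have : 0 < m ^ 2 / M ^ 2 := by positivity
    linarith
  let Φ : E → E := fun x => x - ρ • (N x - w)
  have hΦ : ∀ x y, ‖Φ x - Φ y‖ ^ 2 ≤ κ * ‖x - y‖ ^ 2 := by
    intro x y
    have e : Φ x - Φ y = (x - y) - ρ • (N x - N y) := by
      simp only [Φ, smul_sub]; abel
    have hρ0 : 0 ≤ ρ := by positivity
    have h1 : ‖N x - N y‖ ^ 2 ≤ M ^ 2 * ‖x - y‖ ^ 2 := by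
      rw [← mul_pow]; exact pow_le_pow_left₀ (norm_nonneg _) (hM x y) 2
    rw [e, norm_sub_sq_real, inner_smul_right, norm_smul, mul_pow, Real.norm_eq_abs, sq_abs,
      real_inner_comm]
    have h2 := mul_le_mul_of_nonneg_left (hmono x y) hρ0
    have h3 := mul_le_mul_of_nonneg_left h1 (sq_nonneg ρ)
    have e1 : ρ * m = m ^ 2 / M ^ 2 := by rw [hρ]; ring
    have e2 : ρ ^ 2 * M ^ 2 = m ^ 2 / M ^ 2 := by rw [hρ]; field_simp
    rw [← mul_assoc, e1] at h2
    rw [← mul_assoc, e2] at h3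
    rw [hκ]
    linarith
  have hc : ContractingWith (Real.toNNReal (Real.sqrt κ)) Φ := by
    refine ⟨?_, LipschitzWith.of_dist_le_mul fun x y => ?_⟩
    · rw [Real.toNNReal_lt_one, Real.sqrt_lt' one_pos]
      simpa using hκ1
    · rw [dist_eq_norm, dist_eq_norm, Real.coe_toNNReal _ (Real.sqrt_nonneg _)]
      refine le_of_sq_le_sq ?_ (by positivity)
      rw [mul_pow, Real.sq_sqrt hκ0]
      exact hΦ x y
  refine ⟨hc.fixedPoint, ?_⟩
  have h := hc.fixedPoint_isFixedPt
  have h' : ρ • (N hc.fixedPoint - w) = 0 := by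
    have h0 : hc.fixedPoint - ρ • (N hc.fixedPoint - w) = hc.fixedPoint := h
    simpa using h0
  have hρ0 : ρ ≠ 0 := by positivity
  exact sub_eq_zero.1 ((smul_eq_zero.1 h').resolve_left hρ0)

end Hilbert

/-! ### Primitives and weak derivatives in time -/

section Time

theorem intervalIntegrable_of_integrable_volT {E : Type*} [NormedAddCommGroup E] {T : ℝ}
    {z : ℝ → E} (hz : Integrable z (volT T)) {s t : ℝ} (hs : s ∈ Icc 0 T) (ht : t ∈ Icc 0 T) :
    IntervalIntegrable z volume s t := by
  have h1 : IntegrableOn z (Ioc 0 T) := (integrableOn_Ioc_iff_integrableOn_Ioo (by simp)).2 hz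
  have h2 : IntervalIntegrable z volume 0 T :=
    (intervalIntegrable_iff_integrableOn_Ioc_of_le (hs.1.trans hs.2)).2 h1
  refine h2.mono_set ?_
  rw [uIcc_of_le (hs.1.trans hs.2)]
  exact uIcc_subset_Icc hs ht

theorem volT_integral_eq {E : Type*} [NormedAddCommGroup E] [NormedSpace ℝ E] {T : ℝ} (hT : 0 ≤ T)
    (z : ℝ → E) : ∫ t, z t ∂volT T = ∫ t in (0 : ℝ)..T, z t := by
  rw [intervalIntegral.integral_of_le hT, integral_Ioc_eq_integral_Ioo]

theorem intervalIntegral_congr_volT {E : Type*} [NormedAddCommGroup E] [NormedSpace ℝ E] {T : ℝ}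
    {F G : ℝ → E} (h : F =ᵐ[volT T] G) {s t : ℝ} (hs : 0 ≤ s) (hst : s ≤ t) (ht : t ≤ T) :
    ∫ r in s..t, F r = ∫ r in s..t, G r := by
  rw [intervalIntegral.integral_of_le hst, intervalIntegral.integral_of_le hst,
    integral_Ioc_eq_integral_Ioo, integral_Ioc_eq_integral_Ioo]
  exact integral_congr_ae (ae_mono (Measure.restrict_mono (Ioo_subset_Ioo hs ht) le_rfl) h)

theorem continuousOn_primitive_volT {E : Type*} [NormedAddCommGroup E] [NormedSpace ℝ E] {T : ℝ}
    (hT : 0 ≤ T) {z : ℝ → E} (hz : Integrable z (volT T)) :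
    ContinuousOn (fun t => ∫ r in (0 : ℝ)..t, z r) (Icc 0 T) := by
  have h1 : IntegrableOn z (uIcc 0 T) := by
    rw [uIcc_of_le hT]
    exact (integrableOn_Icc_iff_integrableOn_Ioo (by simp) (by simp)).2 hz
  have := intervalIntegral.continuousOn_primitive_interval h1
  rwa [uIcc_of_le hT] at this

/-- Integration by parts of a primitive of an integrable function against a test function. -/
theorem integral_deriv_mul_primitive {T : ℝ} (hT : 0 < T) {z : ℝ → ℝ} (hz : Integrable z (volT T))
    (p₀ : ℝ) {φ : ℝ → ℝ} (hφ : ContDiff ℝ (⊤ : ℕ∞) φ) (hφs : tsupport φ ⊆ Ioo 0 T) :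
    ∫ t, deriv φ t * (p₀ + ∫ r in (0 : ℝ)..t, z r) ∂volT T = -∫ t, φ t * z t ∂volT T := by
  have hz' : IntervalIntegrable z volume 0 T :=
    intervalIntegrable_of_integrable_volT hz ⟨le_rfl, hT.le⟩ ⟨hT.le, le_rfl⟩
  set P : ℝ → ℝ := fun t => p₀ + ∫ r in (0 : ℝ)..t, z r with hP
  have hPac : AbsolutelyContinuousOnInterval P 0 T := by
    have h1 := hz'.absolutelyContinuousOnInterval_intervalIntegral (c := 0) (by simp)
    have h2 : AbsolutelyContinuousOnInterval (fun _ : ℝ => p₀) 0 T :=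
      contDiffOn_const.absolutelyContinuousOnInterval
    exact h2.add h1
  have hφac : AbsolutelyContinuousOnInterval φ 0 T :=
    (hφ.of_le (by exact_mod_cast le_top)).contDiffOn.absolutelyContinuousOnInterval
  have h0 : φ 0 = 0 := image_eq_zero_of_notMem_tsupport fun h => (hφs h).1.false
  have h1 : φ T = 0 := image_eq_zero_of_notMem_tsupport fun h => (hφs h).2.false
  have hparts := AbsolutelyContinuousOnInterval.integral_mul_deriv_eq_deriv_mul hφac hPac
  rw [h0, h1] at hparts
  have hd : ∫ x in (0 : ℝ)..T, φ x * deriv P x = ∫ x in (0 : ℝ)..T, φ x * z x := by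
    refine intervalIntegral.integral_congr_ae ?_
    filter_upwards [hz'.ae_hasDerivAt_integral] with x hx hxm
    have := ((hx (uIoc_subset_uIcc hxm)) 0 (by simp)).const_add p₀
    rw [show deriv P x = z x from this.deriv]
  rw [volT_integral_eq hT.le, volT_integral_eq hT.le, ← hd, hparts]
  ring

/-- A continuous function on `[0, T]` whose weak derivative vanishes is constant. -/
theorem eqOn_const_of_integral_deriv_mul_eq_zero {T : ℝ} (hT : 0 < T) {w : ℝ → ℝ}
    (hw : ContinuousOn w (Icc 0 T))
    (h : ∀ φ : ℝ → ℝ, ContDiff ℝ (⊤ : ℕ∞) φ → HasCompactSupport φ → tsupport φ ⊆ Ioo 0 T →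
      ∫ t, deriv φ t * w t ∂volT T = 0) : ∃ C, ∀ t ∈ Icc 0 T, w t = C := by
  have hwi : IntegrableOn w (Ioo 0 T) :=
    (hw.integrableOn_compact isCompact_Icc).mono_set Ioo_subset_Icc_self
  let b : ContDiffBump (T / 2) := ⟨T / 8, T / 4, by positivity, by linarith⟩
  set η : ℝ → ℝ := b.normed volume with hη
  have hηc : ContDiff ℝ (⊤ : ℕ∞) η := b.contDiff_normed
  have hηs : HasCompactSupport η := b.hasCompactSupport_normed
  have hηt : tsupport η ⊆ Icc (T / 4) (3 * T / 4) := by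
    rw [hη, b.tsupport_normed_eq, Real.closedBall_eq_Icc]
    exact Icc_subset_Icc (by simp only [b]; linarith) (by simp only [b]; linarith)
  have hηi : ∫ t, η t = 1 := b.integral_normed
  set C : ℝ := ∫ t, η t * w t ∂volT T with hC
  refine ⟨C, ?_⟩
  have key : ∀ᵐ t, t ∈ Ioo 0 T → w t - C = 0 := by
    refine isOpen_Ioo.ae_eq_zero_of_integral_contDiff_smul_eq_zero ?_ fun ψ hψ hψs hψt => ?_
    · exact (hwi.sub (integrableOn_const (by simp))).locallyIntegrableOn
    have hψint : Integrable ψ := hψ.continuous.integrable_of_hasCompactSupport hψs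
    have hηint : Integrable η := hηc.continuous.integrable_of_hasCompactSupport hηs
    set m : ℝ := ∫ t, ψ t with hm
    set φ : ℝ → ℝ := fun x => ∫ t in (0 : ℝ)..x, (ψ t - m * η t) with hφ
    have hcont : Continuous fun t => ψ t - m * η t :=
      hψ.continuous.sub (continuous_const.mul hηc.continuous)
    have hder : ∀ x, HasDerivAt φ (ψ x - m * η x) x := fun x =>
      intervalIntegral.integral_hasDerivAt_right (hcont.intervalIntegrable _ _)
        (hcont.stronglyMeasurableAtFilter _ _) hcont.continuousAt
    have hφd : deriv φ = fun x => ψ x - m * η x := funext fun x => (hder x).deriv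
    have hφc : ContDiff ℝ (⊤ : ℕ∞) φ := by
      refine contDiff_infty_iff_deriv.2 ⟨fun x => (hder x).differentiableAt, ?_⟩
      rw [hφd]
      exact hψ.sub (contDiff_const.mul hηc)
    -- a compact interval inside `(0, T)` containing both supports
    obtain ⟨a, c, ha, hc, hac⟩ : ∃ a c, 0 < a ∧ c < T ∧
        ∀ t, t ∉ Icc a c → ψ t = 0 ∧ η t = 0 := by
      have hKc : IsCompact (tsupport ψ ∪ Icc (T / 4) (3 * T / 4)) :=
        IsCompact.union hψs isCompact_Icc
      have hKn : (tsupport ψ ∪ Icc (T / 4) (3 * T / 4)).Nonempty :=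
        ⟨T / 2, Or.inr ⟨by linarith, by linarith⟩⟩
      have hKs : tsupport ψ ∪ Icc (T / 4) (3 * T / 4) ⊆ Ioo 0 T :=
        union_subset hψt fun t ht => ⟨by linarith [ht.1], by linarith [ht.2]⟩
      refine ⟨sInf _, sSup _, (hKs (hKc.sInf_mem hKn)).1, (hKs (hKc.sSup_mem hKn)).2, ?_⟩
      intro t ht
      have hn : t ∉ tsupport ψ ∪ Icc (T / 4) (3 * T / 4) := fun hmem =>
        ht ⟨csInf_le hKc.bddBelow hmem, le_csSup hKc.bddAbove hmem⟩
      exact ⟨image_eq_zero_of_notMem_tsupport fun h' => hn (Or.inl h'),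
        image_eq_zero_of_notMem_tsupport fun h' => hn (Or.inr (hηt h'))⟩
    have hzero : ∀ x, x ∉ Icc a c → φ x = 0 := by
      intro x hx
      rw [mem_Icc, not_and_or, not_le, not_le] at hx
      rcases hx with hx | hx
      · have : ∀ t ∈ uIcc 0 x, ψ t - m * η t = 0 := fun t ht => by
          have : t < a := by
            rcases le_total 0 x with h0 | h0
            · rw [uIcc_of_le h0] at ht; exact ht.2.trans_lt hx
            · rw [uIcc_of_ge h0] at ht; exact ht.2.trans_lt ha
          have h2 := hac t fun h' => this.not_ge h'.1
          rw [h2.1, h2.2, mul_zero, sub_zero]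
        rw [hφ]
        simp only
        rw [intervalIntegral.integral_congr (g := fun _ => 0) this, intervalIntegral.integral_zero]
      · have hsupp : Function.support (fun t => ψ t - m * η t) ⊆ Ioc 0 x := by
          intro t ht
          by_contra hcon
          have h2 := hac t fun h' => hcon ⟨ha.trans_le h'.1, h'.2.trans hx.le⟩
          exact ht (by simp only; rw [h2.1, h2.2, mul_zero, sub_zero])
        rw [hφ]
        simp only
        rw [intervalIntegral.integral_eq_integral_of_support_subset hsupp,
          integral_sub hψint (hηint.const_mul m), integral_const_mul, hηi, mul_one, sub_self]
    have hts : tsupport φ ⊆ Icc a c :=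
      closure_minimal (fun x hx => by_contra fun h' => hx (hzero x h')) isClosed_Icc
    have hfin := h φ hφc (isCompact_Icc.of_isClosed_subset (isClosed_tsupport _) hts)
      (hts.trans fun t ht => ⟨ha.trans_le ht.1, ht.2.trans_lt hc⟩)
    rw [hφd] at hfin
    have hbound : ∀ {ζ : ℝ → ℝ}, Continuous ζ → Integrable (fun t => ζ t * w t) (volT T) := by
      intro ζ hζ
      have : ContinuousOn (fun t => ζ t * w t) (Icc 0 T) := hζ.continuousOn.mul hw
      exact (this.integrableOn_compact isCompact_Icc).mono_set Ioo_subset_Icc_self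
    have e1 : ∫ t, (ψ t - m * η t) * w t ∂volT T
        = (∫ t, ψ t * w t ∂volT T) - m * C := by
      rw [hC, ← integral_const_mul, ← integral_sub (hbound hψ.continuous)
        ((hbound hηc.continuous).const_mul m)]
      exact integral_congr_ae (Eventually.of_forall fun t => by simp only; ring)
    have e2 : ∫ t, ψ t • (w t - C) = ∫ t, ψ t * (w t - C) ∂volT T := by
      refine (setIntegral_eq_integral_of_forall_compl_eq_zero fun t ht => ?_).symm
      rw [image_eq_zero_of_notMem_tsupport fun h' => ht (hψt h'), zero_smul]
    have e3 : ∫ t, ψ t ∂volT T = m := by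
      refine setIntegral_eq_integral_of_forall_compl_eq_zero fun t ht => ?_
      exact image_eq_zero_of_notMem_tsupport fun h' => ht (hψt h')
    rw [e2]
    simp only [mul_sub]
    rw [integral_sub (hbound hψ.continuous) (hψint.restrict.mul_const C), integral_mul_const, e3]
    linarith
  have hae : w =ᵐ[volume.restrict (Icc 0 T)] fun _ => C := by
    rw [← Measure.restrict_congr_set (Ioo_ae_eq_Icc (a := 0) (b := T))]
    refine (ae_restrict_iff' measurableSet_Ioo).2 ?_
    filter_upwards [key] with t ht h'
    exact sub_eq_zero.1 (ht h')
  exact Measure.eqOn_Icc_of_ae_eq volume hT.ne hae hw continuousOn_const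

/-- A continuous function with integrable weak derivative is the primitive of that derivative. -/
theorem eq_add_primitive_of_weak_deriv {T : ℝ} (hT : 0 < T) {m z : ℝ → ℝ}
    (hm : ContinuousOn m (Icc 0 T)) (hz : Integrable z (volT T))
    (h : ∀ φ : ℝ → ℝ, ContDiff ℝ (⊤ : ℕ∞) φ → HasCompactSupport φ → tsupport φ ⊆ Ioo 0 T →
      ∫ t, deriv φ t * m t ∂volT T = -∫ t, φ t * z t ∂volT T) :
    ∀ t ∈ Icc 0 T, m t = m 0 + ∫ r in (0 : ℝ)..t, z r := by
  have hP := continuousOn_primitive_volT hT.le hz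
  obtain ⟨C, hC⟩ := eqOn_const_of_integral_deriv_mul_eq_zero hT (hm.sub hP) fun φ h1 h2 h3 => by
    have hb : ∀ {w : ℝ → ℝ}, ContinuousOn w (Icc 0 T) →
        Integrable (fun t => deriv φ t * w t) (volT T) := by
      intro w hw
      have hd : Continuous (deriv φ) := h1.continuous_deriv (by simp)
      exact ((hd.continuousOn.mul hw).integrableOn_compact isCompact_Icc).mono_set
        Ioo_subset_Icc_self
    have h4 := integral_deriv_mul_primitive hT hz 0 h1 h3
    simp only [zero_add] at h4
    simp only [mul_sub, Pi.sub_apply]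
    rw [integral_sub (hb hm) (hb hP), h φ h1 h2 h3, h4, sub_self]
  intro t ht
  have h0 := hC 0 ⟨le_rfl, hT.le⟩
  have h1 := hC t ht
  simp only [Pi.sub_apply, intervalIntegral.integral_same, sub_zero] at h0 h1
  linarith

end Time

/-! ### The energy identity by Steklov averages -/

section Energy

variable {V : Type*} [NormedAddCommGroup V] [InnerProductSpace ℝ V]

theorem integrable_inner_of_memLp {α : Type*} [MeasurableSpace α] {μ : Measure α} {Y Z : α → V}
    (hY : MemLp Y 2 μ) (hZ : MemLp Z 2 μ) : Integrable (fun t => ⟪Y t, Z t⟫_ℝ) μ := by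
  refine (L2.integrable_inner (𝕜 := ℝ) (hY.toLp Y) (hZ.toLp Z)).congr ?_
  filter_upwards [hY.coeFn_toLp, hZ.coeFn_toLp] with t h1 h2
  rw [h1, h2]

/-- Continuity of translations in `L²`, in the form of joint continuity of correlations. -/
theorem continuous_integral_inner_translate {Y Z : ℝ → V} (hY : MemLp Y 2 volume)
    (hZ : MemLp Z 2 volume) (s t : ℝ) :
    Continuous fun p : ℝ × ℝ => ∫ r in Ioc s t, ⟪Y (r - p.1), Z (r - p.2)⟫_ℝ := by
  let τ : ℝ → C(ℝ, ℝ) := fun a => ⟨fun r => r - a, continuous_id.sub continuous_const⟩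
  have hτ : Continuous τ :=
    ContinuousMap.continuous_of_continuous_uncurry τ (continuous_snd.sub continuous_fst)
  have hτm : ∀ a, MeasurePreserving (τ a) volume volume := fun a =>
    measurePreserving_sub_right volume a
  let R := LpToLpRestrictCLM ℝ V ℝ volume 2 (Ioc s t)
  have hc : ∀ {W : ℝ → V} (hW : MemLp W 2 volume), Continuous fun a : ℝ =>
      R (Lp.compMeasurePreserving (τ a) (hτm a) (hW.toLp W)) := fun hW =>
    R.continuous.comp (continuous_const.compMeasurePreservingLp hτ hτm ENNReal.ofNat_ne_top)
  have hae : ∀ {W : ℝ → V} (hW : MemLp W 2 volume) (a : ℝ),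
      R (Lp.compMeasurePreserving (τ a) (hτm a) (hW.toLp W))
        =ᵐ[volume.restrict (Ioc s t)] fun r => W (r - a) := fun hW a => by
    refine (LpToLpRestrictCLM_coeFn ℝ _ _).trans (ae_restrict_of_ae ?_)
    rw [Lp.toLp_compMeasurePreserving]
    exact MemLp.coeFn_toLp _
  have h := (Continuous.inner (𝕜 := ℝ) ((hc hY).comp continuous_fst) ((hc hZ).comp continuous_snd))
  refine h.congr fun p => ?_
  simp only [Function.comp_apply]
  rw [L2.inner_def]
  refine integral_congr_ae ?_
  filter_upwards [hae hY p.1, hae hZ p.2] with r h1 h2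
  rw [h1, h2]

theorem abs_integral_inner_translate_le {Y Z : ℝ → V} (hY : MemLp Y 2 volume)
    (hZ : MemLp Z 2 volume) (s t a b : ℝ) :
    |∫ r in Ioc s t, ⟪Y (r - a), Z (r - b)⟫_ℝ| ≤
      (∫ r, ‖Y r‖ ^ 2) + ∫ r, ‖Z r‖ ^ 2 := by
  have hYi : Integrable (fun r => ‖Y r‖ ^ 2) := hY.integrable_norm_pow two_ne_zero
  have hZi : Integrable (fun r => ‖Z r‖ ^ 2) := hZ.integrable_norm_pow two_ne_zero
  have hYa := hYi.comp_sub_right a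
  have hZb := hZi.comp_sub_right b
  rw [← integral_sub_right_eq_self (fun r => ‖Y r‖ ^ 2) a,
    ← integral_sub_right_eq_self (fun r => ‖Z r‖ ^ 2) b, ← integral_add hYa hZb]
  have h1 : ‖∫ r in Ioc s t, ⟪Y (r - a), Z (r - b)⟫_ℝ‖ ≤
      ∫ r in Ioc s t, (‖Y (r - a)‖ ^ 2 + ‖Z (r - b)‖ ^ 2) := by
    refine norm_integral_le_of_norm_le (hYa.add hZb).restrict (Eventually.of_forall fun r => ?_)
    have h2 := abs_real_inner_le_norm (Y (r - a)) (Z (r - b))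
    rw [Real.norm_eq_abs]
    nlinarith [sq_nonneg (‖Y (r - a)‖ - ‖Z (r - b)‖), sq_nonneg (‖Y (r - a)‖ + ‖Z (r - b)‖)]
  refine h1.trans (setIntegral_le_integral (hYa.add hZb) (Eventually.of_forall fun r => ?_))
  simp only [Pi.zero_apply]
  positivity

/-- Fubini's theorem for the averages of translates of `Z`. -/
theorem integral_integral_translate_swap {W Z : ℝ → V} (hWm : StronglyMeasurable W)
    (hZm : StronglyMeasurable Z) (hW : MemLp W 2 volume) (hZ : MemLp Z 2 volume) (h s t : ℝ) :
    ∫ r in Ioc s t, ∫ θ in Ioc (0 : ℝ) 1, ⟪W r, Z (r - h * θ)⟫_ℝ =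
      ∫ θ in Ioc (0 : ℝ) 1, ∫ r in Ioc s t, ⟪W r, Z (r - h * θ)⟫_ℝ := by
  refine integral_integral_swap ?_
  have hWi : Integrable (fun r => ‖W r‖ ^ 2) := hW.integrable_norm_pow two_ne_zero
  have hZi : Integrable (fun r => ‖Z r‖ ^ 2) := hZ.integrable_norm_pow two_ne_zero
  have hmeas : Measurable fun q : ℝ × ℝ => q.1 - h * q.2 :=
    measurable_fst.sub (measurable_snd.const_mul h)
  have hZs : StronglyMeasurable fun q : ℝ × ℝ => Z (q.1 - h * q.2) := hZm.comp_measurable hmeas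
  have hWs : StronglyMeasurable fun q : ℝ × ℝ => W q.1 := hWm.comp_measurable measurable_fst
  have h1 : Integrable (fun q : ℝ × ℝ => ‖Z (q.1 - h * q.2)‖ ^ 2)
      ((volume : Measure ℝ).prod (volume.restrict (Ioc (0 : ℝ) 1))) := by
    refine (integrable_prod_iff' (hZs.norm.pow 2).aestronglyMeasurable).2 ⟨?_, ?_⟩
    · exact Eventually.of_forall fun θ => hZi.comp_sub_right (h * θ)
    · have e : ∀ θ : ℝ, ∫ r, ‖‖Z (r - h * θ)‖ ^ 2‖ = ∫ r, ‖Z r‖ ^ 2 := fun θ => by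
        simp only [norm_pow, norm_norm]
        exact integral_sub_right_eq_self (fun r => ‖Z r‖ ^ 2) (h * θ)
      exact (integrable_const (∫ r, ‖Z r‖ ^ 2)).congr (Eventually.of_forall fun θ => (e θ).symm)
  have h2 : Integrable (fun q : ℝ × ℝ => ‖W q.1‖ ^ 2)
      ((volume : Measure ℝ).prod (volume.restrict (Ioc (0 : ℝ) 1))) := by
    have := hWi.mul_prod (integrable_const (μ := volume.restrict (Ioc (0 : ℝ) 1)) (1 : ℝ))
    simpa using this
  have h3 : Integrable (Function.uncurry fun r θ : ℝ => ⟪W r, Z (r - h * θ)⟫_ℝ)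
      ((volume : Measure ℝ).prod (volume.restrict (Ioc (0 : ℝ) 1))) := by
    refine (h2.add h1).mono' (hWs.inner hZs).aestronglyMeasurable (Eventually.of_forall fun q => ?_)
    have h4 := abs_real_inner_le_norm (W q.1) (Z (q.1 - h * q.2))
    rw [Real.norm_eq_abs]
    simp only [Function.uncurry, Pi.add_apply]
    nlinarith [sq_nonneg (‖W q.1‖ - ‖Z (q.1 - h * q.2)‖),
      sq_nonneg (‖W q.1‖ + ‖Z (q.1 - h * q.2)‖)]
  refine h3.mono_measure ?_
  exact Measure.prod_mono Measure.restrict_le_self le_rfl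

variable {H : Type*} [NormedAddCommGroup H] [InnerProductSpace ℝ H]

/-- The energy identity for `ι Y` up to an additive constant. The difference quotient
`(‖ι Y(r)‖² - ‖ι Y(r - h)‖²) / h` is the mean over `θ ∈ (0, 1)` of
`⟪Y(r) + Y(r - h), Z(r - h θ)⟫`; integrating over `r` and letting `h → 0` gives the claim, by the
continuity of translations in `L²` and the Lebesgue differentiation theorem. -/
theorem energy_identity_aux [CompleteSpace V] (ι : V →L[ℝ] H) {T : ℝ} {Y Z : ℝ → V}
    (hYm : StronglyMeasurable Y) (hZm : StronglyMeasurable Z) (hY : MemLp Y 2 volume)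
    (hZ : MemLp Z 2 volume) (hZi : Integrable Z) (w₀ : V)
    (h : ∀ᵐ t ∂volT T, ∀ v, ⟪ι (Y t), ι v⟫_ℝ = ⟪w₀ + ∫ r in (0 : ℝ)..t, Z r, v⟫_ℝ) :
    ∀ᵐ s, s ∈ Ioo 0 T → ∀ᵐ t, t ∈ Ioo s T →
      ‖ι (Y t)‖ ^ 2 - ‖ι (Y s)‖ ^ 2 = 2 * ∫ r in s..t, ⟪Y r, Z r⟫_ℝ := by
  set e : ℝ → ℝ := fun r => ‖ι (Y r)‖ ^ 2 with he
  have hei : Integrable e := (ι.comp_memLp' hY).integrable_norm_pow two_ne_zero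
  have hLeb := LocallyIntegrable.ae_hasDerivAt_integral hei.locallyIntegrable
  have hI : ∀ᵐ r, r ∈ Ioo 0 T →
      ∀ v, ⟪ι (Y r), ι v⟫_ℝ = ⟪w₀ + ∫ r in (0 : ℝ)..r, Z r, v⟫_ℝ :=
    (ae_restrict_iff' measurableSet_Ioo).1 h
  filter_upwards [hLeb] with s hs hsI
  filter_upwards [hLeb] with t ht htI
  have hst : s ≤ t := htI.1.le
  let Φ : ℝ × ℝ → ℝ := fun p => ∫ r in Ioc s t, ⟪Y (r - p.1), Z (r - p.2)⟫_ℝ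
  have hΦ : Continuous Φ := continuous_integral_inner_translate hY hZ s t
  set F : ℝ → ℝ := fun x => ∫ r in (0 : ℝ)..x, e r with hF
  -- the limit of the difference quotients of the energy
  have lim1 : Tendsto (fun k : ℝ => k⁻¹ * ((F t - F (t - k)) - (F s - F (s - k)))) (𝓝[>] 0)
      (𝓝 (e t - e s)) := by
    have aux : ∀ {x : ℝ}, HasDerivAt F (e x) x →
        Tendsto (fun k : ℝ => k⁻¹ * (F x - F (x - k))) (𝓝[>] 0) (𝓝 (e x)) := by
      intro x hx
      have h1 := hx.tendsto_slope_zero_left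
      have h2 : Tendsto (fun k : ℝ => -k) (𝓝[>] 0) (𝓝[<] 0) := by
        have := tendsto_neg_nhdsGT (a := (0 : ℝ))
        rwa [neg_zero] at this
      refine (h1.comp h2).congr fun k => ?_
      simp only [Function.comp_apply, smul_eq_mul, ← sub_eq_add_neg, inv_neg]
      ring
    refine ((aux (ht 0)).sub (aux (hs 0))).congr fun k => ?_
    ring
  -- the same quotients as averages of correlations
  have lim2 : Tendsto (fun k : ℝ => (∫ θ in Ioc (0 : ℝ) 1, Φ (0, k * θ)) +
      ∫ θ in Ioc (0 : ℝ) 1, Φ (k, k * θ)) (𝓝[>] 0) (𝓝 (Φ (0, 0) + Φ (0, 0))) := by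
    have aux : ∀ b : ℝ → ℝ, Tendsto b (𝓝[>] 0) (𝓝 0) →
        Tendsto (fun k : ℝ => ∫ θ in Ioc (0 : ℝ) 1, Φ (b k, k * θ)) (𝓝[>] 0) (𝓝 (Φ (0, 0))) := by
      intro b hb
      have e0 : Φ (0, 0) = ∫ θ in Ioc (0 : ℝ) 1, Φ (0, 0) := by simp
      rw [e0]
      refine tendsto_integral_filter_of_dominated_convergence
        (fun _ => (∫ r, ‖Y r‖ ^ 2) + ∫ r, ‖Z r‖ ^ 2)
        (Eventually.of_forall fun k => ?_) (Eventually.of_forall fun k => ?_)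
        (integrable_const _) (Eventually.of_forall fun θ => ?_)
      · exact (hΦ.comp (continuous_const.prodMk
          (continuous_const.mul continuous_id))).aestronglyMeasurable
      · exact Eventually.of_forall fun θ => abs_integral_inner_translate_le hY hZ s t _ _
      · have h1 : Tendsto (fun k : ℝ => k * θ) (𝓝[>] 0) (𝓝 0) := by
          have : Tendsto (fun k : ℝ => k * θ) (𝓝 0) (𝓝 (0 * θ)) :=
            (continuous_id.mul continuous_const).tendsto 0
          rw [zero_mul] at this
          exact this.mono_left nhdsWithin_le_nhds
        exact (hΦ.tendsto (0, 0)).comp (hb.prodMk_nhds h1)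
    exact (aux (fun _ => 0) tendsto_const_nhds).add (aux id nhdsWithin_le_nhds)
  have hid : ∀ᶠ k in 𝓝[>] (0 : ℝ), (∫ θ in Ioc (0 : ℝ) 1, Φ (0, k * θ)) +
      (∫ θ in Ioc (0 : ℝ) 1, Φ (k, k * θ)) = k⁻¹ * ((F t - F (t - k)) - (F s - F (s - k))) := by
    filter_upwards [Ioo_mem_nhdsGT hsI.1] with k hk
    have hk0 : k ≠ 0 := hk.1.ne'
    have hZk : ∀ r : ℝ, IntegrableOn (fun θ : ℝ => Z (r - k * θ)) (Ioc 0 1) := fun r => by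
      have h1 : Integrable fun θ : ℝ => Z (r - k * θ) := by
        have h2 := (hZi.comp_sub_left r).comp_mul_left' hk0
        exact h2
      exact h1.integrableOn
    have hYk : MemLp (fun r => Y (r - k)) 2 volume :=
      hY.comp_measurePreserving (measurePreserving_sub_right volume k)
    have hsub : Measurable fun r : ℝ => r - k := measurable_id.sub_const k
    have s1 : (∫ θ in Ioc (0 : ℝ) 1, Φ (0, k * θ)) =
        ∫ r in Ioc s t, ∫ θ in Ioc (0 : ℝ) 1, ⟪Y r, Z (r - k * θ)⟫_ℝ := by
      rw [integral_integral_translate_swap hYm hZm hY hZ]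
      simp only [Φ, sub_zero]
    have s2 : (∫ θ in Ioc (0 : ℝ) 1, Φ (k, k * θ)) =
        ∫ r in Ioc s t, ∫ θ in Ioc (0 : ℝ) 1, ⟪Y (r - k), Z (r - k * θ)⟫_ℝ := by
      exact (integral_integral_translate_swap (hYm.comp_measurable hsub) hZm hYk hZ k s t).symm
    have p1 : ∀ (w : V) (r : ℝ), ∫ θ in Ioc (0 : ℝ) 1, ⟪w, Z (r - k * θ)⟫_ℝ =
        k⁻¹ * ⟪w, ∫ ρ in (r - k)..r, Z ρ⟫_ℝ := by
      intro w r
      rw [integral_inner (hZk r), ← intervalIntegral.integral_of_le zero_le_one,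
        intervalIntegral.integral_comp_sub_mul _ hk0, inner_smul_right]
      simp
    have hIk : ∀ᵐ r : ℝ, r - k ∈ Ioo 0 T →
        ∀ v, ⟪ι (Y (r - k)), ι v⟫_ℝ = ⟪w₀ + ∫ ρ in (0 : ℝ)..(r - k), Z ρ, v⟫_ℝ :=
      (measurePreserving_sub_right volume k).quasiMeasurePreserving.ae hI
    have hZint : ∀ a b : ℝ, IntervalIntegrable Z volume a b := fun a b => hZi.intervalIntegrable
    have hpt : ∀ᵐ r ∂volume.restrict (Ioc s t), k⁻¹ * (e r - e (r - k)) =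
        (∫ θ in Ioc (0 : ℝ) 1, ⟪Y r, Z (r - k * θ)⟫_ℝ) +
          ∫ θ in Ioc (0 : ℝ) 1, ⟪Y (r - k), Z (r - k * θ)⟫_ℝ := by
      refine (ae_restrict_iff' measurableSet_Ioc).2 ?_
      filter_upwards [hI, hIk] with r h1 h2 hr
      have h1' := h1 ⟨hsI.1.trans hr.1, hr.2.trans_lt htI.2⟩
      have h2' := h2 ⟨by linarith [hr.1, hk.2], by linarith [hr.2, htI.2, hk.1]⟩
      have hP : (∫ ρ in (r - k)..r, Z ρ) =
          (w₀ + ∫ ρ in (0 : ℝ)..r, Z ρ) - (w₀ + ∫ ρ in (0 : ℝ)..(r - k), Z ρ) := by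
        rw [← intervalIntegral.integral_add_adjacent_intervals (hZint 0 (r - k)) (hZint (r - k) r)]
        abel
      rw [p1, p1, ← mul_add, ← inner_add_left, hP, inner_sub_right,
        real_inner_comm _ (Y r + Y (r - k)), real_inner_comm _ (Y r + Y (r - k)), ← h1', ← h2',
        map_add, inner_add_right, inner_add_right, real_inner_self_eq_norm_sq,
        real_inner_self_eq_norm_sq, real_inner_comm (ι (Y r)) (ι (Y (r - k)))]
      congr 1
      simp only [he]
      ring
    have hek : Integrable fun r => e (r - k) := hei.comp_sub_right k
    have i1 : IntegrableOn (fun r => ∫ θ in Ioc (0 : ℝ) 1, ⟪Y r, Z (r - k * θ)⟫_ℝ) (Ioc s t) := by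
      simp only [p1]
      have hcont : Continuous fun r => ∫ ρ in (r - k)..r, Z ρ := by
        have hc : Continuous fun x => ∫ ρ in (0 : ℝ)..x, Z ρ :=
          intervalIntegral.continuous_primitive hZint 0
        refine (hc.sub (hc.comp (continuous_sub_right k))).congr fun r => ?_
        simp only [Pi.sub_apply, Function.comp_apply]
        rw [← intervalIntegral.integral_add_adjacent_intervals (hZint 0 (r - k)) (hZint (r - k) r)]
        abel
      refine Integrable.const_mul ?_ _
      have hm : MemLp (fun r => ∫ ρ in (r - k)..r, Z ρ) 2 (volume.restrict (Ioc s t)) := by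
        have hb : IntegrableOn (fun r => ‖∫ ρ in (r - k)..r, Z ρ‖ ^ 2) (Ioc s t) :=
          ((hcont.norm.pow 2).continuousOn.integrableOn_compact isCompact_Icc).mono_set
            Ioc_subset_Icc_self
        exact (memLp_two_iff_integrable_sq_norm hcont.aestronglyMeasurable).2 hb
      exact integrable_inner_of_memLp (hY.restrict _) hm
    have i2 : IntegrableOn (fun r => ∫ θ in Ioc (0 : ℝ) 1, ⟪Y (r - k), Z (r - k * θ)⟫_ℝ)
        (Ioc s t) := by
      have : IntegrableOn (fun r => k⁻¹ * (e r - e (r - k)) -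
          ∫ θ in Ioc (0 : ℝ) 1, ⟪Y r, Z (r - k * θ)⟫_ℝ) (Ioc s t) :=
        (((hei.sub hek).const_mul k⁻¹).integrableOn).sub i1
      refine Integrable.congr this ?_
      filter_upwards [hpt] with r hr
      rw [hr]; ring
    rw [s1, s2, ← integral_add i1 i2, ← integral_congr_ae hpt, integral_const_mul,
      integral_sub hei.integrableOn hek.integrableOn]
    congr 1
    have hee : ∀ a b : ℝ, IntervalIntegrable e volume a b := fun a b => hei.intervalIntegrable
    rw [← intervalIntegral.integral_of_le hst, ← intervalIntegral.integral_of_le hst,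
      intervalIntegral.integral_comp_sub_right (fun r => e r) k, hF]
    simp only
    rw [← intervalIntegral.integral_interval_sub_left (hee 0 t) (hee 0 s),
      ← intervalIntegral.integral_interval_sub_left (hee 0 (t - k)) (hee 0 (s - k))]
    ring
  have := tendsto_nhds_unique (lim2.congr' hid) lim1
  rw [← this, intervalIntegral.integral_of_le hst]
  simp only [Φ, sub_zero]
  ring

end Energy

/-! ### The energy identity up to the initial time and the continuous representative -/

section Continuity

variable {V : Type*} [NormedAddCommGroup V] [InnerProductSpace ℝ V]
  {H : Type*} [NormedAddCommGroup H] [InnerProductSpace ℝ H]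

theorem exists_mem_of_ae_volT {T : ℝ} {p : ℝ → Prop} (h : ∀ᵐ t ∂volT T, p t) {a b : ℝ}
    (hab : a < b) (ha : 0 ≤ a) (hb : b ≤ T) : ∃ t ∈ Ioo a b, p t := by
  by_contra hcon
  push Not at hcon
  have h1 : ∀ᵐ t ∂volume.restrict (Ioo a b), p t :=
    ae_mono (Measure.restrict_mono (Ioo_subset_Ioo ha hb) le_rfl) h
  have h2 : ∀ᵐ t ∂volume.restrict (Ioo a b), False := by
    filter_upwards [h1, ae_restrict_mem measurableSet_Ioo] with t ht htm using hcon t htm ht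
  rw [eventually_false_iff_eq_bot, ae_eq_bot, Measure.restrict_eq_zero, Real.volume_Ioo,
    ENNReal.ofReal_eq_zero] at h2
  linarith

/-- The energy identity for a function `Y ∈ L²(0,T;V)` such that `ι† ι Y` has the derivative
`Z ∈ L²(0,T;V)`, up to the value of the energy at `t = 0`. -/
theorem exists_energy_identity [CompleteSpace V] (ι : V →L[ℝ] H) {T : ℝ} (hT : 0 < T) {Y Z : ℝ → V}
    (hY : MemLp Y 2 (volT T)) (hZ : MemLp Z 2 (volT T)) (w₀ : V)
    (h : ∀ᵐ t ∂volT T, ∀ v, ⟪ι (Y t), ι v⟫_ℝ = ⟪w₀ + ∫ r in (0 : ℝ)..t, Z r, v⟫_ℝ) :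
    ∃ e₀ : ℝ, ∀ᵐ t ∂volT T, ‖ι (Y t)‖ ^ 2 = e₀ + 2 * ∫ r in (0 : ℝ)..t, ⟪Y r, Z r⟫_ℝ := by
  -- strongly measurable representatives, extended by zero
  have ext : ∀ {W : ℝ → V} (hW : MemLp W 2 (volT T)), ∃ Wb : ℝ → V, StronglyMeasurable Wb ∧
      MemLp Wb 2 volume ∧ Integrable Wb ∧ W =ᵐ[volT T] Wb := by
    intro W hW
    have hm := hW.1.stronglyMeasurable_mk
    have hMk : MemLp (hW.1.mk W) 2 (volT T) := hW.ae_eq hW.1.ae_eq_mk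
    refine ⟨(Ioo 0 T).indicator (hW.1.mk W), hm.indicator measurableSet_Ioo,
      (memLp_indicator_iff_restrict measurableSet_Ioo).2 hMk,
      (integrable_indicator_iff measurableSet_Ioo).2 (hMk.integrable one_le_two), ?_⟩
    filter_upwards [hW.1.ae_eq_mk, ae_restrict_mem measurableSet_Ioo] with t ht htm
    rw [indicator_of_mem htm, ht]
  obtain ⟨Yb, hYbm, hYb, -, hYY⟩ := ext hY
  obtain ⟨Zb, hZbm, hZb, hZbi, hZZ⟩ := ext hZ
  have hb : ∀ᵐ t ∂volT T, ∀ v, ⟪ι (Yb t), ι v⟫_ℝ = ⟪w₀ + ∫ r in (0 : ℝ)..t, Zb r, v⟫_ℝ := by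
    filter_upwards [h, hYY, ae_restrict_mem measurableSet_Ioo] with t ht h1 htm v
    rw [← h1, ht v, intervalIntegral_congr_volT hZZ le_rfl htm.1.le htm.2.le]
  have hYZ : (fun r => ⟪Y r, Z r⟫_ℝ) =ᵐ[volT T] fun r => ⟪Yb r, Zb r⟫_ℝ := by
    filter_upwards [hYY, hZZ] with r h1 h2
    rw [h1, h2]
  have hint : Integrable (fun r => ⟪Y r, Z r⟫_ℝ) (volT T) := integrable_inner_of_memLp hY hZ
  have haux := energy_identity_aux ι hYbm hZbm hYb hZb hZbi w₀ hb
  have haux' : ∀ᵐ s ∂volT T, ∀ᵐ t, t ∈ Ioo s T → ‖ι (Y t)‖ ^ 2 - ‖ι (Y s)‖ ^ 2 =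
      2 * ∫ r in s..t, ⟪Y r, Z r⟫_ℝ := by
    filter_upwards [ae_restrict_of_ae haux, ae_restrict_mem measurableSet_Ioo, hYY]
      with s hs hsm h1
    filter_upwards [hs hsm, (ae_restrict_iff' measurableSet_Ioo).1 hYY] with t ht h2 htm
    have htm' : t ∈ Ioo 0 T := ⟨hsm.1.trans htm.1, htm.2⟩
    rw [h1, h2 htm', ht htm, intervalIntegral_congr_volT hYZ hsm.1.le htm.1.le htm.2.le]
  -- the identity holds on `(s, T)` for arbitrarily small good `s`, with the same constant
  have hall : ∀ k : ℕ, ∃ s ∈ Ioo 0 (T / (k + 1)), ∀ᵐ t, t ∈ Ioo s T →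
      ‖ι (Y t)‖ ^ 2 - ‖ι (Y s)‖ ^ 2 = 2 * ∫ r in s..t, ⟪Y r, Z r⟫_ℝ := fun k =>
    exists_mem_of_ae_volT haux' (by positivity) le_rfl
      (div_le_self hT.le (by linarith [k.cast_nonneg (α := ℝ)]))
  choose s hsm hs using hall
  have hsT : ∀ k, s k < T := fun k => (hsm k).2.trans_le
    (div_le_self hT.le (by linarith [k.cast_nonneg (α := ℝ)]))
  have hii : ∀ {a b : ℝ}, a ∈ Icc 0 T → b ∈ Icc 0 T →
      IntervalIntegrable (fun r => ⟪Y r, Z r⟫_ℝ) volume a b := fun ha hb =>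
    intervalIntegrable_of_integrable_volT hint ha hb
  have h0 : (0 : ℝ) ∈ Icc 0 T := ⟨le_rfl, hT.le⟩
  have hk : ∀ k, s k ∈ Icc 0 T := fun k => ⟨(hsm k).1.le, (hsT k).le⟩
  set e : ℕ → ℝ := fun k => ‖ι (Y (s k))‖ ^ 2 - 2 * ∫ r in (0 : ℝ)..s k, ⟪Y r, Z r⟫_ℝ with he
  have hs' : ∀ k, ∀ᵐ t, t ∈ Ioo (s k) T →
      ‖ι (Y t)‖ ^ 2 = e k + 2 * ∫ r in (0 : ℝ)..t, ⟪Y r, Z r⟫_ℝ := by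
    intro k
    filter_upwards [hs k] with t ht htm
    have htT : t ∈ Icc 0 T := ⟨((hsm k).1.trans htm.1).le, htm.2.le⟩
    rw [← intervalIntegral.integral_add_adjacent_intervals (hii h0 (hk k)) (hii (hk k) htT)]
    have := ht htm
    simp only [he]
    linarith
  have hconst : ∀ k, e k = e 0 := by
    intro k
    have h1 : ∀ᵐ t ∂volT T, (t ∈ Ioo (s k) T →
        ‖ι (Y t)‖ ^ 2 = e k + 2 * ∫ r in (0 : ℝ)..t, ⟪Y r, Z r⟫_ℝ) ∧ (t ∈ Ioo (s 0) T →
        ‖ι (Y t)‖ ^ 2 = e 0 + 2 * ∫ r in (0 : ℝ)..t, ⟪Y r, Z r⟫_ℝ) :=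
      ae_restrict_of_ae ((hs' k).and (hs' 0))
    obtain ⟨t, htm, ht1, ht2⟩ := exists_mem_of_ae_volT h1 (max_lt (hsT k) (hsT 0))
      ((hsm k).1.le.trans (le_max_left _ _)) le_rfl
    have e1 := ht1 ⟨(le_max_left _ _).trans_lt htm.1, htm.2⟩
    have e2 := ht2 ⟨(le_max_right _ _).trans_lt htm.1, htm.2⟩
    linarith
  refine ⟨e 0, (ae_restrict_iff' measurableSet_Ioo).2 ?_⟩
  filter_upwards [ae_all_iff.2 hs'] with t ht htm
  obtain ⟨k, hk⟩ := exists_nat_gt (T / t)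
  have hlt : s k < t := by
    refine (hsm k).2.trans ?_
    rw [div_lt_iff₀ (by positivity)]
    rw [div_lt_iff₀ htm.1] at hk
    nlinarith [htm.1]
  rw [ht k ⟨hlt, htm.2⟩, hconst k]

theorem continuousOn_integral_inner {T : ℝ} (hT : 0 ≤ T) {Y Z : ℝ → V}
    (hY : MemLp Y 2 (volT T)) (hZ : MemLp Z 2 (volT T)) :
    ContinuousOn (fun t => ∫ r in (0 : ℝ)..t, ⟪Y r, Z r⟫_ℝ) (Icc 0 T) :=
  continuousOn_primitive_volT hT (integrable_inner_of_memLp hY hZ)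

theorem eqOn_Icc_of_ae_volT {X : Type*} [TopologicalSpace X] [T2Space X] {T : ℝ} (hT : 0 < T)
    {f g : ℝ → X} (h : ∀ᵐ t ∂volT T, f t = g t) (hf : ContinuousOn f (Icc 0 T))
    (hg : ContinuousOn g (Icc 0 T)) : ∀ t ∈ Icc 0 T, f t = g t := by
  refine Measure.eqOn_Icc_of_ae_eq volume hT.ne ?_ hf hg
  rw [← Measure.restrict_congr_set (Ioo_ae_eq_Icc (a := 0) (b := T))]
  exact h

/-- The energy identity for the continuous representative. -/
theorem energy_identity [CompleteSpace H] [CompleteSpace V] (ι : V →L[ℝ] H) {T : ℝ} (hT : 0 < T)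
    {Y Z : ℝ → V} (hY : MemLp Y 2 (volT T)) (hZ : MemLp Z 2 (volT T)) {c : ℝ → H}
    (hc : ContinuousOn c (Icc 0 T)) (hcY : ∀ᵐ t ∂volT T, c t = ι (Y t))
    (h : ∀ᵐ t ∂volT T, ∀ v, ⟪c t, ι v⟫_ℝ = ⟪c 0, ι v⟫_ℝ + ⟪∫ r in (0 : ℝ)..t, Z r, v⟫_ℝ) :
    ∀ t ∈ Icc 0 T, ‖c t‖ ^ 2 = ‖c 0‖ ^ 2 + 2 * ∫ r in (0 : ℝ)..t, ⟪Y r, Z r⟫_ℝ := by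
  obtain ⟨e₀, he⟩ := exists_energy_identity ι hT hY hZ (ContinuousLinearMap.adjoint ι (c 0)) (by
    filter_upwards [h, hcY] with t ht h1 v
    rw [← h1, ht v, inner_add_left, ContinuousLinearMap.adjoint_inner_left])
  have h1 := eqOn_Icc_of_ae_volT hT (f := fun t => ‖c t‖ ^ 2)
    (g := fun t => e₀ + 2 * ∫ r in (0 : ℝ)..t, ⟪Y r, Z r⟫_ℝ) (by
      filter_upwards [he, hcY] with t h1 h2
      rw [h2, h1]) (hc.norm.pow 2)
    (continuousOn_const.add (continuousOn_const.mul (continuousOn_integral_inner hT.le hY hZ)))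
  have h0 := h1 0 ⟨le_rfl, hT.le⟩
  simp only [intervalIntegral.integral_same, mul_zero, add_zero] at h0
  intro t ht
  rw [h0]
  exact h1 t ht

/-- A function `Y ∈ L²(0,T;V)` such that `ι† ι Y` has a derivative `Z ∈ L²(0,T;V)` has a
representative which is continuous with values in `H`. For good times `s, t` in an interval `J`,
the energy identity for `Y - Y(s)` gives
`‖ι Y(t) - ι Y(s)‖² = 2 ∫_s^t ⟪Y - Y(s), Z⟫`, and if `‖Y(s)‖²` is at most the mean of `‖Y‖²` over
`J`, the right-hand side is at most `2 ∫_J (‖Y‖² + ‖Z‖²)`. -/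
theorem exists_continuous_representative [CompleteSpace H] [CompleteSpace V] (ι : V →L[ℝ] H)
    (hι : DenseRange ι)
    {T : ℝ} (hT : 0 < T) {Y Z : ℝ → V} (hY : MemLp Y 2 (volT T)) (hZ : MemLp Z 2 (volT T))
    (z₀ : H) (h : ∀ᵐ t ∂volT T, ∀ v,
      ⟪ι (Y t), ι v⟫_ℝ = ⟪z₀, ι v⟫_ℝ + ⟪∫ r in (0 : ℝ)..t, Z r, v⟫_ℝ) :
    ∃ c : ℝ → H, ContinuousOn c (Icc 0 T) ∧ (∀ᵐ t ∂volT T, c t = ι (Y t)) ∧ c 0 = z₀ := by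
  obtain ⟨e₀, he⟩ := exists_energy_identity ι hT hY hZ (ContinuousLinearMap.adjoint ι z₀) (by
    filter_upwards [h] with t ht v
    rw [ht v, inner_add_left, ContinuousLinearMap.adjoint_inner_left])
  -- the good times, at which the equation and the energy identity hold
  set G : Set ℝ := {t | t ∈ Ioo 0 T ∧ (‖ι (Y t)‖ ^ 2 = e₀ + 2 * ∫ r in (0 : ℝ)..t, ⟪Y r, Z r⟫_ℝ) ∧
    ∀ v, ⟪ι (Y t), ι v⟫_ℝ = ⟪z₀, ι v⟫_ℝ + ⟪∫ r in (0 : ℝ)..t, Z r, v⟫_ℝ} with hG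
  have hGae : ∀ᵐ t ∂volT T, t ∈ G := by
    filter_upwards [h, he, ae_restrict_mem measurableSet_Ioo] with t h1 h2 h3 using ⟨h3, h2, h1⟩
  have hYi : Integrable (fun r => ‖Y r‖ ^ 2) (volT T) := hY.integrable_norm_pow two_ne_zero
  have hZi : Integrable (fun r => ‖Z r‖ ^ 2) (volT T) := hZ.integrable_norm_pow two_ne_zero
  set m : ℝ → ℝ := fun r => ‖Y r‖ ^ 2 + ‖Z r‖ ^ 2 with hm
  have hmi : Integrable m (volT T) := hYi.add hZi
  have hZ1 : Integrable Z (volT T) := hZ.integrable one_le_two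
  have hYZ : Integrable (fun r => ⟪Y r, Z r⟫_ℝ) (volT T) := integrable_inner_of_memLp hY hZ
  have h0T : (0 : ℝ) ∈ Icc 0 T := ⟨le_rfl, hT.le⟩
  have hdiff : ∀ s ∈ G, ∀ t ∈ G, ‖ι (Y t) - ι (Y s)‖ ^ 2 = 2 * ∫ r in s..t, ⟪Y r - Y s, Z r⟫_ℝ := by
    rintro s ⟨hs, hs1, hs2⟩ t ⟨ht, ht1, ht2⟩
    have hsI : s ∈ Icc 0 T := Ioo_subset_Icc_self hs
    have htI : t ∈ Icc 0 T := Ioo_subset_Icc_self ht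
    have i1 := intervalIntegrable_of_integrable_volT hYZ hsI htI
    have i2 := intervalIntegrable_of_integrable_volT hZ1 hsI htI
    have i3 : IntervalIntegrable (fun r => ⟪Y s, Z r⟫_ℝ) volume s t :=
      intervalIntegrable_of_integrable_volT (hZ1.const_inner (𝕜 := ℝ) (Y s)) hsI htI
    have e1 : ∫ r in s..t, ⟪Y s, Z r⟫_ℝ = ⟪Y s, ∫ r in s..t, Z r⟫_ℝ :=
      ((innerSL ℝ (Y s)).intervalIntegral_comp_comm i2)
    have e2 : ∫ r in s..t, Z r = (∫ r in (0 : ℝ)..t, Z r) - ∫ r in (0 : ℝ)..s, Z r :=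
      (intervalIntegral.integral_interval_sub_left
        (intervalIntegrable_of_integrable_volT hZ1 h0T htI)
        (intervalIntegrable_of_integrable_volT hZ1 h0T hsI)).symm
    have e3 : ∫ r in s..t, ⟪Y r, Z r⟫_ℝ =
        (∫ r in (0 : ℝ)..t, ⟪Y r, Z r⟫_ℝ) - ∫ r in (0 : ℝ)..s, ⟪Y r, Z r⟫_ℝ :=
      (intervalIntegral.integral_interval_sub_left
        (intervalIntegrable_of_integrable_volT hYZ h0T htI)
        (intervalIntegrable_of_integrable_volT hYZ h0T hsI)).symm
    simp only [inner_sub_left]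
    rw [intervalIntegral.integral_sub i1 i3, e1, e2, inner_sub_right, e3, norm_sub_sq_real]
    have h1 := ht2 (Y s)
    have h2 := hs2 (Y s)
    rw [real_inner_self_eq_norm_sq] at h2
    rw [real_inner_comm (∫ r in (0 : ℝ)..t, Z r), real_inner_comm (∫ r in (0 : ℝ)..s, Z r)]
    linarith
  -- the oscillation of `ι Y` on good times in an interval
  have hosc : ∀ a b : ℝ, 0 ≤ a → a < b → b ≤ T → ∃ z : H, ∀ t ∈ G, t ∈ Ioo a b →
      ‖ι (Y t) - z‖ ^ 2 ≤ 2 * ∫ r in Ioo a b, m r := by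
    intro a b ha hab hb
    have hsub : Ioo a b ⊆ Ioo 0 T := Ioo_subset_Ioo ha hb
    have hYJ : IntegrableOn (fun r => ‖Y r‖ ^ 2) (Ioo a b) := hYi.mono_measure
      (Measure.restrict_mono hsub le_rfl)
    have hZJ : IntegrableOn (fun r => ‖Z r‖ ^ 2) (Ioo a b) := hZi.mono_measure
      (Measure.restrict_mono hsub le_rfl)
    have hGJ : (volume.restrict (Ioo a b)) Gᶜ = 0 := by
      have := ae_mono (Measure.restrict_mono hsub le_rfl) hGae
      exact this
    have hvol : volume (Ioo a b) ≠ 0 := by simp [hab]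
    obtain ⟨s, hsG, hsJ, hs⟩ : ∃ s, s ∈ G ∧ s ∈ Ioo a b ∧
        (b - a) * ‖Y s‖ ^ 2 ≤ ∫ r in Ioo a b, ‖Y r‖ ^ 2 := by
      have hne : volume.restrict (Ioo a b) ≠ 0 := by
        rwa [Ne, Measure.restrict_eq_zero]
      have hnull : (volume.restrict (Ioo a b)) (G ∩ Ioo a b)ᶜ = 0 := by
        rw [compl_inter]
        refine measure_union_null hGJ ?_
        exact ae_restrict_mem measurableSet_Ioo
      obtain ⟨s, hs1, hs2⟩ := exists_notMem_null_le_average hne hYJ hnull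
      rw [mem_compl_iff, not_not] at hs1
      refine ⟨s, hs1.1, hs1.2, ?_⟩
      rw [setAverage_eq] at hs2
      have hv : volume.real (Ioo a b) = b - a := by
        rw [measureReal_def, Real.volume_Ioo, ENNReal.toReal_ofReal (by linarith)]
      rw [hv, smul_eq_mul, inv_mul_eq_div, le_div_iff₀ (by linarith)] at hs2
      linarith
    refine ⟨ι (Y s), fun t htG htJ => ?_⟩
    rw [hdiff s hsG t htG]
    have hYsJ : IntegrableOn (fun _ : ℝ => ‖Y s‖ ^ 2) (Ioo a b) := integrableOn_const (by simp)
    have hbound : ∫ r in Ioo a b, (‖Y r‖ ^ 2 + ‖Y s‖ ^ 2 + 2 * ‖Z r‖ ^ 2) ≤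
        2 * ∫ r in Ioo a b, m r := by
      have e1 : ∫ r in Ioo a b, ‖Y s‖ ^ 2 = (b - a) * ‖Y s‖ ^ 2 := by
        rw [setIntegral_const, measureReal_def, Real.volume_Ioo,
          ENNReal.toReal_ofReal (by linarith), smul_eq_mul]
      have e2 : ∫ r in Ioo a b, (‖Y r‖ ^ 2 + ‖Y s‖ ^ 2 + 2 * ‖Z r‖ ^ 2) =
          (∫ r in Ioo a b, (‖Y r‖ ^ 2 + ‖Y s‖ ^ 2)) + ∫ r in Ioo a b, 2 * ‖Z r‖ ^ 2 :=
        integral_add (hYJ.add hYsJ) (hZJ.const_mul 2)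
      rw [e2, integral_add hYJ hYsJ, e1, integral_const_mul, hm, integral_add hYJ hZJ]
      linarith
    have habs : |∫ r in s..t, ⟪Y r - Y s, Z r⟫_ℝ| ≤
        (1 / 2) * ∫ r in Ioo a b, (‖Y r‖ ^ 2 + ‖Y s‖ ^ 2 + 2 * ‖Z r‖ ^ 2) := by
      rw [← Real.norm_eq_abs, ← integral_const_mul]
      refine (intervalIntegral.norm_integral_le_integral_norm_uIoc).trans ?_
      have hint : IntegrableOn
          (fun r => 1 / 2 * (‖Y r‖ ^ 2 + ‖Y s‖ ^ 2 + 2 * ‖Z r‖ ^ 2)) (Ioo a b) :=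
        ((hYJ.add hYsJ).add (hZJ.const_mul 2)).const_mul _
      have hsubJ : uIoc s t ⊆ Ioo a b := by
        intro r hr
        rcases le_total s t with hst | hst
        · rw [uIoc_of_le hst] at hr
          exact ⟨hsJ.1.trans hr.1, hr.2.trans_lt htJ.2⟩
        · rw [uIoc_of_ge hst] at hr
          exact ⟨htJ.1.trans hr.1, hr.2.trans_lt hsJ.2⟩
      refine (integral_mono_of_nonneg (Eventually.of_forall fun r => norm_nonneg _)
        (hint.mono_set hsubJ) (Eventually.of_forall fun r => ?_)).trans
        (setIntegral_mono_set hint (Eventually.of_forall fun r => by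
          simp only [Pi.zero_apply]; positivity) hsubJ.eventuallyLE)
      have h1 := abs_real_inner_le_norm (Y r - Y s) (Z r)
      have h2 := norm_sub_le (Y r) (Y s)
      have h3 := mul_le_mul_of_nonneg_right h2 (norm_nonneg (Z r))
      simp only [Real.norm_eq_abs]
      nlinarith [sq_nonneg (‖Y r‖ - ‖Z r‖), sq_nonneg (‖Y s‖ - ‖Z r‖)]
    have := (le_abs_self _).trans habs
    linarith
  -- absolute continuity: each time has a neighbourhood on which the integral of `m` is small
  have hsmall : ∀ t₀ ∈ Icc 0 T, ∀ ε > 0, ∃ a b, a < b ∧ 0 ≤ a ∧ b ≤ T ∧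
      (∀ᶠ t in 𝓝 t₀, t ∈ Ioo 0 T → t ∈ Ioo a b) ∧ ∫ r in Ioo a b, m r < ε := by
    intro t₀ ht₀ ε hε
    have hcont := continuousOn_primitive_volT hT.le hmi
    obtain ⟨δ, hδ, hd⟩ := Metric.continuousOn_iff.1 hcont t₀ ht₀ (ε / 2) (by positivity)
    set a := max 0 (t₀ - δ / 2) with ha
    set b := min T (t₀ + δ / 2) with hb
    have hab : a < b := max_lt (lt_min hT (by linarith [ht₀.1]))
      (lt_min (by linarith [ht₀.2]) (by linarith))
    have haT : a ∈ Icc 0 T := ⟨le_max_left _ _, hab.le.trans (min_le_left _ _)⟩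
    have hbT : b ∈ Icc 0 T := ⟨haT.1.trans hab.le, min_le_left _ _⟩
    have hda : dist a t₀ < δ := by
      rw [Real.dist_eq, abs_lt]
      have h1 : t₀ - δ / 2 ≤ a := le_max_right _ _
      have h2 : a ≤ t₀ := max_le ht₀.1 (by linarith)
      constructor <;> linarith
    have hdb : dist b t₀ < δ := by
      rw [Real.dist_eq, abs_lt]
      have h1 : b ≤ t₀ + δ / 2 := min_le_right _ _
      have h2 : t₀ ≤ b := le_min ht₀.2 (by linarith)
      constructor <;> linarith
    refine ⟨a, b, hab, haT.1, hbT.2, ?_, ?_⟩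
    · filter_upwards [Ioo_mem_nhds (show t₀ - δ / 2 < t₀ by linarith)
        (show t₀ < t₀ + δ / 2 by linarith)] with t ht htI
      exact ⟨max_lt htI.1 ht.1, lt_min htI.2 ht.2⟩
    · rw [← integral_Ioc_eq_integral_Ioo, ← intervalIntegral.integral_of_le hab.le,
        ← intervalIntegral.integral_interval_sub_left
        (intervalIntegrable_of_integrable_volT hmi h0T hbT)
        (intervalIntegrable_of_integrable_volT hmi h0T haT)]
      have h1 := hd a haT hda
      have h2 := hd b hbT hdb
      rw [Real.dist_eq, abs_lt] at h1 h2
      linarith [h1.1, h2.2]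
  have hcl : Icc 0 T ⊆ closure G := by
    intro t₀ ht₀
    rw [Metric.mem_closure_iff]
    intro ε hε
    have hab : max 0 (t₀ - ε / 2) < min T (t₀ + ε / 2) := max_lt
      (lt_min hT (by linarith [ht₀.1])) (lt_min (by linarith [ht₀.2]) (by linarith))
    obtain ⟨t, ht, htG⟩ := exists_mem_of_ae_volT hGae hab (le_max_left _ _) (min_le_left _ _)
    refine ⟨t, htG, ?_⟩
    have h1 := (le_max_right _ _).trans_lt ht.1
    have h2 := ht.2.trans_le (min_le_right _ _)
    rw [Real.dist_eq, abs_lt]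
    constructor <;> linarith
  -- the Cauchy criterion, so that `ι Y` extends continuously from the good times to `[0, T]`
  have hlim : ∀ t₀ ∈ Icc 0 T, ∃ z, Tendsto (fun t => ι (Y t)) (𝓝[G] t₀) (𝓝 z) := by
    intro t₀ ht₀
    have : (𝓝[G] t₀).NeBot := mem_closure_iff_nhdsWithin_neBot.1 (hcl ht₀)
    refine cauchy_map_iff_exists_tendsto.1 (Metric.cauchy_iff.2 ⟨map_neBot, fun ε hε => ?_⟩)
    obtain ⟨a, b, hab, ha, hb, hev, hint⟩ := hsmall t₀ ht₀ (ε ^ 2 / 8) (by positivity)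
    obtain ⟨z, hz⟩ := hosc a b ha hab hb
    have hz' : ∀ t ∈ G, t ∈ Ioo a b → dist (ι (Y t)) z < ε / 2 := by
      intro t htG htJ
      rw [dist_eq_norm]
      refine lt_of_pow_lt_pow_left₀ 2 (by positivity) ((hz t htG htJ).trans_lt ?_)
      linarith [show (ε / 2) ^ 2 = 2 * (ε ^ 2 / 8) by ring]
    have hmem : {t | t ∈ G ∧ t ∈ Ioo a b} ∈ 𝓝[G] t₀ := by
      filter_upwards [self_mem_nhdsWithin, nhdsWithin_le_nhds hev] with t h1 h2
      exact ⟨h1, h2 h1.1⟩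
    refine ⟨_, image_mem_map hmem, ?_⟩
    rintro _ ⟨t, ⟨h1, h2⟩, rfl⟩ _ ⟨t', ⟨h1', h2'⟩, rfl⟩
    calc _ ≤ dist (ι (Y t)) z + dist (ι (Y t')) z := dist_triangle_right _ _ _
      _ < ε := by linarith [hz' t h1 h2, hz' t' h1' h2']
  set c : ℝ → H := extendFrom G fun t => ι (Y t) with hc
  have hcont : ContinuousOn c (Icc 0 T) := continuousOn_extendFrom hcl hlim
  have hcG : ∀ t ∈ G, c t = ι (Y t) := by
    intro t ht
    have htI : t ∈ Icc 0 T := Ioo_subset_Icc_self ht.1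
    obtain ⟨z, hz⟩ := hlim t htI
    rw [hc, extendFrom_eq (hcl htI) hz]
    exact tendsto_nhds_unique (hz.mono_left (pure_le_nhdsWithin ht)) (tendsto_pure_nhds _ _)
  have hcae : ∀ᵐ t ∂volT T, c t = ι (Y t) := by
    filter_upwards [hGae] with t ht using hcG t ht
  refine ⟨c, hcont, hcae, ?_⟩
  have h1 : ∀ v, ⟪c 0 - z₀, ι v⟫_ℝ = 0 := by
    intro v
    have h2 := eqOn_Icc_of_ae_volT hT (f := fun t => ⟪c t, ι v⟫_ℝ)
      (g := fun t => ⟪z₀, ι v⟫_ℝ + ⟪∫ r in (0 : ℝ)..t, Z r, v⟫_ℝ) (by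
        filter_upwards [hcae, h] with t h1 h2
        rw [h1, h2 v]) (hcont.inner continuousOn_const)
      (continuousOn_const.add ((continuousOn_primitive_volT hT.le hZ1).inner continuousOn_const))
      0 h0T
    simp only [intervalIntegral.integral_same, inner_zero_left, add_zero] at h2
    rw [inner_sub_left, h2, sub_self]
  exact sub_eq_zero.1 (hι.eq_zero_of_inner_left ℝ h1)

end Continuity

/-! ### Time slices of functions in `L²(Q)` -/

noncomputable section

variable {n : ℕ} {Ω : Set (Space n)} {T : ℝ}

theorem volQ_eq_prod (Ω : Set (Space n)) (T : ℝ) : volQ Ω T = (volΩ Ω).prod (volT T) := by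
  rw [Measure.prod_restrict, ← Measure.volume_eq_prod]

/-- In a separable metric space, measurability can be tested on distances to points. -/
theorem measurable_of_measurableSet_dist {α X : Type*} [MeasurableSpace α] [PseudoMetricSpace X]
    [TopologicalSpace.SeparableSpace X] [MeasurableSpace X] [BorelSpace X] {f : α → X}
    (h : ∀ c r, MeasurableSet {t | dist (f t) c < r}) : Measurable f := by
  refine measurable_of_isOpen fun U hU => ?_
  obtain ⟨D, hDc, hD⟩ := TopologicalSpace.exists_countable_dense X
  have hcover : f ⁻¹' U = ⋃ c ∈ D, ⋃ q : ℚ, ⋃ _ : Metric.ball c q ⊆ U,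
      {t | dist (f t) c < q} := by
    ext t
    simp only [mem_preimage, mem_iUnion, mem_ofPred_eq, exists_prop]
    constructor
    · intro ht
      obtain ⟨ε, hε, hball⟩ := Metric.isOpen_iff.1 hU _ ht
      obtain ⟨c, hcb, hcD⟩ := Metric.dense_iff.1 hD (f t) (ε / 2) (by positivity)
      obtain ⟨q, hq1, hq2⟩ := exists_rat_btwn (Metric.mem_ball.1 hcb)
      refine ⟨c, hcD, q, fun z hz => hball ?_, by rwa [dist_comm]⟩
      rw [Metric.mem_ball] at hz ⊢
      linarith [dist_triangle z c (f t)]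
    · rintro ⟨c, -, q, hq, ht⟩
      exact hq ht
  rw [hcover]
  exact MeasurableSet.biUnion hDc fun c _ => MeasurableSet.iUnion fun q =>
    MeasurableSet.iUnion fun _ => h c q

theorem ae_memLp_slice {F : Space n × ℝ → ℝ} (hF : MemLp F 2 (volQ Ω T)) :
    ∀ᵐ t ∂volT T, MemLp (fun x => F (x, t)) 2 (volΩ Ω) := by
  have hF' : MemLp F 2 ((volΩ Ω).prod (volT T)) := by rwa [← volQ_eq_prod]
  filter_upwards [hF'.1.prodMk_right, hF'.integrable_sq.prod_left_ae] with t h1 h2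
  exact (memLp_two_iff_integrable_sq h1).2 h2

theorem memLp_volQ {F : Space n × ℝ → ℝ} (hF : AEStronglyMeasurable F (volQ Ω T))
    (h1 : ∀ᵐ t ∂volT T, MemLp (fun x => F (x, t)) 2 (volΩ Ω))
    (h2 : Integrable (fun t => ∫ x, F (x, t) ^ 2 ∂volΩ Ω) (volT T)) : MemLp F 2 (volQ Ω T) := by
  refine (memLp_two_iff_integrable_sq hF).2 ?_
  rw [volQ_eq_prod] at hF ⊢
  refine (integrable_prod_iff' (hF.pow 2)).2 ⟨?_, ?_⟩
  · filter_upwards [h1] with t ht using ht.integrable_sq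
  · refine h2.congr (Eventually.of_forall fun t => ?_)
    simp only [Pi.pow_apply, norm_pow, Real.norm_eq_abs, sq_abs]

theorem integrable_volQ_iff {F : Space n × ℝ → ℝ} :
    Integrable F (volQ Ω T) ↔ Integrable F ((volΩ Ω).prod (volT T)) := by
  rw [volQ_eq_prod]

theorem integral_volQ_eq (F : Space n × ℝ → ℝ) :
    ∫ z, F z ∂volQ Ω T = ∫ z, F z ∂(volΩ Ω).prod (volT T) := by
  rw [volQ_eq_prod]

instance separableSpace_L2Ω (Ω : Set (Space n)) : TopologicalSpace.SeparableSpace (L2Ω Ω) := by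
  have : Fact ((2 : ℝ≥0∞) ≠ ∞) := ⟨ENNReal.ofNat_ne_top⟩
  infer_instance

open Classical in
/-- The time slice `y(·, t) ∈ L²(Ω)` of `y ∈ L²(Q)`, set to zero for the exceptional times at which
`y(·, t)` is not square integrable. -/
def slice (y : L2Q Ω T) (t : ℝ) : L2Ω Ω :=
  if h : MemLp (fun x => y (x, t)) 2 (volΩ Ω) then h.toLp _ else 0

theorem slice_coe (y : L2Q Ω T) :
    ∀ᵐ t ∂volT T, slice y t =ᵐ[volΩ Ω] fun x => y (x, t) := by
  filter_upwards [ae_memLp_slice (Lp.memLp y)] with t ht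
  rw [slice, dif_pos ht]
  exact ht.coeFn_toLp

/-- Measurability of the slices as an `L²(Ω)`-valued curve: this space is separable, and the
distances `‖y(·, t) - c‖` are measurable in `t` by Tonelli's theorem. -/
theorem aestronglyMeasurable_slice (y : L2Q Ω T) : AEStronglyMeasurable (slice y) (volT T) := by
  have hy : Measurable (y : Space n × ℝ → ℝ) := (Lp.stronglyMeasurable y).measurable
  borelize (L2Ω Ω)
  have : SecondCountableTopology (L2Ω Ω) := UniformSpace.secondCountable_of_separable _
  have hL : ∀ c : L2Ω Ω, Measurable fun t => eLpNorm (fun x => y (x, t) - c x) 2 (volΩ Ω) := by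
    intro c
    simp only [eLpNorm_eq_lintegral_rpow_enorm_toReal two_ne_zero ENNReal.ofNat_ne_top]
    refine Measurable.pow_const (Measurable.lintegral_prod_left' (f := fun z : Space n × ℝ =>
      ‖y z - c z.1‖ₑ ^ (2 : ℝ≥0∞).toReal) ?_) _
    exact ((hy.sub ((Lp.stronglyMeasurable c).measurable.comp measurable_fst)).enorm).pow_const _
  have hslice : ∀ t, Measurable fun x => y (x, t) := fun t =>
    hy.comp (measurable_id.prodMk measurable_const)
  have hS : MeasurableSet {t | MemLp (fun x => y (x, t)) 2 (volΩ Ω)} := by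
    have h0 : Measurable fun t => eLpNorm (fun x => y (x, t)) 2 (volΩ Ω) := by
      simp only [eLpNorm_eq_lintegral_rpow_enorm_toReal two_ne_zero ENNReal.ofNat_ne_top]
      refine Measurable.pow_const (Measurable.lintegral_prod_left' (f := fun z : Space n × ℝ =>
        ‖y z‖ₑ ^ (2 : ℝ≥0∞).toReal) ?_) _
      exact hy.enorm.pow_const _
    have : {t | MemLp (fun x => y (x, t)) 2 (volΩ Ω)} =
        {t | eLpNorm (fun x => y (x, t)) 2 (volΩ Ω) < ∞} := by
      ext t
      exact ⟨fun h => h.2, fun h => ⟨(hslice t).aestronglyMeasurable, h⟩⟩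
    rw [this]
    exact measurableSet_lt h0 measurable_const
  have hm : Measurable (slice y) := by
    refine measurable_of_measurableSet_dist fun c r => ?_
    have hd : ∀ t, MemLp (fun x => y (x, t)) 2 (volΩ Ω) → dist (slice y t) c =
        (eLpNorm (fun x => y (x, t) - c x) 2 (volΩ Ω)).toReal := by
      intro t ht
      rw [slice, dif_pos ht, Lp.dist_def]
      congr 1
      refine eLpNorm_congr_ae ?_
      filter_upwards [ht.coeFn_toLp] with x hx
      simp only [Pi.sub_apply, hx]
    have hset : {t | dist (slice y t) c < r} =
        ({t | MemLp (fun x => y (x, t)) 2 (volΩ Ω)} ∩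
          {t | (eLpNorm (fun x => y (x, t) - c x) 2 (volΩ Ω)).toReal < r}) ∪
        ({t | MemLp (fun x => y (x, t)) 2 (volΩ Ω)}ᶜ ∩ {_t | dist 0 c < r}) := by
      ext t
      by_cases ht : MemLp (fun x => y (x, t)) 2 (volΩ Ω)
      · simp [ht, hd t ht]
      · simp [ht, slice]
    rw [hset]
    exact (hS.inter (measurableSet_lt (hL c).ennreal_toReal measurable_const)).union
      (hS.compl.inter (MeasurableSet.const _))
  exact hm.aestronglyMeasurable

theorem inner_eq_integral_slice (y w : L2Q Ω T) :
    ⟪y, w⟫_ℝ = ∫ t, ⟪slice y t, slice w t⟫_ℝ ∂volT T := by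
  have hi := integrable_volQ_iff.1 (L2.integrable_inner (𝕜 := ℝ) y w)
  rw [L2.inner_def]
  rw [integral_volQ_eq, integral_prod_symm _ hi]
  refine integral_congr_ae ?_
  filter_upwards [slice_coe y, slice_coe w] with t h1 h2
  rw [L2.inner_def]
  refine integral_congr_ae ?_
  filter_upwards [h1, h2] with x h3 h4
  rw [h3, h4]

theorem memLp_slice (y : L2Q Ω T) : MemLp (slice y) 2 (volT T) := by
  refine (memLp_two_iff_integrable_sq_norm (aestronglyMeasurable_slice y)).2 ?_
  have hi := integrable_volQ_iff.1 (L2.integrable_inner (𝕜 := ℝ) y y)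
  refine hi.integral_prod_right.congr ?_
  filter_upwards [slice_coe y] with t h1
  rw [← real_inner_self_eq_norm_sq, L2.inner_def]
  refine integral_congr_ae ?_
  filter_upwards [h1] with x h3
  rw [h3]

theorem norm_sq_eq_integral_slice (y : L2Q Ω T) :
    ‖y‖ ^ 2 = ∫ t, ‖slice y t‖ ^ 2 ∂volT T := by
  rw [← real_inner_self_eq_norm_sq, inner_eq_integral_slice]
  simp only [real_inner_self_eq_norm_sq]

theorem ae_ae_of_ae_volQ {p : Space n × ℝ → Prop} (h : ∀ᵐ z ∂volQ Ω T, p z) :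
    ∀ᵐ t ∂volT T, ∀ᵐ x ∂volΩ Ω, p (x, t) := by
  rw [volQ_eq_prod] at h
  have h2 : ∀ᵐ z ∂(volT T).prod (volΩ Ω), p z.swap :=
    (Measure.measurePreserving_swap (μ := volT T) (ν := volΩ Ω)).quasiMeasurePreserving.ae h
  exact Measure.ae_ae_of_ae_prod h2

theorem slice_sub (y w : L2Q Ω T) : ∀ᵐ t ∂volT T, slice (y - w) t = slice y t - slice w t := by
  filter_upwards [slice_coe y, slice_coe w, slice_coe (y - w),
    ae_ae_of_ae_volQ (Lp.coeFn_sub y w)] with t h1 h2 h3 h4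
  refine Lp.ext ?_
  filter_upwards [h1, h2, h3, h4, Lp.coeFn_sub (slice y t) (slice w t)] with x k1 k2 k3 k4 k5
  rw [k3, k4, k5, Pi.sub_apply, Pi.sub_apply, k1, k2]

theorem norm_sub_sq_eq_integral_slice (y w : L2Q Ω T) :
    ‖y - w‖ ^ 2 = ∫ t, ‖slice y t - slice w t‖ ^ 2 ∂volT T := by
  rw [norm_sq_eq_integral_slice]
  refine integral_congr_ae ?_
  filter_upwards [slice_sub y w] with t ht
  rw [ht]

theorem eq_of_slice_ae_eq {y w : L2Q Ω T} (h : ∀ᵐ t ∂volT T, slice y t = slice w t) : y = w := by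
  have h1 : ‖y - w‖ ^ 2 = 0 := by
    rw [norm_sub_sq_eq_integral_slice, integral_congr_ae (g := fun _ => 0), integral_zero]
    filter_upwards [h] with t ht
    rw [ht, sub_self, norm_zero]; norm_num
  exact sub_eq_zero.1 (norm_eq_zero.1 (pow_eq_zero_iff two_ne_zero |>.1 h1))

/-- A curve in `L²(Ω)` with countably many values comes from an element of `L²(Q)`. -/
theorem exists_slice_eq {κ : ℝ → ℕ} (hκ : Measurable κ) (s : ℕ → L2Ω Ω) {C : ℝ}
    (hs : ∀ i, ‖s i‖ ≤ C) : ∃ y : L2Q Ω T, ∀ᵐ t ∂volT T, slice y t = s (κ t) := by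
  set F : Space n × ℝ → ℝ := fun z => s (κ z.2) z.1 with hF
  have hFm : Measurable F := by
    have h1 : Measurable fun p : Space n × ℕ => s p.2 p.1 :=
      measurable_from_prod_countable_left fun i => (Lp.stronglyMeasurable (s i)).measurable
    exact h1.comp (measurable_fst.prodMk (hκ.comp measurable_snd))
  have hm2 : MemLp F 2 (volQ Ω T) := by
    refine memLp_volQ hFm.aestronglyMeasurable (Eventually.of_forall fun t => Lp.memLp (s (κ t))) ?_
    have e : ∀ t, ∫ x, F (x, t) ^ 2 ∂volΩ Ω = ‖s (κ t)‖ ^ 2 := fun t => by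
      rw [← real_inner_self_eq_norm_sq, L2.inner_def]
      refine integral_congr_ae (Eventually.of_forall fun x => ?_)
      simp only [hF, real_inner_self_eq_norm_sq, Real.norm_eq_abs, sq_abs]
    simp only [e]
    have hmeas : Measurable fun t => ‖s (κ t)‖ ^ 2 :=
      (measurable_from_top (f := fun i : ℕ => ‖s i‖ ^ 2)).comp hκ
    refine Integrable.of_bound hmeas.aestronglyMeasurable (C ^ 2) (Eventually.of_forall fun t => ?_)
    rw [norm_pow, norm_norm]
    exact pow_le_pow_left₀ (norm_nonneg _) (hs _) 2
  refine ⟨hm2.toLp F, ?_⟩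
  filter_upwards [slice_coe (hm2.toLp F), ae_ae_of_ae_volQ hm2.coeFn_toLp] with t h1 h2
  refine Lp.ext ?_
  filter_upwards [h1, h2] with x h3 h4
  rw [h3, h4]

/-- On sets of finite measure, Hölder's inequality in `x` and then in `t` gives
`L^p(0,T; L^q(Ω)) ⊆ L²(Q)`. -/
theorem memLp_of_memMixedLp (hΩ : volume Ω ≠ ∞) {p q : ℝ≥0∞} (hp : 2 ≤ p) (hq : 2 ≤ q)
    {g : Space n × ℝ → ℝ} (hg : MemMixedLp Ω T p q g) : MemLp g 2 (volQ Ω T) := by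
  obtain ⟨hm, hfin⟩ := hg
  have : IsFiniteMeasure (volΩ Ω) := ⟨by simpa using lt_top_iff_ne_top.2 hΩ⟩
  refine ⟨hm, ?_⟩
  rw [volQ_eq_prod] at hm ⊢
  set C₁ : ℝ≥0∞ := volΩ Ω univ ^ (1 / (2 : ℝ≥0∞).toReal - 1 / q.toReal) with hC₁
  set C₂ : ℝ≥0∞ := volT T univ ^ (1 / (2 : ℝ≥0∞).toReal - 1 / p.toReal) with hC₂
  have hexp : ∀ {r : ℝ≥0∞}, 2 ≤ r → 0 ≤ 1 / (2 : ℝ≥0∞).toReal - 1 / r.toReal := by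
    intro r hr
    rcases eq_or_ne r ∞ with rfl | hr'
    · simp
    · have h2 : (2 : ℝ≥0∞).toReal ≤ r.toReal := ENNReal.toReal_mono hr' hr
      rw [sub_nonneg]
      exact one_div_le_one_div_of_le (by simp) h2
  have hC₁' : C₁ ≠ ∞ := ENNReal.rpow_ne_top_of_nonneg (hexp hq) (measure_ne_top _ _)
  have hC₂' : C₂ ≠ ∞ := ENNReal.rpow_ne_top_of_nonneg (hexp hp) (measure_ne_top _ _)
  have hin : ∀ᵐ t ∂volT T, eLpNorm (fun x => g (x, t)) 2 (volΩ Ω) ≤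
      C₁ * eLpNorm (fun x => g (x, t)) q (volΩ Ω) := by
    filter_upwards [hm.prodMk_right] with t ht
    rw [mul_comm]
    exact eLpNorm_le_eLpNorm_mul_rpow_measure_univ hq ht
  have hL : AEMeasurable (fun t => eLpNorm (fun x => g (x, t)) 2 (volΩ Ω)) (volT T) := by
    simp only [eLpNorm_eq_lintegral_rpow_enorm_toReal two_ne_zero ENNReal.ofNat_ne_top]
    refine AEMeasurable.pow_const ?_ _
    have := (hm.aemeasurable.enorm.pow_const ((2 : ℝ≥0∞).toReal)).prod_swap.lintegral_prod_right'
    exact this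
  have h2 : eLpNorm (fun t => eLpNorm (fun x => g (x, t)) 2 (volΩ Ω)) 2 (volT T) < ∞ := by
    have k1 := eLpNorm_le_eLpNorm_mul_rpow_measure_univ hp hL.aestronglyMeasurable
    have k2 : eLpNorm (fun t => eLpNorm (fun x => g (x, t)) 2 (volΩ Ω)) p (volT T) ≤
        C₁ * eLpNorm (fun t => eLpNorm (fun x => g (x, t)) q (volΩ Ω)) p (volT T) := by
      obtain ⟨C, hC⟩ : ∃ C : ℝ≥0, (C : ℝ≥0∞) = C₁ := ⟨C₁.toNNReal, ENNReal.coe_toNNReal hC₁'⟩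
      rw [← hC] at hin ⊢
      refine (eLpNorm_le_nnreal_smul_eLpNorm_of_ae_le_mul' (c := C) ?_ p).trans_eq rfl
      filter_upwards [hin] with t ht
      simpa using ht
    refine k1.trans_lt (ENNReal.mul_lt_top ?_ hC₂'.lt_top)
    exact k2.trans_lt (ENNReal.mul_lt_top hC₁'.lt_top hfin)
  rw [eLpNorm_lt_top_iff_lintegral_rpow_enorm_lt_top two_ne_zero ENNReal.ofNat_ne_top] at h2 ⊢
  rw [lintegral_prod_symm _ (hm.aemeasurable.enorm.pow_const _)]
  convert h2 using 3 with t
  rw [enorm_eq_self, eLpNorm_eq_lintegral_rpow_enorm_toReal two_ne_zero ENNReal.ofNat_ne_top,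
    ← ENNReal.rpow_mul]
  simp

end

/-! ### Mollification and `H₀¹(Ω)` -/

noncomputable section

/-- Jensen's inequality for the square and a probability density. -/
theorem sq_integral_mul_le {α : Type*} [MeasurableSpace α] {μ : Measure α} {ρ u : α → ℝ}
    (hρ : 0 ≤ ρ) (hρ1 : ∫ x, ρ x ∂μ = 1) (h0 : Integrable ρ μ)
    (h1 : Integrable (fun x => ρ x * u x) μ) (h2 : Integrable (fun x => ρ x * u x ^ 2) μ) :
    (∫ x, ρ x * u x ∂μ) ^ 2 ≤ ∫ x, ρ x * u x ^ 2 ∂μ := by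
  set m := ∫ x, ρ x * u x ∂μ with hm
  have h3 : 0 ≤ ∫ x, ρ x * (u x - m) ^ 2 ∂μ :=
    integral_nonneg fun x => mul_nonneg (hρ x) (sq_nonneg _)
  have h4 : ∫ x, ρ x * (u x - m) ^ 2 ∂μ = (∫ x, ρ x * u x ^ 2 ∂μ) - m ^ 2 := by
    have e : ∀ x, ρ x * (u x - m) ^ 2 = ρ x * u x ^ 2 - (2 * m * (ρ x * u x) - m ^ 2 * ρ x) :=
      fun x => by ring
    have e1 : ∫ x, (ρ x * u x ^ 2 - (2 * m * (ρ x * u x) - m ^ 2 * ρ x)) ∂μ =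
        (∫ x, ρ x * u x ^ 2 ∂μ) - ∫ x, (2 * m * (ρ x * u x) - m ^ 2 * ρ x) ∂μ :=
      integral_sub h2 ((h1.const_mul _).sub (h0.const_mul _))
    have e2 : ∫ x, (2 * m * (ρ x * u x) - m ^ 2 * ρ x) ∂μ =
        (∫ x, 2 * m * (ρ x * u x) ∂μ) - ∫ x, m ^ 2 * ρ x ∂μ :=
      integral_sub (h1.const_mul _) (h0.const_mul _)
    simp only [e]
    rw [e1, e2, integral_const_mul, integral_const_mul, hρ1, ← hm]
    ring
  linarith

variable {n : ℕ}

theorem norm_gradient_eq (φ : Space n → ℝ) (x : Space n) : ‖gradient φ x‖ = ‖fderiv ℝ φ x‖ := by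
  rw [gradient, LinearIsometryEquiv.norm_map]

/-- The `L²` modulus of continuity of a test function is controlled by its gradient. -/
theorem lintegral_sq_sub_translate_le {φ : Space n → ℝ} (hφ : ContDiff ℝ (⊤ : ℕ∞) φ)
    (z : Space n) :
    ∫⁻ x, ENNReal.ofReal ((φ x - φ (x - z)) ^ 2) ≤
      ENNReal.ofReal (‖z‖ ^ 2) * ∫⁻ x, ENNReal.ofReal (‖fderiv ℝ φ x‖ ^ 2) := by
  have hd : Continuous (fderiv ℝ φ) := hφ.continuous_fderiv (by simp)
  have hpt : ∀ x, ENNReal.ofReal ((φ x - φ (x - z)) ^ 2) ≤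
      ∫⁻ s in Ioc (0 : ℝ) 1, ENNReal.ofReal (‖z‖ ^ 2) *
        ENNReal.ofReal (‖fderiv ℝ φ (x - (1 - s) • z)‖ ^ 2) := by
    intro x
    have hpath : Continuous fun s : ℝ => x - (1 - s) • z := by fun_prop
    have hder : ∀ s : ℝ, HasDerivAt (fun s : ℝ => φ (x - (1 - s) • z))
        (fderiv ℝ φ (x - (1 - s) • z) z) s := by
      intro s
      have h1 : HasDerivAt (fun s : ℝ => x - (1 - s) • z) z s := by
        have h2 : HasDerivAt (fun s : ℝ => (1 - s) • z) ((-1 : ℝ) • z) s :=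
          ((hasDerivAt_id s).const_sub 1).smul_const z
        simpa using h2.const_sub x
      exact ((hφ.differentiable (by simp)) _).hasFDerivAt.comp_hasDerivAt s h1
    have hc : Continuous fun s : ℝ => fderiv ℝ φ (x - (1 - s) • z) z :=
      (hd.comp hpath).clm_apply continuous_const
    have h1 := intervalIntegral.integral_eq_sub_of_hasDerivAt (a := (0 : ℝ)) (b := 1)
      (fun s _ => hder s) (hc.intervalIntegrable _ _)
    simp only [sub_self, zero_smul, sub_zero, one_smul] at h1
    rw [intervalIntegral.integral_of_le zero_le_one] at h1
    have hci : ∀ {u : ℝ → ℝ}, Continuous u → IntegrableOn u (Ioc (0 : ℝ) 1) := fun hu =>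
      (hu.continuousOn.integrableOn_compact isCompact_Icc).mono_set Ioc_subset_Icc_self
    have hJ := sq_integral_mul_le (μ := volume.restrict (Ioc (0 : ℝ) 1)) (ρ := fun _ => 1)
      (u := fun s => fderiv ℝ φ (x - (1 - s) • z) z) (fun _ => zero_le_one) (by simp)
      (hci continuous_const) (hci (continuous_const.mul hc))
      (hci (continuous_const.mul (hc.pow 2)))
    simp only [one_mul] at hJ
    rw [h1] at hJ
    have hle : ∫ s in Ioc (0 : ℝ) 1, (fderiv ℝ φ (x - (1 - s) • z) z) ^ 2 ≤
        ∫ s in Ioc (0 : ℝ) 1, ‖z‖ ^ 2 * ‖fderiv ℝ φ (x - (1 - s) • z)‖ ^ 2 := by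
      refine integral_mono (hci (hc.pow 2))
        (hci (continuous_const.mul ((hd.comp hpath).norm.pow 2))) fun s => ?_
      have h3 := (fderiv ℝ φ (x - (1 - s) • z)).le_opNorm z
      have h4 := pow_le_pow_left₀ (norm_nonneg _) h3 2
      rw [Real.norm_eq_abs, sq_abs, mul_pow] at h4
      simp only
      linarith
    refine (ENNReal.ofReal_le_ofReal (hJ.trans hle)).trans_eq ?_
    have hint : IntegrableOn (fun s : ℝ => ‖z‖ ^ 2 * ‖fderiv ℝ φ (x - (1 - s) • z)‖ ^ 2)
        (Ioc 0 1) := hci (continuous_const.mul ((hd.comp hpath).norm.pow 2))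
    rw [ofReal_integral_eq_lintegral_ofReal hint
      (Eventually.of_forall fun s => by simp only [Pi.zero_apply]; positivity)]
    refine lintegral_congr fun s => ?_
    rw [ENNReal.ofReal_mul (by positivity)]
  have hmeas : Measurable fun q : Space n × ℝ => ENNReal.ofReal (‖z‖ ^ 2) *
      ENNReal.ofReal (‖fderiv ℝ φ (q.1 - (1 - q.2) • z)‖ ^ 2) := by
    refine Measurable.const_mul (Measurable.ennreal_ofReal (Continuous.measurable ?_)) _
    exact ((hd.comp (by fun_prop)).norm.pow 2)
  refine (lintegral_mono hpt).trans ?_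
  rw [lintegral_lintegral_swap hmeas.aemeasurable]
  have h5 : ∀ s : ℝ, ∫⁻ x, ENNReal.ofReal (‖z‖ ^ 2) *
      ENNReal.ofReal (‖fderiv ℝ φ (x - (1 - s) • z)‖ ^ 2) =
      ENNReal.ofReal (‖z‖ ^ 2) * ∫⁻ x, ENNReal.ofReal (‖fderiv ℝ φ x‖ ^ 2) := by
    intro s
    rw [lintegral_const_mul' _ _ ENNReal.ofReal_ne_top,
      lintegral_sub_right_eq_self (fun x => ENNReal.ofReal (‖fderiv ℝ φ x‖ ^ 2))]
  simp only [h5]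
  simp

/-- Mollification at scale `ε` moves a test function by at most `ε ‖∇φ‖` in `L²`. -/
theorem integral_sq_sub_mollify_le {φ : Space n → ℝ} (hφ : ContDiff ℝ (⊤ : ℕ∞) φ)
    (hφs : HasCompactSupport φ) {ρ : Space n → ℝ} {ε : ℝ} (hρc : Continuous ρ)
    (hρs : HasCompactSupport ρ) (hρ0 : 0 ≤ ρ) (hρ1 : ∫ z, ρ z = 1)
    (hρε : ∀ z, ρ z ≠ 0 → ‖z‖ ≤ ε) :
    Integrable (fun x => (φ x - ∫ z, ρ z * φ (x - z)) ^ 2) ∧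
    ∫ x, (φ x - ∫ z, ρ z * φ (x - z)) ^ 2 ≤ ε ^ 2 * ∫ x, ‖fderiv ℝ φ x‖ ^ 2 := by
  have hρi : Integrable ρ := hρc.integrable_of_hasCompactSupport hρs
  have hd : Continuous (fderiv ℝ φ) := hφ.continuous_fderiv (by simp)
  have hds : HasCompactSupport fun x => ‖fderiv ℝ φ x‖ ^ 2 :=
    (hφs.fderiv ℝ).norm.comp_left (g := fun r : ℝ => r ^ 2) (by norm_num)
  have hdi : Integrable fun x => ‖fderiv ℝ φ x‖ ^ 2 :=
    (show Continuous fun x => ‖fderiv ℝ φ x‖ ^ 2 from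
      hd.norm.pow 2).integrable_of_hasCompactSupport hds
  have hTc : Continuous fun x => ∫ z, ρ z * φ (x - z) :=
    hρs.continuous_convolution_left (ContinuousLinearMap.lsmul ℝ ℝ) hρc
      (hφ.continuous.integrable_of_hasCompactSupport hφs).locallyIntegrable
  have hmi : ∀ {u : Space n → ℝ}, Continuous u → Integrable fun z => ρ z * u z := fun hu =>
    (hρc.mul hu).integrable_of_hasCompactSupport hρs.mul_right
  have hpt : ∀ x, ENNReal.ofReal ((φ x - ∫ z, ρ z * φ (x - z)) ^ 2) ≤
      ∫⁻ z, ENNReal.ofReal (ρ z) * ENNReal.ofReal ((φ x - φ (x - z)) ^ 2) := by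
    intro x
    have hu : Continuous fun z => φ x - φ (x - z) :=
      continuous_const.sub (hφ.continuous.comp (continuous_const.sub continuous_id))
    have hi : Integrable fun z => ρ z * (φ x - φ (x - z)) ^ 2 := hmi (hu.pow 2)
    have h1 := sq_integral_mul_le hρ0 hρ1 hρi (hmi hu) hi
    have h2 : ∫ z, ρ z * (φ x - φ (x - z)) = φ x - ∫ z, ρ z * φ (x - z) := by
      have e : ∫ z, (ρ z * φ x - ρ z * φ (x - z)) =
          (∫ z, ρ z * φ x) - ∫ z, ρ z * φ (x - z) :=
        integral_sub (hmi continuous_const)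
          (hmi (hφ.continuous.comp (continuous_const.sub continuous_id)))
      simp only [mul_sub]
      rw [e, integral_mul_const, hρ1, one_mul]
    rw [h2] at h1
    refine (ENNReal.ofReal_le_ofReal h1).trans_eq ?_
    rw [ofReal_integral_eq_lintegral_ofReal hi
      (Eventually.of_forall fun z => mul_nonneg (hρ0 z) (sq_nonneg _))]
    exact lintegral_congr fun z => ENNReal.ofReal_mul (hρ0 z)
  have hlin : ∫⁻ x, ENNReal.ofReal ((φ x - ∫ z, ρ z * φ (x - z)) ^ 2) ≤
      ENNReal.ofReal (ε ^ 2 * ∫ x, ‖fderiv ℝ φ x‖ ^ 2) := by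
    have hmeas : Measurable fun q : Space n × Space n =>
        ENNReal.ofReal (ρ q.2) * ENNReal.ofReal ((φ q.1 - φ (q.1 - q.2)) ^ 2) := by
      have hφc := hφ.continuous
      refine Measurable.mul (Measurable.ennreal_ofReal (Continuous.measurable (by fun_prop)))
        (Measurable.ennreal_ofReal (Continuous.measurable (by fun_prop)))
    refine (lintegral_mono hpt).trans ?_
    rw [lintegral_lintegral_swap hmeas.aemeasurable]
    have hz : ∀ z, ∫⁻ x, ENNReal.ofReal (ρ z) * ENNReal.ofReal ((φ x - φ (x - z)) ^ 2) ≤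
        ENNReal.ofReal (ρ z) * ENNReal.ofReal (ε ^ 2 * ∫ x, ‖fderiv ℝ φ x‖ ^ 2) := by
      intro z
      rw [lintegral_const_mul' _ _ ENNReal.ofReal_ne_top]
      rcases eq_or_ne (ρ z) 0 with h0 | h0
      · simp [h0]
      refine mul_le_mul' le_rfl ((lintegral_sq_sub_translate_le hφ z).trans ?_)
      have hzb : ‖z‖ ≤ ε := hρε z h0
      rw [← ofReal_integral_eq_lintegral_ofReal hdi (Eventually.of_forall fun x => sq_nonneg _),
        ← ENNReal.ofReal_mul (sq_nonneg _)]
      refine ENNReal.ofReal_le_ofReal (mul_le_mul_of_nonneg_right ?_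
        (integral_nonneg fun x => sq_nonneg _))
      exact pow_le_pow_left₀ (norm_nonneg _) hzb 2
    refine (lintegral_mono hz).trans ?_
    rw [lintegral_mul_const' _ _ ENNReal.ofReal_ne_top,
      ← ofReal_integral_eq_lintegral_ofReal hρi (Eventually.of_forall hρ0), hρ1,
      ENNReal.ofReal_one, one_mul]
  have hm : AEStronglyMeasurable (fun x => (φ x - ∫ z, ρ z * φ (x - z)) ^ 2) volume :=
    ((hφ.continuous.sub hTc).pow 2).aestronglyMeasurable
  have hnn : 0 ≤ᵐ[volume] fun x => (φ x - ∫ z, ρ z * φ (x - z)) ^ 2 :=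
    Eventually.of_forall fun x => sq_nonneg _
  refine ⟨(lintegral_ofReal_ne_top_iff_integrable hm hnn).1
    (hlin.trans_lt ENNReal.ofReal_lt_top).ne, ?_⟩
  rw [integral_eq_lintegral_of_nonneg_ae hnn hm]
  refine (ENNReal.toReal_mono ENNReal.ofReal_ne_top hlin).trans_eq (ENNReal.toReal_ofReal ?_)
  exact mul_nonneg (sq_nonneg _) (integral_nonneg fun x => sq_nonneg _)

variable {Ω : Set (Space n)}

/-- The element of `H₀¹(Ω)` given by a test function. -/
theorem exists_H10_of_test {φ : Space n → ℝ} (hφ : ContDiff ℝ (⊤ : ℕ∞) φ)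
    (hφs : HasCompactSupport φ) (hφt : tsupport φ ⊆ Ω) :
    ∃ v : H10 Ω, toPair Ω v ∈ testPairs Ω ∧ toL2 Ω v =ᵐ[volΩ Ω] φ ∧
      grad Ω v =ᵐ[volΩ Ω] gradient φ := by
  have hd : Continuous (fderiv ℝ φ) := hφ.continuous_fderiv (by simp)
  have hg : Continuous (gradient φ) :=
    (InnerProductSpace.toDual ℝ (Space n)).symm.continuous.comp hd
  have hgs : HasCompactSupport (gradient φ) := by
    refine (hφs.fderiv ℝ).comp_left (g := (InnerProductSpace.toDual ℝ (Space n)).symm) (map_zero _)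
  have m1 : MemLp φ 2 (volΩ Ω) := (hφ.continuous.memLp_of_hasCompactSupport hφs).restrict _
  have m2 : MemLp (gradient φ) 2 (volΩ Ω) := (hg.memLp_of_hasCompactSupport hgs).restrict _
  let p : PairSpace Ω := WithLp.toLp 2 (m1.toLp φ, m2.toLp (gradient φ))
  have hp : p ∈ testPairs Ω := ⟨φ, hφ, hφs, hφt, m1.coeFn_toLp, m2.coeFn_toLp⟩
  exact ⟨⟨p, Submodule.le_topologicalClosure _ hp⟩, hp, m1.coeFn_toLp, m2.coeFn_toLp⟩

theorem norm_sq_H10 (v : H10 Ω) : ‖v‖ ^ 2 = ‖toL2 Ω v‖ ^ 2 + ‖grad Ω v‖ ^ 2 := by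
  have h : ‖v‖ = ‖toPair Ω v‖ := rfl
  rw [h, WithLp.prod_norm_sq_eq_of_L2]
  rfl

/-- `C_c^∞(Ω)`, hence `H₀¹(Ω)`, is dense in `L²(Ω)`. -/
theorem denseRange_toL2 (hΩ : IsOpen Ω) : DenseRange (toL2 Ω) := by
  have : Dense ((LinearMap.range (toL2 Ω).toLinearMap : Submodule ℝ (L2Ω Ω)) : Set (L2Ω Ω)) := by
    rw [Submodule.dense_iff_topologicalClosure_eq_top,
      Submodule.topologicalClosure_eq_top_iff, Submodule.eq_bot_iff]
    intro g hg
    have hgloc : LocallyIntegrableOn g Ω volume := by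
      have hl : LocallyIntegrable g (volΩ Ω) := (Lp.memLp g).locallyIntegrable one_le_two
      exact locallyIntegrableOn_of_locallyIntegrable_restrict hl
    have h0 := hΩ.ae_eq_zero_of_integral_contDiff_smul_eq_zero hgloc fun φ h1 h2 h3 => by
      obtain ⟨v, -, hv, -⟩ := exists_H10_of_test h1 h2 h3
      have h4 : ⟪toL2 Ω v, g⟫_ℝ = 0 := (Submodule.mem_orthogonal _ _).1 hg _ ⟨v, rfl⟩
      rw [L2.inner_def] at h4
      rw [← setIntegral_eq_integral_of_forall_compl_eq_zero (s := Ω) fun x hx => by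
        rw [image_eq_zero_of_notMem_tsupport fun h' => hx (h3 h'), zero_smul], ← h4]
      refine integral_congr_ae ?_
      filter_upwards [hv] with x hx
      rw [hx, real_inner_comm, smul_eq_mul]
      simp
    rw [Lp.eq_zero_iff_ae_eq_zero]
    exact (ae_restrict_iff' hΩ.measurableSet).2 h0
  exact this

end

/-! ### Friedrichs' inequality -/

noncomputable section

theorem norm_sq_eq_integral {α E : Type*} [MeasurableSpace α] {μ : Measure α}
    [NormedAddCommGroup E] [InnerProductSpace ℝ E] (g : Lp E 2 μ) :
    ‖g‖ ^ 2 = ∫ x, ‖g x‖ ^ 2 ∂μ := by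
  rw [← real_inner_self_eq_norm_sq, L2.inner_def]
  simp only [real_inner_self_eq_norm_sq]

variable {n : ℕ} {Ω : Set (Space n)}

/-- Translates of a continuous kernel with compact support form a totally bounded set
in `L²(Ω)` as the centre ranges over the bounded set `Ω`. -/
theorem exists_finset_translates (hb : Bornology.IsBounded Ω) {ρ : Space n → ℝ}
    (hρc : Continuous ρ) (hρs : HasCompactSupport ρ) {δ : ℝ} (hδ : 0 < δ) :
    ∃ (G : Space n → L2Ω Ω) (s : Finset (L2Ω Ω)),
      (∀ x, G x =ᵐ[volΩ Ω] fun z => ρ (x - z)) ∧ ∀ x ∈ Ω, ∃ g ∈ s, ‖G x - g‖ < δ := by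
  have : IsFiniteMeasure (volΩ Ω) := ⟨by simpa using hb.measure_lt_top⟩
  obtain ⟨M, hM⟩ := hρs.exists_bound_of_continuous hρc
  have hm : ∀ x, MemLp (fun z => ρ (x - z)) 2 (volΩ Ω) := fun x =>
    MemLp.of_bound (hρc.comp (continuous_const.sub continuous_id)).aestronglyMeasurable M
      (Eventually.of_forall fun z => hM _)
  have hG : UniformContinuous fun x => (hm x).toLp := by
    rw [Metric.uniformContinuous_iff]
    intro ε hε
    set K : ℝ := (measureUnivNNReal (volΩ Ω) : ℝ) ^ ((2 : ℝ≥0∞).toReal)⁻¹ with hK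
    have hK0 : 0 ≤ K := by positivity
    obtain ⟨r, hr, hr2⟩ := Metric.uniformContinuous_iff.1
      (hρs.uniformContinuous_of_continuous hρc) (ε / (K + 1)) (by positivity)
    refine ⟨r, hr, fun {x y} hxy => ?_⟩
    rw [dist_eq_norm]
    have h1 : ∀ᵐ z ∂volΩ Ω, ‖((hm x).toLp - (hm y).toLp) z‖ ≤ ε / (K + 1) := by
      filter_upwards [Lp.coeFn_sub (hm x).toLp (hm y).toLp, (hm x).coeFn_toLp, (hm y).coeFn_toLp]
        with z h1 h2 h3
      rw [h1, Pi.sub_apply, h2, h3, ← dist_eq_norm]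
      refine (hr2 ?_).le
      rwa [dist_sub_right]
    have h2 := Lp.norm_le_of_ae_bound (by positivity) h1
    rw [← hK] at h2
    refine h2.trans_lt ?_
    rw [mul_div_assoc', div_lt_iff₀ (by positivity)]
    nlinarith
  have htb : TotallyBounded ((fun x => (hm x).toLp) '' Ω) := by
    refine TotallyBounded.image ?_ hG
    exact hb.isCompact_closure.totallyBounded.subset subset_closure
  obtain ⟨t, ht, hcov⟩ := Metric.totallyBounded_iff.1 htb δ hδ
  refine ⟨fun x => (hm x).toLp, ht.toFinset, fun x => (hm x).coeFn_toLp, fun x hx => ?_⟩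
  obtain ⟨g, hg, hxg⟩ := mem_iUnion₂.1 (hcov ⟨x, hx, rfl⟩)
  exact ⟨g, ht.mem_toFinset.2 hg, by rwa [← dist_eq_norm]⟩

/-- Friedrichs' inequality for test functions: up to a small multiple of the `H¹` norm, finitely
many `L²` functionals control the `L²` norm. -/
theorem friedrichs_test (hΩ : IsOpen Ω) (hb : Bornology.IsBounded Ω) {η : ℝ} (hη : 0 < η) :
    ∃ (C : ℝ) (s : Finset (L2Ω Ω)), 0 ≤ C ∧ ∀ v : H10 Ω, toPair Ω v ∈ testPairs Ω →
      ‖toL2 Ω v‖ ^ 2 ≤ η * ‖v‖ ^ 2 + C * ∑ g ∈ s, ⟪g, toL2 Ω v⟫_ℝ ^ 2 := by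
  have hfin : IsFiniteMeasure (volΩ Ω) := ⟨by simpa using hb.measure_lt_top⟩
  set V : ℝ := volume.real Ω with hV
  have hV0 : 0 ≤ V := measureReal_nonneg
  -- `ε` is the scale of mollification, `δ` the accuracy of the finite family of translates
  set ε : ℝ := √(η / 4)
  have hε : 0 < ε := Real.sqrt_pos.2 (by positivity)
  have hε2 : ε ^ 2 = η / 4 := Real.sq_sqrt (by positivity)
  set δ : ℝ := √(η / (8 * (V + 1)))
  have hδ : 0 < δ := Real.sqrt_pos.2 (by positivity)
  have hδ2 : δ ^ 2 = η / (8 * (V + 1)) := Real.sq_sqrt (by positivity)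
  obtain ⟨ρ, hρc, hρs, hρ0, hρ1, hρε⟩ : ∃ ρ : Space n → ℝ, Continuous ρ ∧ HasCompactSupport ρ ∧
      0 ≤ ρ ∧ ∫ z, ρ z = 1 ∧ ∀ z, ρ z ≠ 0 → ‖z‖ ≤ ε := by
    let b : ContDiffBump (0 : Space n) := ⟨ε / 2, ε, half_pos hε, half_lt_self hε⟩
    refine ⟨b.normed volume, (b.contDiff_normed (n := 0)).continuous, b.hasCompactSupport_normed,
      fun x => b.nonneg_normed x, b.integral_normed, fun z hz => ?_⟩
    have h1 : z ∈ Function.support (b.normed volume) := hz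
    rw [b.support_normed_eq, mem_ball_zero_iff] at h1
    exact h1.le
  obtain ⟨G, s, hG, hs⟩ := exists_finset_translates hb hρc hρs hδ
  refine ⟨4 * V, s, by positivity, fun v hv => ?_⟩
  obtain ⟨φ, hφ, hφs, hφt, hv1, hv2⟩ := hv
  change toL2 Ω v =ᵐ[volΩ Ω] φ at hv1
  change grad Ω v =ᵐ[volΩ Ω] gradient φ at hv2
  have hφ0 : ∀ x ∉ Ω, φ x = 0 := fun x hx => image_eq_zero_of_notMem_tsupport fun h => hx (hφt h)
  obtain ⟨hi, hmol⟩ := integral_sq_sub_mollify_le hφ hφs hρc hρs hρ0 hρ1 hρε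
  -- the values of the mollified function are pairings with translates of the kernel
  have hT : ∀ x, ∫ z, ρ z * φ (x - z) = ⟪G x, toL2 Ω v⟫_ℝ := by
    intro x
    rw [← integral_sub_left_eq_self (fun z => ρ z * φ (x - z)) volume x, L2.inner_def]
    simp only [sub_sub_cancel]
    rw [← setIntegral_eq_integral_of_forall_compl_eq_zero (s := Ω) fun z hz => by
      rw [hφ0 z hz, mul_zero]]
    refine integral_congr_ae ?_
    filter_upwards [hG x, hv1] with z h1 h2
    rw [h1, h2]
    simp [mul_comm]
  have hgrad : ∫ x, ‖fderiv ℝ φ x‖ ^ 2 = ‖grad Ω v‖ ^ 2 := by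
    rw [norm_sq_eq_integral,
      ← setIntegral_eq_integral_of_forall_compl_eq_zero (s := Ω) fun z hz => by
      rw [image_eq_zero_of_notMem_tsupport fun h => hz (hφt (tsupport_fderiv_subset ℝ h))]
      simp]
    refine integral_congr_ae ?_
    filter_upwards [hv2] with x hx
    rw [hx, norm_gradient_eq]
  set S := ∑ g ∈ s, ⟪g, toL2 Ω v⟫_ℝ ^ 2 with hS
  have hpt : ∀ x ∈ Ω, (∫ z, ρ z * φ (x - z)) ^ 2 ≤ 2 * S + 2 * (δ ^ 2 * ‖toL2 Ω v‖ ^ 2) := by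
    intro x hx
    obtain ⟨g, hg, hxg⟩ := hs x hx
    have h1 : ⟪g, toL2 Ω v⟫_ℝ ^ 2 ≤ S :=
      Finset.single_le_sum (f := fun g => ⟪g, toL2 Ω v⟫_ℝ ^ 2) (fun g _ => sq_nonneg _) hg
    have h2 : ⟪G x - g, toL2 Ω v⟫_ℝ ^ 2 ≤ δ ^ 2 * ‖toL2 Ω v‖ ^ 2 := by
      rw [← mul_pow, ← sq_abs]
      refine pow_le_pow_left₀ (abs_nonneg _) ((abs_real_inner_le_norm _ _).trans ?_) 2
      exact mul_le_mul_of_nonneg_right hxg.le (norm_nonneg _)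
    rw [inner_sub_left] at h2
    rw [hT]
    nlinarith [sq_nonneg (⟪G x, toL2 Ω v⟫_ℝ - 2 * ⟪g, toL2 Ω v⟫_ℝ)]
  have hφi : Integrable (fun x => φ x ^ 2) (volΩ Ω) :=
    ((hφ.continuous.memLp_of_hasCompactSupport hφs (p := 2)).integrable_sq).restrict
  have h1 : ‖toL2 Ω v‖ ^ 2 = ∫ x in Ω, φ x ^ 2 := by
    rw [norm_sq_eq_integral]
    refine integral_congr_ae ?_
    filter_upwards [hv1] with x hx
    rw [hx, Real.norm_eq_abs, sq_abs]
  have h2 : ∫ x in Ω, φ x ^ 2 ≤ ∫ x in Ω, (2 * (φ x - ∫ z, ρ z * φ (x - z)) ^ 2 +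
      2 * (2 * S + 2 * (δ ^ 2 * ‖toL2 Ω v‖ ^ 2))) := by
    refine setIntegral_mono_on hφi ((hi.restrict.const_mul 2).add (integrable_const _))
      hΩ.measurableSet fun x hx => ?_
    have := hpt x hx
    nlinarith [sq_nonneg (φ x - 2 * ∫ z, ρ z * φ (x - z))]
  have h3 : ∫ x in Ω, (2 * (φ x - ∫ z, ρ z * φ (x - z)) ^ 2 +
      2 * (2 * S + 2 * (δ ^ 2 * ‖toL2 Ω v‖ ^ 2))) =
      2 * (∫ x in Ω, (φ x - ∫ z, ρ z * φ (x - z)) ^ 2) +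
        V * (2 * (2 * S + 2 * (δ ^ 2 * ‖toL2 Ω v‖ ^ 2))) := by
    rw [integral_add (hi.restrict.const_mul 2) (integrable_const _), integral_const_mul,
      integral_const, smul_eq_mul, measureReal_restrict_apply_univ]
  have h4 : ∫ x in Ω, (φ x - ∫ z, ρ z * φ (x - z)) ^ 2 ≤ ε ^ 2 * ‖grad Ω v‖ ^ 2 := by
    rw [← hgrad]
    exact (setIntegral_le_integral hi (Eventually.of_forall fun x => sq_nonneg _)).trans hmol
  have h5 : V * δ ^ 2 ≤ η / 8 := by
    rw [hδ2, mul_div_assoc', div_le_div_iff₀ (by positivity) (by norm_num)]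
    nlinarith
  have h6 := norm_sq_H10 v
  have h7 : V * δ ^ 2 * ‖toL2 Ω v‖ ^ 2 ≤ η / 8 * ‖toL2 Ω v‖ ^ 2 :=
    mul_le_mul_of_nonneg_right h5 (sq_nonneg _)
  rw [hε2] at h4
  have h8 : 0 ≤ η * ‖grad Ω v‖ ^ 2 := by positivity
  have h9 : 0 ≤ η * ‖toL2 Ω v‖ ^ 2 := by positivity
  nlinarith

/-- Friedrichs' inequality in `H₀¹(Ω)`; it expresses the compactness of `H₀¹(Ω) → L²(Ω)`. -/
theorem friedrichs (hΩ : IsOpen Ω) (hb : Bornology.IsBounded Ω) {η : ℝ} (hη : 0 < η) :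
    ∃ (C : ℝ) (s : Finset (L2Ω Ω)), 0 ≤ C ∧ ∀ v : H10 Ω,
      ‖toL2 Ω v‖ ^ 2 ≤ η * ‖v‖ ^ 2 + C * ∑ g ∈ s, ⟪g, toL2 Ω v⟫_ℝ ^ 2 := by
  obtain ⟨C, s, hC, h⟩ := friedrichs_test hΩ hb hη
  refine ⟨C, s, hC, fun v => ?_⟩
  let P : PairSpace Ω → Prop := fun p =>
    ‖WithLp.fstL 2 ℝ _ _ p‖ ^ 2 ≤ η * ‖p‖ ^ 2 + C * ∑ g ∈ s, ⟪g, WithLp.fstL 2 ℝ _ _ p⟫_ℝ ^ 2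
  have hcl : IsClosed {p | P p} := by
    refine isClosed_le (by fun_prop) (by fun_prop)
  have hsub : (testPairs Ω : Set (PairSpace Ω)) ⊆ {p | P p} := fun p hp =>
    h ⟨p, Submodule.le_topologicalClosure _ hp⟩ hp
  exact closure_minimal hsub hcl v.2

theorem exists_seq_test (v : H10 Ω) : ∃ w : ℕ → H10 Ω, (∀ k, toPair Ω (w k) ∈ testPairs Ω) ∧
    Tendsto w atTop (𝓝 v) := by
  obtain ⟨p, hp, hlim⟩ := mem_closure_iff_seq_limit.1 (show (v.1 : PairSpace Ω) ∈
    closure (testPairs Ω : Set (PairSpace Ω)) from v.2)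
  refine ⟨fun k => ⟨p k, Submodule.le_topologicalClosure _ (hp k)⟩, hp, ?_⟩
  exact tendsto_subtype_rng.2 hlim

end

/-! ### The elliptic operator and composition with smooth functions -/

noncomputable section

/-- Multiplication by an essentially bounded function, as an operator of `L²`. -/
theorem exists_mul_operator {α : Type*} [MeasurableSpace α] {μ : Measure α} {b : α → ℝ}
    (hb : MemLp b ∞ μ) : ∃ m : Lp ℝ 2 μ →L[ℝ] Lp ℝ 2 μ, ∀ g, m g =ᵐ[μ] fun x => b x * g x := by
  refine ⟨(ContinuousLinearMap.mul ℝ ℝ).holderL μ ∞ 2 2 hb.toLp, fun g => ?_⟩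
  filter_upwards [(ContinuousLinearMap.mul ℝ ℝ).coeFn_holder (r := 2) hb.toLp g, hb.coeFn_toLp]
    with x h1 h2
  rw [ContinuousLinearMap.holderL_apply_apply, h1, h2]
  rfl

variable {n : ℕ} {Ω : Set (Space n)} {a : Fin n → Fin n → Space n → ℝ} {a₀ : Space n → ℝ}

/-- The `i`-th weak partial derivative. -/
def partialDeriv (Ω : Set (Space n)) (i : Fin n) : H10 Ω →L[ℝ] L2Ω Ω :=
  ((EuclideanSpace.proj i : Space n →L[ℝ] ℝ).compLpL 2 (volΩ Ω)).comp (grad Ω)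

theorem partialDeriv_coe (i : Fin n) (v : H10 Ω) :
    partialDeriv Ω i v =ᵐ[volΩ Ω] fun x => grad Ω v x i :=
  (EuclideanSpace.proj i : Space n →L[ℝ] ℝ).coeFn_compLpL (grad Ω v)

theorem integrable_coeff_mul {b : Space n → ℝ} (hb : MemLp b ∞ (volΩ Ω)) {g h : Space n → ℝ}
    (hg : MemLp g 2 (volΩ Ω)) (hh : MemLp h 2 (volΩ Ω)) :
    Integrable (fun x => b x * g x * h x) (volΩ Ω) := by
  have h1 : MemLp (fun x => b x * g x) 2 (volΩ Ω) := hg.mul hb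
  exact h1.integrable_mul hh

theorem memLp_grad_apply (v : H10 Ω) (i : Fin n) : MemLp (fun x => grad Ω v x i) 2 (volΩ Ω) :=
  (Lp.memLp (partialDeriv Ω i v)).ae_eq (partialDeriv_coe i v)

theorem integrable_formA (ha : ∀ i j, MemLp (a i j) ∞ (volΩ Ω)) (ha₀ : MemLp a₀ ∞ (volΩ Ω))
    (y v : H10 Ω) : Integrable (fun x => (∑ i, ∑ j, a i j x * grad Ω y x i * grad Ω v x j) +
      a₀ x * toL2 Ω y x * toL2 Ω v x) (volΩ Ω) := by
  refine Integrable.add ?_ (integrable_coeff_mul ha₀ (Lp.memLp _) (Lp.memLp _))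
  exact integrable_finsetSum _ fun i _ => integrable_finsetSum _ fun j _ =>
    integrable_coeff_mul (ha i j) (memLp_grad_apply y i) (memLp_grad_apply v j)

/-- The operator `A` on `H₀¹(Ω)`, under the Riesz identification of `H⁻¹(Ω)` with `H₀¹(Ω)`. -/
theorem exists_operator (ha : ∀ i j, MemLp (a i j) ∞ (volΩ Ω)) (ha₀ : MemLp a₀ ∞ (volΩ Ω)) :
    ∃ A : H10 Ω →L[ℝ] H10 Ω, ∀ y v, formA Ω a a₀ y v = ⟪A y, v⟫_ℝ := by
  choose m hm using fun i j => exists_mul_operator (ha i j)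
  obtain ⟨m₀, hm₀⟩ := exists_mul_operator ha₀
  refine ⟨(∑ i, ∑ j, (ContinuousLinearMap.adjoint (partialDeriv Ω j)).comp
    ((m i j).comp (partialDeriv Ω i))) +
    (ContinuousLinearMap.adjoint (toL2 Ω)).comp (m₀.comp (toL2 Ω)), fun y v => ?_⟩
  have e1 : ∀ i j, ∫ x in Ω, a i j x * grad Ω y x i * grad Ω v x j =
      ⟪m i j (partialDeriv Ω i y), partialDeriv Ω j v⟫_ℝ := by
    intro i j
    rw [L2.inner_def]
    refine integral_congr_ae ?_
    filter_upwards [hm i j (partialDeriv Ω i y), partialDeriv_coe i y, partialDeriv_coe j v]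
      with x h1 h2 h3
    rw [h1, h2, h3]
    simp [mul_comm]
  have e2 : ∫ x in Ω, a₀ x * toL2 Ω y x * toL2 Ω v x = ⟪m₀ (toL2 Ω y), toL2 Ω v⟫_ℝ := by
    rw [L2.inner_def]
    refine integral_congr_ae ?_
    filter_upwards [hm₀ (toL2 Ω y)] with x h1
    rw [h1]
    simp [mul_comm]
  have hi : ∀ i j, Integrable (fun x => a i j x * grad Ω y x i * grad Ω v x j) (volΩ Ω) :=
    fun i j => integrable_coeff_mul (ha i j) (memLp_grad_apply y i) (memLp_grad_apply v j)
  have e3 : formA Ω a a₀ y v = (∑ i, ∑ j, ∫ x in Ω, a i j x * grad Ω y x i * grad Ω v x j) +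
      ∫ x in Ω, a₀ x * toL2 Ω y x * toL2 Ω v x := by
    have e4 : formA Ω a a₀ y v = (∫ x in Ω, ∑ i, ∑ j, a i j x * grad Ω y x i * grad Ω v x j) +
        ∫ x in Ω, a₀ x * toL2 Ω y x * toL2 Ω v x :=
      integral_add (integrable_finsetSum _ fun i _ => integrable_finsetSum _ fun j _ => hi i j)
        (integrable_coeff_mul ha₀ (Lp.memLp _) (Lp.memLp _))
    rw [e4, integral_finsetSum _ fun i _ => integrable_finsetSum _ fun j _ => hi i j]
    simp only [integral_finsetSum _ fun j _ => hi _ j]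
  rw [e3, e2]
  simp only [e1, add_apply, sum_apply, inner_add_left,
    sum_inner, ContinuousLinearMap.comp_apply, ContinuousLinearMap.adjoint_inner_left]

/-- Coercivity up to the `L²` norm: only the gradient is controlled, since `a₀` may vanish. -/
theorem formA_coercive (ha : ∀ i j, MemLp (a i j) ∞ (volΩ Ω)) (ha₀ : MemLp a₀ ∞ (volΩ Ω)) {Λ : ℝ}
    (hell : ∀ᵐ x ∂volΩ Ω, ∀ ξ : Space n, Λ * ‖ξ‖ ^ 2 ≤ ∑ i, ∑ j, a i j x * ξ i * ξ j)
    (hnn : ∀ᵐ x ∂volΩ Ω, 0 ≤ a₀ x) (v : H10 Ω) : Λ * ‖grad Ω v‖ ^ 2 ≤ formA Ω a a₀ v v := by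
  rw [norm_sq_eq_integral, ← integral_const_mul]
  refine integral_mono_ae ?_ (integrable_formA ha ha₀ v v) ?_
  · exact ((Lp.memLp (grad Ω v)).integrable_norm_pow two_ne_zero).const_mul Λ
  · filter_upwards [hell, hnn] with x h1 h2
    have h3 := mul_nonneg h2 (mul_self_nonneg (toL2 Ω v x))
    have h4 := h1 (grad Ω v x)
    linarith [mul_assoc (a₀ x) (toL2 Ω v x) (toL2 Ω v x)]

/-- The chain rule for test functions: composition with a smooth nondecreasing function keeps the
`H¹` norm bounded and pairs nonnegatively with the elliptic form. -/
theorem exists_comp_test {Λ : ℝ} (hΛ : 0 ≤ Λ)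
    (hell : ∀ᵐ x ∂volΩ Ω, ∀ ξ : Space n, Λ * ‖ξ‖ ^ 2 ≤ ∑ i, ∑ j, a i j x * ξ i * ξ j)
    (hnn : ∀ᵐ x ∂volΩ Ω, 0 ≤ a₀ x) {g : ℝ → ℝ} (hg : ContDiff ℝ (⊤ : ℕ∞) g) (g0 : g 0 = 0)
    (hmono : Monotone g) {L : ℝ≥0} (hL : LipschitzWith L g) {w : H10 Ω}
    (hw : toPair Ω w ∈ testPairs Ω) :
    ∃ v : H10 Ω, toL2 Ω v = hL.compLp g0 (toL2 Ω w) ∧ ‖v‖ ≤ L * ‖w‖ ∧ 0 ≤ formA Ω a a₀ w v := by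
  obtain ⟨φ, hφ, hφs, hφt, hw1, hw2⟩ := hw
  change toL2 Ω w =ᵐ[volΩ Ω] φ at hw1
  change grad Ω w =ᵐ[volΩ Ω] gradient φ at hw2
  have hψt : tsupport (g ∘ φ) ⊆ Ω := (tsupport_comp_subset g0 φ).trans hφt
  obtain ⟨v, -, hv1, hv2⟩ := exists_H10_of_test (hg.comp hφ) (hφs.comp_left g0) hψt
  have hchain : ∀ x, gradient (g ∘ φ) x = deriv g (φ x) • gradient φ x := by
    intro x
    have h1 : HasFDerivAt (g ∘ φ) (deriv g (φ x) • fderiv ℝ φ x) x :=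
      ((hg.differentiable (by simp)) _).hasDerivAt.comp_hasFDerivAt x
        ((hφ.differentiable (by simp)) x).hasFDerivAt
    rw [gradient, h1.fderiv, map_smul, gradient]
  have hv3 : grad Ω v =ᵐ[volΩ Ω] fun x => deriv g (φ x) • grad Ω w x := by
    filter_upwards [hv2, hw2] with x h1 h2
    rw [h1, h2, hchain]
  have hv4 : toL2 Ω v = hL.compLp g0 (toL2 Ω w) := by
    refine Lp.ext ?_
    filter_upwards [hv1, hw1, hL.coeFn_compLp g0 (toL2 Ω w)] with x h1 h2 h3
    rw [h1, h3, Function.comp_apply, Function.comp_apply, h2]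
  have hd0 : ∀ s, 0 ≤ deriv g s := fun s => hmono.deriv_nonneg
  refine ⟨v, hv4, ?_, ?_⟩
  · have h1 : ‖toL2 Ω v‖ ≤ L * ‖toL2 Ω w‖ := by
      rw [hv4]; exact hL.norm_compLp_le g0 _
    have h2 : ‖grad Ω v‖ ≤ L * ‖grad Ω w‖ := by
      refine Lp.norm_le_mul_norm_of_ae_le_mul ?_
      filter_upwards [hv3] with x hx
      rw [hx, norm_smul]
      exact mul_le_mul_of_nonneg_right (norm_deriv_le_of_lipschitz hL) (norm_nonneg _)
    refine le_of_sq_le_sq ?_ (by positivity)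
    rw [norm_sq_H10, mul_pow, norm_sq_H10]
    have h3 := pow_le_pow_left₀ (norm_nonneg _) h1 2
    have h4 := pow_le_pow_left₀ (norm_nonneg _) h2 2
    rw [mul_pow] at h3 h4
    linarith
  · refine integral_nonneg_of_ae ?_
    filter_upwards [hell, hnn, hv3, hv1, hw1] with x h1 h2 h3 h4 h5
    have h6 : ∑ i, ∑ j, a i j x * grad Ω w x i * grad Ω v x j =
        deriv g (φ x) * ∑ i, ∑ j, a i j x * grad Ω w x i * grad Ω w x j := by
      rw [Finset.mul_sum]
      refine Finset.sum_congr rfl fun i _ => ?_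
      rw [Finset.mul_sum]
      refine Finset.sum_congr rfl fun j _ => ?_
      rw [h3, PiLp.smul_apply, smul_eq_mul]
      ring
    have h7 : 0 ≤ φ x * g (φ x) := by
      rcases le_total 0 (φ x) with h | h
      · exact mul_nonneg h (g0 ▸ hmono h)
      · exact mul_nonneg_of_nonpos_of_nonpos h (g0 ▸ hmono h)
    simp only [Pi.zero_apply]
    rw [h6, h4, h5, Function.comp_apply, mul_assoc]
    refine add_nonneg (mul_nonneg (hd0 _) (le_trans (by positivity) (h1 _))) (mul_nonneg h2 h7)

/-- For `y ∈ H₀¹(Ω)` and a smooth nondecreasing Lipschitz function `g` with `g(0) = 0`, the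
composition `g(y)` lies in `H₀¹(Ω)` and `⟨A y, g(y)⟩ ≥ 0`. -/
theorem exists_comp (ha : ∀ i j, MemLp (a i j) ∞ (volΩ Ω)) (ha₀ : MemLp a₀ ∞ (volΩ Ω)) {Λ : ℝ}
    (hΛ : 0 ≤ Λ)
    (hell : ∀ᵐ x ∂volΩ Ω, ∀ ξ : Space n, Λ * ‖ξ‖ ^ 2 ≤ ∑ i, ∑ j, a i j x * ξ i * ξ j)
    (hnn : ∀ᵐ x ∂volΩ Ω, 0 ≤ a₀ x) {g : ℝ → ℝ} (hg : ContDiff ℝ (⊤ : ℕ∞) g) (g0 : g 0 = 0)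
    (hmono : Monotone g) {L : ℝ≥0} (hL : LipschitzWith L g) (y : H10 Ω) :
    ∃ v : H10 Ω, toL2 Ω v = hL.compLp g0 (toL2 Ω y) ∧ 0 ≤ formA Ω a a₀ y v := by
  obtain ⟨A, hA⟩ := exists_operator ha ha₀
  obtain ⟨w, hw, hlim⟩ := exists_seq_test y
  choose v hv1 hv2 hv3 using fun k =>
    exists_comp_test hΛ hell hnn hg g0 hmono hL (hw k)
  obtain ⟨M, hM⟩ : ∃ M, ∀ k, ‖w k‖ ≤ M := by
    obtain ⟨M, hM⟩ := hlim.norm.bddAbove_range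
    exact ⟨M, fun k => hM ⟨k, rfl⟩⟩
  have hvM : ∀ k, ‖v k‖ ≤ L * M := fun k =>
    (hv2 k).trans (mul_le_mul_of_nonneg_left (hM k) L.2)
  obtain ⟨z, κ, hκ, hz⟩ := exists_subseq_tendsto_inner hvM
  have hwκ := hlim.comp hκ.tendsto_atTop
  refine ⟨z, ?_, ?_⟩
  · refine ext_inner_right ℝ fun q => ?_
    have h1 : Tendsto (fun k => ⟪toL2 Ω (v (κ k)), q⟫_ℝ) atTop (𝓝 ⟪toL2 Ω z, q⟫_ℝ) := by
      simpa only [ContinuousLinearMap.adjoint_inner_right] using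
        hz (ContinuousLinearMap.adjoint (toL2 Ω) q)
    have h2 : Tendsto (fun k => toL2 Ω (v (κ k))) atTop (𝓝 (hL.compLp g0 (toL2 Ω y))) := by
      simp only [hv1]
      exact ((hL.continuous_compLp g0).comp (toL2 Ω).continuous).continuousAt.tendsto.comp hwκ
    exact tendsto_nhds_unique h1 (h2.inner tendsto_const_nhds)
  · have h5 : Tendsto (fun k => formA Ω a a₀ (w (κ k)) (v (κ k))) atTop (𝓝 (formA Ω a a₀ y z)) := by
      have h6 := tendsto_inner_of_tendsto (fun k => hvM (κ k)) hz
        (A.continuous.continuousAt.tendsto.comp hwκ)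
      simpa only [hA, real_inner_comm, Function.comp_def] using h6
    exact ge_of_tendsto' h5 fun k => hv3 _

end

/-! ### Smooth approximation of monotone functions, potentials and step functions -/

section

/-- A nondecreasing `C¹` function is approximated, uniformly on a bounded interval, by smooth
nondecreasing Lipschitz functions with the same value at zero. The approximation is the
mollification of the function truncated outside a larger interval. -/
theorem exists_smooth_approx {g : ℝ → ℝ} (hg : ContDiff ℝ 1 g) (hmono : Monotone g) (g0 : g 0 = 0)
    {R ε : ℝ} (hR : 0 ≤ R) (hε : 0 < ε) :
    ∃ (h : ℝ → ℝ) (L : ℝ≥0), ContDiff ℝ (⊤ : ℕ∞) h ∧ Monotone h ∧ LipschitzWith L h ∧ h 0 = 0 ∧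
      ∀ s, |s| ≤ R → |h s - g s| ≤ ε := by
  obtain ⟨L, hL⟩ := (hg.locallyLipschitz.locallyLipschitzOn
    (s := Icc (-R) R)).exists_lipschitzOnWith_of_compact isCompact_Icc
  -- truncation at `±R`, which makes `g ∘ c` Lipschitz on the whole line
  set c : ℝ → ℝ := fun s => max (-R) (min R s) with hc
  have hcL : LipschitzWith 1 c := (LipschitzWith.id.const_min R).const_max (-R)
  have hcm : Monotone c := fun s t hst => max_le_max le_rfl (min_le_min le_rfl hst)
  have hcI : ∀ s, c s ∈ Icc (-R) R := fun s =>
    ⟨le_max_left _ _, max_le (by linarith) (min_le_left _ _)⟩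
  have hcid : ∀ s, |s| ≤ R → c s = s := fun s hs => by
    rw [abs_le] at hs
    rw [hc]; simp only
    rw [min_eq_right hs.2, max_eq_right hs.1]
  set G : ℝ → ℝ := g ∘ c with hG
  have hGL : ∀ s t, |G s - G t| ≤ L * |s - t| := fun s t => by
    have h1 := hL.dist_le_mul _ (hcI s) _ (hcI t)
    have h2 := hcL.dist_le_mul s t
    rw [Real.dist_eq] at h1 h2
    rw [NNReal.coe_one, one_mul, Real.dist_eq] at h2
    exact h1.trans (mul_le_mul_of_nonneg_left h2 L.2)
  have hGLip : LipschitzWith L G := LipschitzWith.of_dist_le_mul fun s t => by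
    rw [Real.dist_eq, Real.dist_eq]; exact hGL s t
  have hGm : Monotone G := hmono.comp hcm
  set δ : ℝ := ε / (2 * (L + 1))
  have hL0 : (0 : ℝ) ≤ L := L.2
  have hδ : 0 < δ := by positivity
  let b : ContDiffBump (0 : ℝ) := ⟨δ / 2, δ, half_pos hδ, half_lt_self hδ⟩
  set ρ : ℝ → ℝ := b.normed volume with hρ
  have hρc : Continuous ρ := (b.contDiff_normed (n := 0)).continuous
  have hρs : HasCompactSupport ρ := b.hasCompactSupport_normed
  have hρ0 : ∀ z, 0 ≤ ρ z := fun z => b.nonneg_normed z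
  have hρ1 : ∫ z, ρ z = 1 := b.integral_normed
  have hρδ : ∀ z, ρ z ≠ 0 → |z| ≤ δ := fun z hz => by
    have h1 : z ∈ Function.support (b.normed volume) := hz
    rw [b.support_normed_eq, mem_ball_zero_iff] at h1
    exact h1.le
  have hmi : ∀ {u : ℝ → ℝ}, Continuous u → Integrable fun z => ρ z * u z := fun hu =>
    (hρc.mul hu).integrable_of_hasCompactSupport hρs.mul_right
  have hi : ∀ s, Integrable fun z => ρ z * G (s - z) := fun s =>
    hmi (hGLip.continuous.comp (continuous_const.sub continuous_id))
  have hρi : Integrable ρ := hρc.integrable_of_hasCompactSupport hρs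
  set P : ℝ → ℝ := fun s => ∫ z, ρ z * G (s - z) with hP
  have hPs : ContDiff ℝ (⊤ : ℕ∞) P :=
    hρs.contDiff_convolution_left (ContinuousLinearMap.lsmul ℝ ℝ) b.contDiff_normed
      hGLip.continuous.locallyIntegrable
  have hPm : Monotone P := fun s t hst => integral_mono (hi s) (hi t) fun z =>
    mul_le_mul_of_nonneg_left (hGm (by linarith)) (hρ0 z)
  -- averages of a function against `ρ` inherit its bounds
  have hav : ∀ (u v : ℝ → ℝ) (C : ℝ), Integrable (fun z => ρ z * u z) →
      Integrable (fun z => ρ z * v z) → (∀ z, ρ z ≠ 0 → |u z - v z| ≤ C) →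
      |(∫ z, ρ z * u z) - ∫ z, ρ z * v z| ≤ C := by
    intro u v C hu hv huv
    rw [← integral_sub hu hv]
    refine (abs_integral_le_integral_abs).trans ?_
    have h1 : ∫ z, ρ z * C = C := by rw [integral_mul_const, hρ1, one_mul]
    rw [← h1]
    refine integral_mono (hu.sub hv).abs (hρi.mul_const C) fun z => ?_
    simp only
    rcases eq_or_ne (ρ z) 0 with h0 | h0
    · simp [h0]
    · rw [← mul_sub, abs_mul, abs_of_nonneg (hρ0 z)]
      exact mul_le_mul_of_nonneg_left (huv z h0) (hρ0 z)
  have hPL : LipschitzWith L P := LipschitzWith.of_dist_le_mul fun s t => by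
    rw [Real.dist_eq, Real.dist_eq]
    refine hav _ _ _ (hi s) (hi t) fun z _ => ?_
    refine (hGL _ _).trans_eq ?_
    rw [sub_sub_sub_cancel_right]
  have hPG : ∀ s, |P s - G s| ≤ L * δ := fun s => by
    have h1 := hav (fun z => G (s - z)) (fun _ => G s) (L * δ) (hi s) (hρi.mul_const _)
      fun z hz => (hGL _ _).trans (mul_le_mul_of_nonneg_left (by
        rw [sub_sub_cancel_left, abs_neg]; exact hρδ z hz) hL0)
    rwa [integral_mul_const, hρ1, one_mul] at h1
  have hLδ : L * δ ≤ ε / 2 := by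
    rw [show ε / 2 = (L + 1) * δ by simp only [δ]; field_simp]
    nlinarith
  have hG0 : G 0 = 0 := by rw [hG, Function.comp_apply, hcid 0 (by simpa using hR), g0]
  refine ⟨fun s => P s - P 0, L, hPs.sub contDiff_const,
    fun s t hst => sub_le_sub_right (hPm hst) _,
    LipschitzWith.of_dist_le_mul fun s t => ?_, sub_self _, fun s hs => ?_⟩
  · rw [dist_sub_right]; exact hPL.dist_le_mul s t
  · have h1 := hPG s
    have h2 := hPG 0
    rw [hG0, sub_zero] at h2
    rw [hG, Function.comp_apply, hcid s hs] at h1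
    have h3 : P s - P 0 - g s = (P s - g s) - P 0 := by ring
    rw [h3]
    exact (abs_sub _ _).trans (by linarith)

/-- The primitive `G` of a nondecreasing function lies above its tangents. -/
theorem primitive_sub_le {g : ℝ → ℝ} (hg : Continuous g) (hmono : Monotone g) (s t : ℝ) :
    (∫ r in (0 : ℝ)..s, g r) - ∫ r in (0 : ℝ)..t, g r ≤ g s * (s - t) := by
  have hi : ∀ p q : ℝ, IntervalIntegrable g volume p q := fun p q => hg.intervalIntegrable p q
  rw [intervalIntegral.integral_interval_sub_left (hi _ _) (hi _ _)]
  rcases le_total t s with h | h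
  · refine (intervalIntegral.integral_mono_on h (hi _ _) (by simp : IntervalIntegrable
      (fun _ => g s) volume t s) fun r hr => hmono hr.2).trans_eq ?_
    rw [intervalIntegral.integral_const, smul_eq_mul, mul_comm]
  · rw [intervalIntegral.integral_symm]
    have h1 := intervalIntegral.integral_mono_on h (by simp : IntervalIntegrable
      (fun _ => g s) volume s t) (hi _ _) fun r hr => hmono hr.1
    rw [intervalIntegral.integral_const, smul_eq_mul] at h1
    linarith

theorem primitive_nonneg {g : ℝ → ℝ} (hg : Continuous g) (hmono : Monotone g) (g0 : g 0 = 0)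
    (s : ℝ) : 0 ≤ ∫ r in (0 : ℝ)..s, g r := by
  have h := primitive_sub_le hg hmono 0 s
  simp only [intervalIntegral.integral_same, g0, zero_mul] at h
  linarith

/-- On each interval of the uniform grid with mesh `h`, the step function takes its own value. -/
theorem eqOn_step {E : Type*} (F : ℕ → E) {h : ℝ} (hh : 0 < h) (i : ℕ) :
    EqOn (fun t => F ⌊t / h⌋₊) (fun _ => F i) (Ico (i * h) ((i + 1 : ℕ) * h)) := by
  intro t ht
  have : ⌊t / h⌋₊ = i := by
    rw [Nat.floor_eq_iff (div_nonneg ((by positivity : (0 : ℝ) ≤ i * h).trans ht.1) hh.le)]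
    constructor
    · rw [le_div_iff₀ hh]; exact ht.1
    · rw [div_lt_iff₀ hh]; exact_mod_cast ht.2
  simp only [this]

variable {E : Type*} [NormedAddCommGroup E]

theorem intervalIntegrable_step (F : ℕ → E) {h : ℝ} (hh : 0 < h) (i : ℕ) :
    IntervalIntegrable (fun t => F ⌊t / h⌋₊) volume (i * h) ((i + 1 : ℕ) * h) := by
  have hle : (i : ℝ) * h ≤ (i + 1 : ℕ) * h := by push_cast; nlinarith
  rw [intervalIntegrable_iff_integrableOn_Ico_of_le hle]
  exact IntegrableOn.congr_fun (integrableOn_const (by simp)) (eqOn_step F hh i).symm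
    measurableSet_Ico

theorem integral_step [NormedSpace ℝ E] [CompleteSpace E] (F : ℕ → E) {h : ℝ} (hh : 0 < h) (m : ℕ) :
    ∫ t in (0 : ℝ)..m * h, F ⌊t / h⌋₊ = h • ∑ i ∈ Finset.range m, F i := by
  have h1 := intervalIntegral.sum_integral_adjacent_intervals (a := fun i : ℕ => (i : ℝ) * h)
    (n := m) fun i _ => intervalIntegrable_step F hh i
  simp only [Nat.cast_zero, zero_mul] at h1
  rw [← h1, Finset.smul_sum]
  refine Finset.sum_congr rfl fun i _ => ?_
  have hle : (i : ℝ) * h ≤ (i + 1 : ℕ) * h := by push_cast; nlinarith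
  rw [intervalIntegral.integral_of_le hle, ← integral_Ico_eq_integral_Ioc,
    setIntegral_congr_fun measurableSet_Ico (eqOn_step F hh i), setIntegral_const, measureReal_def,
    Real.volume_Ico, ENNReal.toReal_ofReal (by linarith)]
  congr 1
  push_cast; ring

end

/-! ### The implicit Euler scheme -/

section

variable {V H : Type*} [NormedAddCommGroup V] [InnerProductSpace ℝ V]
  [NormedAddCommGroup H] [InnerProductSpace ℝ H]

/-- One step of the implicit Euler scheme is solvable when the step is small: `h (Λ + lam) ≤ 1`
makes the operator of the step strongly monotone with constant `h * lam`. -/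
theorem exists_euler_step [CompleteSpace V] [CompleteSpace H] (ι : V →L[ℝ] H) (A : V →L[ℝ] V)
    {N : H → H} {L Λ lam h : ℝ} (hL : 0 ≤ L) (hlam : 0 < lam)
    (hA : ∀ v, lam * (‖v‖ ^ 2 - ‖ι v‖ ^ 2) ≤ ⟪A v, v⟫_ℝ)
    (hNL : ∀ x y, ‖N x - N y‖ ≤ L * ‖x - y‖) (hNm : ∀ x y, 0 ≤ ⟪N x - N y, x - y⟫_ℝ)
    (hh : 0 < h) (hh1 : h * (Λ + lam) ≤ 1) (z u : H) :
    ∃ v : V, ∀ w, ⟪ι v - z, ι w⟫_ℝ + h * (⟪A v, w⟫_ℝ + ⟪N (ι v) - Λ • ι v, ι w⟫_ℝ) =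
      h * ⟪u, ι w⟫_ℝ := by
  set ιs := ContinuousLinearMap.adjoint ι
  have hadj : ∀ x w, ⟪ιs x, w⟫_ℝ = ⟪x, ι w⟫_ℝ := fun x w =>
    ContinuousLinearMap.adjoint_inner_left ι w x
  have hex : ∃ v, (1 - h * Λ) • ιs (ι v) + h • A v + h • ιs (N (ι v)) = ιs (z + h • u) := by
    refine exists_eq_of_stronglyMonotone
      (N := fun v => (1 - h * Λ) • ιs (ι v) + h • A v + h • ιs (N (ι v)))
      (L := |1 - h * Λ| * (‖ιs‖ * ‖ι‖) + h * ‖A‖ + h * (‖ιs‖ * (L * ‖ι‖))) (m := h * lam)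
      (by positivity) (fun x y => ?_) (fun x y => ?_) (ιs (z + h • u))
    · have e : (1 - h * Λ) • ιs (ι x) + h • A x + h • ιs (N (ι x)) -
          ((1 - h * Λ) • ιs (ι y) + h • A y + h • ιs (N (ι y))) =
          (1 - h * Λ) • ιs (ι (x - y)) + h • A (x - y) + h • ιs (N (ι x) - N (ι y)) := by
        simp only [map_sub]; module
      have e1 : ‖ιs (ι (x - y))‖ ≤ ‖ιs‖ * ‖ι‖ * ‖x - y‖ := by
        rw [mul_assoc]
        exact (ιs.le_opNorm _).trans (mul_le_mul_of_nonneg_left (ι.le_opNorm _) (norm_nonneg _))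
      have e2 := A.le_opNorm (x - y)
      have e3 : ‖ιs (N (ι x) - N (ι y))‖ ≤ ‖ιs‖ * (L * ‖ι‖) * ‖x - y‖ := by
        rw [mul_assoc, mul_assoc]
        refine (ιs.le_opNorm _).trans (mul_le_mul_of_nonneg_left ?_ (norm_nonneg _))
        refine (hNL _ _).trans (mul_le_mul_of_nonneg_left ?_ hL)
        rw [← map_sub]; exact ι.le_opNorm _
      rw [e]
      refine (norm_add₃_le).trans ?_
      rw [norm_smul, norm_smul, norm_smul, Real.norm_eq_abs, Real.norm_eq_abs, abs_of_pos hh]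
      have f1 := mul_le_mul_of_nonneg_left e1 (abs_nonneg (1 - h * Λ))
      have f2 := mul_le_mul_of_nonneg_left e2 hh.le
      have f3 := mul_le_mul_of_nonneg_left e3 hh.le
      linarith
    · have e : ⟪(1 - h * Λ) • ιs (ι x) + h • A x + h • ιs (N (ι x)) -
          ((1 - h * Λ) • ιs (ι y) + h • A y + h • ιs (N (ι y))), x - y⟫_ℝ =
          (1 - h * Λ) * ‖ι (x - y)‖ ^ 2 + h * ⟪A (x - y), x - y⟫_ℝ +
            h * ⟪N (ι x) - N (ι y), ι x - ι y⟫_ℝ := by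
        rw [← real_inner_self_eq_norm_sq]
        simp only [inner_add_left, inner_sub_left, real_inner_smul_left, hadj, map_sub]
        ring
      rw [e]
      have e1 := hA (x - y)
      have e2 := hNm (ι x) (ι y)
      have f1 := mul_le_mul_of_nonneg_left e1 hh.le
      have f2 := mul_nonneg hh.le e2
      have f3 := mul_nonneg (sub_nonneg.2 hh1) (sq_nonneg ‖ι (x - y)‖)
      linarith
  obtain ⟨v, hv⟩ := hex
  refine ⟨v, fun w => ?_⟩
  have h1 := congrArg (fun q => ⟪q, w⟫_ℝ) hv
  simp only [inner_add_left, real_inner_smul_left, hadj] at h1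
  simp only [inner_sub_left, real_inner_smul_left]
  linarith

/-- The implicit Euler scheme for `c' + A c + N(c) - Λ c = u`, `c(0) = z₀`, with step `h`:
`s i ∈ V` is the approximation on the `i`-th time interval, and `z (i + 1) ∈ H` is its image, with
`z 0` the initial value. -/
structure IsEuler (ι : V →L[ℝ] H) (A : V →L[ℝ] V) (N : H → H) (Λ h : ℝ) (u : ℕ → H) (z₀ : H)
    (s : ℕ → V) (z : ℕ → H) : Prop where
  zero : z 0 = z₀
  succ : ∀ i, z (i + 1) = ι (s i)
  eq : ∀ i w, ⟪z (i + 1) - z i, ι w⟫_ℝ +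
    h * (⟪A (s i), w⟫_ℝ + ⟪N (z (i + 1)) - Λ • z (i + 1), ι w⟫_ℝ) = h * ⟪u i, ι w⟫_ℝ

theorem exists_isEuler [CompleteSpace V] [CompleteSpace H] (ι : V →L[ℝ] H) (A : V →L[ℝ] V)
    {N : H → H} {L Λ lam h : ℝ} (hL : 0 ≤ L) (hlam : 0 < lam)
    (hA : ∀ v, lam * (‖v‖ ^ 2 - ‖ι v‖ ^ 2) ≤ ⟪A v, v⟫_ℝ)
    (hNL : ∀ x y, ‖N x - N y‖ ≤ L * ‖x - y‖) (hNm : ∀ x y, 0 ≤ ⟪N x - N y, x - y⟫_ℝ)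
    (hh : 0 < h) (hh1 : h * (Λ + lam) ≤ 1) (u : ℕ → H) (z₀ : H) :
    ∃ s z, IsEuler ι A N Λ h u z₀ s z := by
  choose S hS using exists_euler_step ι A hL hlam hA hNL hNm hh hh1
  let z : ℕ → H := fun i => Nat.rec z₀ (fun i zi => ι (S zi (u i))) i
  exact ⟨fun i => S (z i) (u i), z, rfl, fun i => rfl, fun i w => hS (z i) (u i) w⟩

namespace IsEuler

variable {ι : V →L[ℝ] H} {A : V →L[ℝ] V} {N : H → H} {Λ h : ℝ} {u : ℕ → H} {z₀ : H}
  {s : ℕ → V} {z : ℕ → H}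

/-- The discrete energy estimate, with a discrete Gronwall argument. -/
theorem energy_le (hE : IsEuler ι A N Λ h u z₀ s z) {lam : ℝ} (hlam : 0 < lam) (hΛ : 0 ≤ Λ)
    (hA : ∀ v, lam * (‖v‖ ^ 2 - ‖ι v‖ ^ 2) ≤ ⟪A v, v⟫_ℝ) (hN0 : ∀ x, 0 ≤ ⟪N x, x⟫_ℝ)
    (hh : 0 < h) (hh1 : h * (2 * Λ + 2 * lam + 1) ≤ 1 / 2) (m : ℕ) :
    ‖z m‖ ^ 2 + 2 * lam * (h * ∑ i ∈ Finset.range m, ‖s i‖ ^ 2) ≤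
      Real.exp (2 * (2 * Λ + 2 * lam + 1) * (m * h)) *
        (‖z₀‖ ^ 2 + h * ∑ i ∈ Finset.range m, ‖u i‖ ^ 2) := by
  set K := 2 * Λ + 2 * lam + 1 with hK
  have hstep : ∀ i, ‖z (i + 1)‖ ^ 2 + 2 * lam * (h * ‖s i‖ ^ 2) ≤
      ‖z i‖ ^ 2 + h * ‖u i‖ ^ 2 + h * K * ‖z (i + 1)‖ ^ 2 := by
    intro i
    have h1 := hE.eq i (s i)
    rw [← hE.succ, inner_sub_left, inner_sub_left, real_inner_smul_left,
      real_inner_self_eq_norm_sq] at h1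
    have h2 := hA (s i)
    rw [← hE.succ] at h2
    have h3 := hN0 (z (i + 1))
    have h4 := real_inner_le_norm (z i) (z (i + 1))
    have h5 := real_inner_le_norm (u i) (z (i + 1))
    have h6 := mul_le_mul_of_nonneg_left h2 hh.le
    have h7 := mul_nonneg hh.le h3
    have h8 := mul_le_mul_of_nonneg_left h5 hh.le
    have h9 := mul_nonneg hh.le (sq_nonneg (‖u i‖ - ‖z (i + 1)‖))
    rw [hK]
    nlinarith [sq_nonneg (‖z i‖ - ‖z (i + 1)‖)]
  -- the right-hand sides of the summed estimates; since `S m` bounds `‖z m‖ ^ 2`,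
  -- they satisfy a linear recursion
  let S : ℕ → ℝ := fun m => ‖z₀‖ ^ 2 +
    ∑ i ∈ Finset.range m, (h * ‖u i‖ ^ 2 + h * K * ‖z (i + 1)‖ ^ 2)
  have hS1 : ∀ m, ‖z m‖ ^ 2 + 2 * lam * (h * ∑ i ∈ Finset.range m, ‖s i‖ ^ 2) ≤ S m := by
    intro m
    induction m with
    | zero => simp [S, hE.zero]
    | succ m ih =>
      have h1 := hstep m
      simp only [S, Finset.sum_range_succ] at ih ⊢
      linarith
  have hKpos : 0 < K := by positivity
  have hS2 : ∀ m, S m ≤ Real.exp (2 * K * (m * h)) *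
      (‖z₀‖ ^ 2 + h * ∑ i ∈ Finset.range m, ‖u i‖ ^ 2) := by
    intro m
    induction m with
    | zero => simp [S]
    | succ m ih =>
      set B := ‖z₀‖ ^ 2 + h * ∑ i ∈ Finset.range m, ‖u i‖ ^ 2 with hB
      have h1 : S (m + 1) = S m + (h * ‖u m‖ ^ 2 + h * K * ‖z (m + 1)‖ ^ 2) := by
        simp only [S, Finset.sum_range_succ]; ring
      have h2 : ‖z (m + 1)‖ ^ 2 ≤ S (m + 1) := by
        refine le_trans ?_ (hS1 (m + 1))
        have : 0 ≤ 2 * lam * (h * ∑ i ∈ Finset.range (m + 1), ‖s i‖ ^ 2) := by positivity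
        linarith
      have h3 : 0 ≤ S m + h * ‖u m‖ ^ 2 := by
        have : 0 ≤ S m := by simp only [S]; positivity
        positivity
      have hhK : 0 ≤ h * K := by positivity
      have h4 : S (m + 1) ≤ (1 + 2 * (h * K)) * (S m + h * ‖u m‖ ^ 2) := by
        have h5 : S (m + 1) * (1 - h * K) ≤ S m + h * ‖u m‖ ^ 2 := by nlinarith
        have h6 : 1 ≤ (1 + 2 * (h * K)) * (1 - h * K) := by nlinarith
        have h7 : 0 ≤ S (m + 1) := (sq_nonneg _).trans h2
        nlinarith [mul_le_mul_of_nonneg_left h5 (by positivity : 0 ≤ 1 + 2 * (h * K))]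
      have h5 : 1 + 2 * (h * K) ≤ Real.exp (2 * (h * K)) := by
        linarith [Real.add_one_le_exp (2 * (h * K))]
      have h6 : S m + h * ‖u m‖ ^ 2 ≤ Real.exp (2 * K * (m * h)) * (B + h * ‖u m‖ ^ 2) := by
        have h7 : 1 ≤ Real.exp (2 * K * (m * h)) := Real.one_le_exp (by positivity)
        have h8 : 0 ≤ h * ‖u m‖ ^ 2 := by positivity
        nlinarith
      have h7 : Real.exp (2 * K * ((m + 1 : ℕ) * h)) =
          Real.exp (2 * (h * K)) * Real.exp (2 * K * (m * h)) := by
        rw [← Real.exp_add]; congr 1; push_cast; ring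
      rw [h7, Finset.sum_range_succ, mul_add h _ (‖u m‖ ^ 2), ← add_assoc,
        ← hB, mul_assoc]
      calc S (m + 1) ≤ (1 + 2 * (h * K)) * (S m + h * ‖u m‖ ^ 2) := h4
        _ ≤ Real.exp (2 * (h * K)) * (S m + h * ‖u m‖ ^ 2) := mul_le_mul_of_nonneg_right h5 h3
        _ ≤ _ := mul_le_mul_of_nonneg_left h6 (Real.exp_pos _).le
  exact (hS1 m).trans (hS2 m)

/-- Testing the scheme with the nonlinearity bounds it, the potential `Φ` absorbing the discrete
time derivative. -/
theorem nonlinearity_le (hE : IsEuler ι A N Λ h u z₀ s z)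
    (hcomp : ∀ v, ∃ w, ι w = N (ι v) ∧ 0 ≤ ⟪A v, w⟫_ℝ) {Φ : H → ℝ} (hΦ : ∀ x, 0 ≤ Φ x)
    (hΦN : ∀ x y, Φ x - Φ y ≤ ⟪N x, x - y⟫_ℝ) (hh : 0 < h) (m : ℕ) :
    h * ∑ i ∈ Finset.range m, ‖N (z (i + 1))‖ ^ 2 ≤
      2 * (Φ z₀ + h * ∑ i ∈ Finset.range m, (‖u i‖ ^ 2 + Λ ^ 2 * ‖z (i + 1)‖ ^ 2)) := by
  have hstep : ∀ i, Φ (z (i + 1)) + h * ‖N (z (i + 1))‖ ^ 2 / 2 ≤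
      Φ (z i) + h * (‖u i‖ ^ 2 + Λ ^ 2 * ‖z (i + 1)‖ ^ 2) := by
    intro i
    obtain ⟨w, hw1, hw2⟩ := hcomp (s i)
    rw [← hE.succ] at hw1
    have h1 := hE.eq i w
    rw [hw1, inner_sub_left (N _), real_inner_smul_left, real_inner_self_eq_norm_sq,
      real_inner_comm] at h1
    have h2 := hΦN (z (i + 1)) (z i)
    have h3 : ⟪u i, N (z (i + 1))⟫_ℝ + Λ * ⟪z (i + 1), N (z (i + 1))⟫_ℝ ≤
        ‖u i‖ ^ 2 + Λ ^ 2 * ‖z (i + 1)‖ ^ 2 + ‖N (z (i + 1))‖ ^ 2 / 2 := by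
      have h4 := real_inner_le_norm (u i) (N (z (i + 1)))
      have h5 := abs_real_inner_le_norm (z (i + 1)) (N (z (i + 1)))
      have h6 : Λ * ⟪z (i + 1), N (z (i + 1))⟫_ℝ ≤ |Λ| * (‖z (i + 1)‖ * ‖N (z (i + 1))‖) := by
        refine (le_abs_self _).trans ?_
        rw [abs_mul]
        exact mul_le_mul_of_nonneg_left h5 (abs_nonneg _)
      nlinarith [sq_nonneg (‖u i‖ - ‖N (z (i + 1))‖ / 2),
        sq_nonneg (|Λ| * ‖z (i + 1)‖ - ‖N (z (i + 1))‖ / 2), sq_abs Λ]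
    have h4 := mul_le_mul_of_nonneg_left h3 hh.le
    have h5 := mul_nonneg hh.le hw2
    linarith
  have hsum : Φ (z m) + (h * ∑ i ∈ Finset.range m, ‖N (z (i + 1))‖ ^ 2) / 2 ≤
      Φ z₀ + h * ∑ i ∈ Finset.range m, (‖u i‖ ^ 2 + Λ ^ 2 * ‖z (i + 1)‖ ^ 2) := by
    induction m with
    | zero => simp [hE.zero]
    | succ m ih =>
      have h1 := hstep m
      rw [Finset.sum_range_succ, Finset.sum_range_succ]
      linarith
  linarith [hΦ (z m)]

/-- The scheme summed over time, the discrete form of the integrated equation. -/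
theorem inner_eq_sum (hE : IsEuler ι A N Λ h u z₀ s z) (m : ℕ) (w : V) :
    ⟪z m, ι w⟫_ℝ = ⟪z₀, ι w⟫_ℝ + h * ∑ i ∈ Finset.range m, ⟪u i, ι w⟫_ℝ -
      h * ∑ i ∈ Finset.range m, (⟪A (s i), w⟫_ℝ + ⟪N (z (i + 1)) - Λ • z (i + 1), ι w⟫_ℝ) := by
  induction m with
  | zero => simp [hE.zero]
  | succ m ih =>
    have h1 := hE.eq m w
    rw [inner_sub_left] at h1
    rw [Finset.sum_range_succ, Finset.sum_range_succ]
    linarith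

end IsEuler

/-- Jensen's inequality for the average over an interval. -/
theorem norm_sq_average_le {U : ℝ → H} {a b : ℝ} (hab : a < b)
    (hU : MemLp U 2 (volume.restrict (Ioc a b))) :
    (b - a) * ‖(b - a)⁻¹ • ∫ t in a..b, U t‖ ^ 2 ≤ ∫ t in a..b, ‖U t‖ ^ 2 := by
  have hpos : 0 < b - a := sub_pos.2 hab
  have : IsFiniteMeasure (volume.restrict (Ioc a b)) := ⟨by simp⟩
  have h1 := sq_integral_mul_le (μ := volume.restrict (Ioc a b)) (ρ := fun _ => (b - a)⁻¹)
    (u := fun t => ‖U t‖) (fun _ => inv_nonneg.2 hpos.le)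
    (by simp [measureReal_def, ENNReal.toReal_ofReal hpos.le, hpos.ne']) (integrable_const _)
    ((hU.integrable one_le_two).norm.const_mul _)
    ((hU.integrable_norm_pow two_ne_zero).const_mul _)
  rw [integral_const_mul, integral_const_mul] at h1
  rw [intervalIntegral.integral_of_le hab.le, intervalIntegral.integral_of_le hab.le, norm_smul,
    Real.norm_eq_abs, abs_of_pos (inv_pos.2 hpos)]
  have h2 : ((b - a)⁻¹ * ‖∫ t in Ioc a b, U t‖) ^ 2 ≤ ((b - a)⁻¹ * ∫ t in Ioc a b, ‖U t‖) ^ 2 :=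
    pow_le_pow_left₀ (by positivity) (mul_le_mul_of_nonneg_left
      (norm_integral_le_integral_norm _) (inv_nonneg.2 hpos.le)) 2
  refine (mul_le_mul_of_nonneg_left (h2.trans h1) hpos.le).trans_eq ?_
  rw [← mul_assoc, mul_inv_cancel₀ hpos.ne', one_mul]

/-- Time-discrete approximate solutions of `c' + A c + N(c) - Λ c = U`, `c(0) = z₀`, with
estimates that do not depend on the step `T / M`. -/
theorem exists_euler_approx [CompleteSpace V] [CompleteSpace H] (ι : V →L[ℝ] H) (A : V →L[ℝ] V)
    {N : H → H} {L Λ lam T : ℝ} (hL : 0 ≤ L) (hlam : 0 < lam) (hΛ : 0 ≤ Λ)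
    (hA : ∀ v, lam * (‖v‖ ^ 2 - ‖ι v‖ ^ 2) ≤ ⟪A v, v⟫_ℝ)
    (hNL : ∀ x y, ‖N x - N y‖ ≤ L * ‖x - y‖) (hNm : ∀ x y, 0 ≤ ⟪N x - N y, x - y⟫_ℝ)
    (hN0 : N 0 = 0) (hcomp : ∀ v, ∃ w, ι w = N (ι v) ∧ 0 ≤ ⟪A v, w⟫_ℝ) {Φ : H → ℝ}
    (hΦ : ∀ x, 0 ≤ Φ x) (hΦN : ∀ x y, Φ x - Φ y ≤ ⟪N x, x - y⟫_ℝ) (hT : 0 < T)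
    {U : ℝ → H} (hU : MemLp U 2 (volT T)) (z₀ : H) {M : ℕ} (hM : 0 < M)
    (hM1 : T / M * (2 * Λ + 2 * lam + 1) ≤ 1 / 2) {D P : ℝ}
    (hD : D = Real.exp (2 * (2 * Λ + 2 * lam + 1) * T) * (‖z₀‖ ^ 2 + ∫ t, ‖U t‖ ^ 2 ∂volT T))
    (hP : Φ z₀ ≤ P) :
    ∃ s : ℕ → V, (∀ i < M, ‖ι (s i)‖ ^ 2 ≤ D) ∧
      2 * lam * (∫ t in (0 : ℝ)..T, ‖s ⌊t / (T / M)⌋₊‖ ^ 2) ≤ D ∧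
      (∫ t in (0 : ℝ)..T, ‖N (ι (s ⌊t / (T / M)⌋₊))‖ ^ 2) ≤
        2 * (P + (∫ t, ‖U t‖ ^ 2 ∂volT T) + T * (Λ ^ 2 * D)) ∧
      ∀ t ∈ Ioo 0 T, ∃ τ, t ≤ τ ∧ τ ≤ t + T / M ∧ τ ≤ T ∧ ∀ w,
        ⟪ι (s ⌊t / (T / M)⌋₊), ι w⟫_ℝ = ⟪z₀, ι w⟫_ℝ + (∫ r in (0 : ℝ)..τ, ⟪U r, ι w⟫_ℝ) -
          ∫ r in (0 : ℝ)..τ, (⟪A (s ⌊r / (T / M)⌋₊), w⟫_ℝ +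
            ⟪N (ι (s ⌊r / (T / M)⌋₊)) - Λ • ι (s ⌊r / (T / M)⌋₊), ι w⟫_ℝ) := by
  have hM0 : (0 : ℝ) < M := by exact_mod_cast hM
  set h := T / M with hh_def
  have hh : 0 < h := by positivity
  have hMh : M * h = T := by rw [hh_def]; field_simp
  have hle : ∀ i : ℕ, (i : ℝ) * h < (i + 1 : ℕ) * h := fun i => by push_cast; nlinarith
  have hmT : ∀ m : ℕ, m ≤ M → (m : ℝ) * h ≤ T := fun m hm => by
    rw [← hMh]; exact mul_le_mul_of_nonneg_right (by exact_mod_cast hm) hh.le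
  have hi0 : ∀ i : ℕ, 0 ≤ (i : ℝ) * h := fun i => by positivity
  -- the data of the scheme are the means of `U` over the time intervals
  set u : ℕ → H := fun i => h⁻¹ • ∫ t in (i * h)..((i + 1 : ℕ) * h), U t with hu
  have hUi : Integrable U (volT T) := hU.integrable one_le_two
  have hU2 : Integrable (fun t => ‖U t‖ ^ 2) (volT T) := hU.integrable_norm_pow two_ne_zero
  have hsumU : ∀ m ≤ M, h * ∑ i ∈ Finset.range m, ‖u i‖ ^ 2 ≤ ∫ t, ‖U t‖ ^ 2 ∂volT T := by
    intro m hm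
    have h1 : ∀ i ∈ Finset.range m,
        h * ‖u i‖ ^ 2 ≤ ∫ t in (i * h)..((i + 1 : ℕ) * h), ‖U t‖ ^ 2 := by
      intro i hi
      have hi' : i + 1 ≤ M := (Finset.mem_range.1 hi).trans_le hm
      have h2 := norm_sq_average_le (U := U) (hle i) (by
        rw [← Measure.restrict_congr_set Ioo_ae_eq_Ioc]
        exact hU.mono_measure (Measure.restrict_mono (Ioo_subset_Ioo (hi0 i) (hmT _ hi')) le_rfl))
      have h3 : ((i + 1 : ℕ) : ℝ) * h - i * h = h := by push_cast; ring
      rwa [h3] at h2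
    rw [Finset.mul_sum]
    refine (Finset.sum_le_sum h1).trans ?_
    have h4 := intervalIntegral.sum_integral_adjacent_intervals (f := fun t => ‖U t‖ ^ 2)
      (μ := volume) (a := fun i : ℕ => (i : ℝ) * h) (n := m) fun i hi =>
        intervalIntegrable_of_integrable_volT hU2 ⟨hi0 i, hmT _ (hi.le.trans hm)⟩
          ⟨hi0 _, hmT _ (Nat.succ_le_of_lt (hi.trans_le hm))⟩
    rw [h4, Nat.cast_zero, zero_mul, volT_integral_eq hT.le]
    exact intervalIntegral.integral_mono_interval le_rfl (hi0 m) (hmT m hm)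
      (Eventually.of_forall fun t => sq_nonneg _)
      (intervalIntegrable_of_integrable_volT hU2 ⟨le_rfl, hT.le⟩ ⟨hT.le, le_rfl⟩)
  obtain ⟨s, z, hE⟩ := exists_isEuler ι A (Λ := Λ) hL hlam hA hNL hNm hh (by nlinarith) u z₀
  have hNpos : ∀ x, 0 ≤ ⟪N x, x⟫_ℝ := fun x => by simpa [hN0] using hNm x 0
  have hU0 : 0 ≤ ∫ t, ‖U t‖ ^ 2 ∂volT T := integral_nonneg fun t => sq_nonneg _
  have hen : ∀ m ≤ M, ‖z m‖ ^ 2 + 2 * lam * (h * ∑ i ∈ Finset.range m, ‖s i‖ ^ 2) ≤ D := by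
    intro m hm
    refine (hE.energy_le hlam hΛ hA hNpos hh hM1 m).trans ?_
    rw [hD]
    refine mul_le_mul (Real.exp_le_exp.2 ?_) (by linarith [hsumU m hm]) (by positivity)
      (Real.exp_pos _).le
    exact mul_le_mul_of_nonneg_left (hmT m hm) (by positivity)
  have hzD : ∀ m ≤ M, ‖z m‖ ^ 2 ≤ D := fun m hm => by
    have : 0 ≤ 2 * lam * (h * ∑ i ∈ Finset.range m, ‖s i‖ ^ 2) := by positivity
    linarith [hen m hm]
  refine ⟨s, fun i hi => ?_, ?_, ?_, fun t ht => ?_⟩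
  · rw [← hE.succ]; exact hzD _ hi
  · have h1 := integral_step (fun i => ‖s i‖ ^ 2) hh M
    rw [hMh, smul_eq_mul] at h1
    rw [h1]
    linarith [hen M le_rfl, sq_nonneg ‖z M‖]
  · have h1 := integral_step (fun i => ‖N (ι (s i))‖ ^ 2) hh M
    rw [hMh, smul_eq_mul] at h1
    rw [h1]
    have h2 := hE.nonlinearity_le hcomp hΦ hΦN hh M
    simp only [hE.succ] at h2
    refine h2.trans ?_
    have h3 : h * ∑ i ∈ Finset.range M, Λ ^ 2 * ‖ι (s i)‖ ^ 2 ≤ T * (Λ ^ 2 * D) := by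
      have h4 : ∑ i ∈ Finset.range M, Λ ^ 2 * ‖ι (s i)‖ ^ 2 ≤ ∑ _i ∈ Finset.range M, Λ ^ 2 * D := by
        refine Finset.sum_le_sum fun i hi => mul_le_mul_of_nonneg_left ?_ (sq_nonneg _)
        rw [← hE.succ]; exact hzD _ (Finset.mem_range.1 hi)
      rw [Finset.sum_const, Finset.card_range, nsmul_eq_mul] at h4
      calc _ ≤ h * (M * (Λ ^ 2 * D)) := mul_le_mul_of_nonneg_left h4 hh.le
        _ = M * h * (Λ ^ 2 * D) := by ring
        _ = _ := by rw [hMh]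
    rw [Finset.sum_add_distrib, mul_add]
    linarith [hsumU M le_rfl]
  · set j := ⌊t / h⌋₊ with hj
    have hj1 : (j : ℝ) * h ≤ t := by
      rw [← le_div_iff₀ hh]; exact Nat.floor_le (div_nonneg ht.1.le hh.le)
    have hj2 : t < (j + 1 : ℕ) * h := by
      rw [← div_lt_iff₀ hh]; exact_mod_cast Nat.lt_floor_add_one (t / h)
    have hjM : j + 1 ≤ M := by
      have h1 : (j : ℝ) * h < M * h := by rw [hMh]; exact hj1.trans_lt ht.2
      exact_mod_cast lt_of_mul_lt_mul_right h1 hh.le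
    -- `τ` is the right end of the time interval that contains `t`
    refine ⟨(j + 1 : ℕ) * h, hj2.le, by push_cast; linarith, hmT _ hjM, fun w => ?_⟩
    have h1 := hE.inner_eq_sum (j + 1) w
    have h2 := integral_step (fun i => ⟪A (s i), w⟫_ℝ + ⟪N (ι (s i)) - Λ • ι (s i), ι w⟫_ℝ) hh
      (j + 1)
    have hint : ∀ i < j + 1, IntervalIntegrable U volume (i * h) ((i + 1 : ℕ) * h) := fun i hi =>
      intervalIntegrable_of_integrable_volT hUi ⟨hi0 i, hmT _ (hi.le.trans hjM)⟩
        ⟨hi0 _, hmT _ (Nat.succ_le_of_lt (hi.trans_le hjM))⟩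
    have h3 : ∫ r in (0 : ℝ)..(j + 1 : ℕ) * h, ⟪U r, ι w⟫_ℝ =
        h * ∑ i ∈ Finset.range (j + 1), ⟪u i, ι w⟫_ℝ := by
      have h4 := intervalIntegral.sum_integral_adjacent_intervals (f := fun r => ⟪U r, ι w⟫_ℝ)
        (μ := volume) (a := fun i : ℕ => (i : ℝ) * h) (n := j + 1) fun i hi =>
          ⟨(hint i hi).1.inner_const _, (hint i hi).2.inner_const _⟩
      rw [Nat.cast_zero, zero_mul] at h4
      rw [← h4, Finset.mul_sum]
      refine Finset.sum_congr rfl fun i hi => ?_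
      have h5 := (innerSL ℝ (ι w)).intervalIntegral_comp_comm (hint i (Finset.mem_range.1 hi))
      simp only [innerSL_apply_apply] at h5
      simp only [real_inner_comm (ι w)]
      rw [h5, hu, real_inner_smul_right, ← mul_assoc, mul_inv_cancel₀ hh.ne', one_mul]
    rw [h3, h2, smul_eq_mul]
    simp only [hE.succ] at h1
    exact h1

end

/-! ### Approximate solutions of the state equation -/

section

section Nemytskii

variable {α : Type*} [MeasurableSpace α] {μ : Measure α} {g : ℝ → ℝ} {L : ℝ≥0}

theorem inner_compLp_sub_nonneg (hL : LipschitzWith L g) (g0 : g 0 = 0) (hmono : Monotone g)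
    (x y : Lp ℝ 2 μ) : 0 ≤ ⟪hL.compLp g0 x - hL.compLp g0 y, x - y⟫_ℝ := by
  rw [L2.inner_def]
  refine integral_nonneg_of_ae ?_
  filter_upwards [Lp.coeFn_sub (hL.compLp g0 x) (hL.compLp g0 y), Lp.coeFn_sub x y,
    hL.coeFn_compLp g0 x, hL.coeFn_compLp g0 y] with a h1 h2 h3 h4
  rw [h1, h2, Pi.sub_apply, Pi.sub_apply, h3, h4, Function.comp_apply, Function.comp_apply,
    Pi.zero_apply, Real.inner_apply]
  rcases le_total (x a) (y a) with h | h
  · exact mul_nonneg_of_nonpos_of_nonpos (sub_nonpos.2 (hmono h)) (sub_nonpos.2 h)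
  · exact mul_nonneg (sub_nonneg.2 (hmono h)) (sub_nonneg.2 h)

theorem integrable_primitive_comp (hL : LipschitzWith L g) (g0 : g 0 = 0) (hmono : Monotone g)
    (x : Lp ℝ 2 μ) : Integrable (fun a => ∫ r in (0 : ℝ)..x a, g r) μ := by
  have hc : Continuous fun s => ∫ r in (0 : ℝ)..s, g r :=
    intervalIntegral.continuous_primitive (fun _ _ => hL.continuous.intervalIntegrable _ _) 0
  refine Integrable.mono' (((Lp.memLp x).integrable_norm_pow two_ne_zero).const_mul (L : ℝ))
    (hc.comp_aestronglyMeasurable (Lp.aestronglyMeasurable x)) (Eventually.of_forall fun a => ?_)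
  rw [Real.norm_eq_abs, abs_of_nonneg (primitive_nonneg hL.continuous hmono g0 _)]
  have h1 := primitive_sub_le hL.continuous hmono (x a) 0
  rw [intervalIntegral.integral_same, sub_zero, sub_zero] at h1
  have h2 := hL.dist_le_mul (x a) 0
  rw [g0, dist_zero_right, dist_zero_right] at h2
  refine h1.trans ((le_abs_self _).trans ?_)
  rw [abs_mul, ← Real.norm_eq_abs, ← Real.norm_eq_abs, pow_two, ← mul_assoc]
  exact mul_le_mul_of_nonneg_right h2 (norm_nonneg _)

/-- The potential `∫ G(x)` of the Nemytskii operator `g` is convex, with gradient `g`. -/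
theorem potential_sub_le (hL : LipschitzWith L g) (g0 : g 0 = 0) (hmono : Monotone g)
    (x y : Lp ℝ 2 μ) : (∫ a, (∫ r in (0 : ℝ)..x a, g r) ∂μ) - ∫ a, (∫ r in (0 : ℝ)..y a, g r) ∂μ ≤
      ⟪hL.compLp g0 x, x - y⟫_ℝ := by
  rw [← integral_sub (integrable_primitive_comp hL g0 hmono x)
    (integrable_primitive_comp hL g0 hmono y), L2.inner_def]
  refine integral_mono_ae ((integrable_primitive_comp hL g0 hmono x).sub
    (integrable_primitive_comp hL g0 hmono y)) (L2.integrable_inner _ _) ?_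
  filter_upwards [Lp.coeFn_sub x y, hL.coeFn_compLp g0 x] with a h1 h2
  rw [h1, h2, Pi.sub_apply, Function.comp_apply, Real.inner_apply]
  exact primitive_sub_le hL.continuous hmono _ _

end Nemytskii

variable {n : ℕ} {Ω : Set (Space n)} {T : ℝ}

theorem slice_compLp_sub_smul {g : ℝ → ℝ} {L : ℝ≥0} (hL : LipschitzWith L g) (g0 : g 0 = 0) (Λ : ℝ)
    (y : L2Q Ω T) : ∀ᵐ t ∂volT T, slice (hL.compLp g0 y - Λ • y) t =
      hL.compLp g0 (slice y t) - Λ • slice y t := by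
  filter_upwards [slice_coe y, slice_coe (hL.compLp g0 y - Λ • y),
    ae_ae_of_ae_volQ (Lp.coeFn_sub (hL.compLp g0 y) (Λ • y)),
    ae_ae_of_ae_volQ (Lp.coeFn_smul Λ y), ae_ae_of_ae_volQ (hL.coeFn_compLp g0 y)]
    with t h1 h2 h3 h4 h5
  refine Lp.ext ?_
  filter_upwards [h1, h2, h3, h4, h5, hL.coeFn_compLp g0 (slice y t),
    Lp.coeFn_smul Λ (slice y t), Lp.coeFn_sub (hL.compLp g0 (slice y t)) (Λ • slice y t)]
    with x k1 k2 k3 k4 k5 k6 k7 k8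
  rw [k2, k3, k8, Pi.sub_apply, Pi.sub_apply, k4, k5, k6, k7, Pi.smul_apply, Pi.smul_apply,
    Function.comp_apply, Function.comp_apply, k1]

theorem slice_compLp {g : ℝ → ℝ} {L : ℝ≥0} (hL : LipschitzWith L g) (g0 : g 0 = 0)
    (y : L2Q Ω T) : ∀ᵐ t ∂volT T, slice (hL.compLp g0 y) t = hL.compLp g0 (slice y t) := by
  have h := slice_compLp_sub_smul hL g0 0 y
  simpa only [zero_smul, sub_zero] using h

/-- `y ∈ L²(Q)`, with curve `Y`, is an approximate solution of `∂ₜy + A y + φ(y) = u`,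
`y(0) = z₀`: the equation holds in integrated form up to a shift of at most `h` in the upper limit
of integration. The constant `C` bounds the norms that are needed for compactness; `χ = φ(y)`. -/
structure IsApprox (A : H10 Ω →L[ℝ] H10 Ω) (φ : ℝ → ℝ) (z₀ : L2Ω Ω) (u : L2Q Ω T) (h C : ℝ)
    (Y : ℝ → H10 Ω) (y χ : L2Q Ω T) : Prop where
  memLp : MemLp Y 2 (volT T)
  slice_eq : ∀ᵐ t ∂volT T, slice y t = toL2 Ω (Y t)
  coe_eq : χ =ᵐ[volQ Ω T] fun z => φ (y z)
  norm_slice_le : ∀ᵐ t ∂volT T, ‖slice y t‖ ≤ C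
  integral_le : ∫ t, ‖Y t‖ ^ 2 ∂volT T ≤ C
  norm_le : ‖χ‖ ≤ C
  eq : ∀ᵐ t ∂volT T, ∃ τ, t ≤ τ ∧ τ ≤ t + h ∧ τ ≤ T ∧ ∀ w,
    ⟪slice y t, toL2 Ω w⟫_ℝ = ⟪z₀, toL2 Ω w⟫_ℝ + (∫ r in (0 : ℝ)..τ, ⟪slice u r, toL2 Ω w⟫_ℝ) -
      ((∫ r in (0 : ℝ)..τ, ⟪A (Y r), w⟫_ℝ) + ∫ r in (0 : ℝ)..τ, ⟪slice χ r, toL2 Ω w⟫_ℝ)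

variable {a : Fin n → Fin n → Space n → ℝ} {a₀ : Space n → ℝ}

/-- The constant and the admissible step sizes depend on the smooth nonlinearity `g` only through a
bound for the potential of the initial value, and on the control only through its norm. -/
theorem exists_isApprox (ha : ∀ i j, MemLp (a i j) ∞ (volΩ Ω)) (ha₀ : MemLp a₀ ∞ (volΩ Ω))
    {lam : ℝ} (hlam : 0 < lam)
    (hell : ∀ᵐ x ∂volΩ Ω, ∀ ξ : Space n, lam * ‖ξ‖ ^ 2 ≤ ∑ i, ∑ j, a i j x * ξ i * ξ j)
    (hnn : ∀ᵐ x ∂volΩ Ω, 0 ≤ a₀ x) {A : H10 Ω →L[ℝ] H10 Ω}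
    (hA : ∀ y v, formA Ω a a₀ y v = ⟪A y, v⟫_ℝ) (hT : 0 < T) {Λ : ℝ} (hΛ : 0 ≤ Λ) (z₀ : L2Ω Ω)
    (P B : ℝ) :
    ∃ (C : ℝ) (M₀ : ℕ), ∀ (g : ℝ → ℝ) (L : ℝ≥0), ContDiff ℝ (⊤ : ℕ∞) g → Monotone g →
      LipschitzWith L g → g 0 = 0 → ∫ x in Ω, (∫ r in (0 : ℝ)..z₀ x, g r) ≤ P →
      ∀ u : L2Q Ω T, ‖u‖ ≤ B → ∀ M : ℕ, M₀ ≤ M → ∃ Y y χ,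
        IsApprox A (fun s => g s - Λ * s) z₀ u (T / M) C Y y χ := by
  set K := 2 * Λ + 2 * lam + 1 with hK
  have hKpos : 0 < K := by positivity
  set D := Real.exp (2 * K * T) * (‖z₀‖ ^ 2 + B ^ 2) with hD
  have hD0 : 0 ≤ D := by positivity
  set D₂ := 2 * (P + B ^ 2 + T * (Λ ^ 2 * D)) with hD₂
  obtain ⟨M₀, hM₀⟩ := exists_nat_gt (max 1 (2 * T * K))
  refine ⟨max (√D) (max (D / (2 * lam)) (√D₂ + Λ * √(T * D))), M₀, ?_⟩
  intro g L hg hmono hL g0 hP u hu M hM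
  have hMR : max 1 (2 * T * K) < M := hM₀.trans_le (by exact_mod_cast hM)
  have hM0 : (0 : ℝ) < M := zero_lt_one.trans_le ((le_max_left _ _).trans hMR.le)
  have hM1 : T / M * K ≤ 1 / 2 := by
    rw [div_mul_eq_mul_div, div_le_iff₀ hM0]
    linarith [(le_max_right 1 (2 * T * K)).trans hMR.le]
  have hu2 : ∫ t, ‖slice u t‖ ^ 2 ∂volT T ≤ B ^ 2 := by
    rw [← norm_sq_eq_integral_slice]
    exact pow_le_pow_left₀ (norm_nonneg _) hu 2
  obtain ⟨s, hs1, hs2, hs3, hs4⟩ := exists_euler_approx (toL2 Ω) A (N := hL.compLp g0) (L := L)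
    (Λ := Λ) (lam := lam) (T := T) (P := P) (Φ := fun x => ∫ ξ in Ω, ∫ r in (0 : ℝ)..x ξ, g r)
    (U := slice u) (z₀ := z₀) (M := M) L.2 hlam hΛ
    (fun v => by
      rw [norm_sq_H10, add_sub_cancel_left, ← hA]
      exact formA_coercive ha ha₀ hell hnn v)
    (hL.norm_compLp_sub_le g0) (inner_compLp_sub_nonneg hL g0 hmono) (hL.compLp_zero g0)
    (fun v => by
      obtain ⟨w, hw1, hw2⟩ := exists_comp ha ha₀ hlam.le hell hnn hg g0 hmono hL v
      exact ⟨w, hw1, by rwa [← hA]⟩)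
    (fun x => integral_nonneg fun ξ => primitive_nonneg hL.continuous hmono g0 _)
    (potential_sub_le hL g0 hmono) hT (memLp_slice u) (by exact_mod_cast hM0) hM1 rfl hP
  rw [← hK] at hs1 hs2 hs3
  have hDle : Real.exp (2 * K * T) * (‖z₀‖ ^ 2 + ∫ t, ‖slice u t‖ ^ 2 ∂volT T) ≤ D :=
    mul_le_mul_of_nonneg_left (by linarith) (Real.exp_pos _).le
  set κ : ℝ → ℕ := fun t => ⌊t / (T / M)⌋₊ with hκ
  have hκm : Measurable κ := Nat.measurable_floor.comp (measurable_id.div_const _)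
  have hκM : ∀ t ∈ Ioo 0 T, κ t < M := by
    intro t ht
    have hh : 0 < T / M := by positivity
    rw [hκ, Nat.floor_lt (div_nonneg ht.1.le hh.le), div_lt_iff₀ hh, mul_div_cancel₀ _ hM0.ne']
    exact ht.2
  have hae : ∀ᵐ t ∂volT T, t ∈ Ioo 0 T := ae_restrict_mem measurableSet_Ioo
  have hbd : ∀ i < M, ‖toL2 Ω (s i)‖ ≤ √D := fun i hi =>
    Real.le_sqrt_of_sq_le ((hs1 i hi).trans hDle)
  obtain ⟨y, hy⟩ := exists_slice_eq (T := T) hκm (fun i => if i < M then toL2 Ω (s i) else 0)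
    (C := √D) fun i => by
      split_ifs with hi
      · exact hbd i hi
      · rw [norm_zero]; exact Real.sqrt_nonneg _
  have hy' : ∀ᵐ t ∂volT T, slice y t = toL2 Ω (s (κ t)) := by
    filter_upwards [hy, hae] with t h1 h2
    rw [h1, if_pos (hκM t h2)]
  have hYm : MemLp (fun t => s (κ t)) 2 (volT T) := by
    refine MemLp.of_bound (C := ∑ i ∈ Finset.range M, ‖s i‖) ?_ ?_
    · exact ((StronglyMeasurable.of_discrete (f := s)).comp_measurable hκm).aestronglyMeasurable
    · filter_upwards [hae] with t ht
      exact Finset.single_le_sum (f := fun i => ‖s i‖) (fun i _ => norm_nonneg _)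
        (Finset.mem_range.2 (hκM t ht))
  have hχs := slice_compLp_sub_smul hL g0 Λ y
  have hynorm : ‖y‖ ≤ √(T * D) := by
    refine Real.le_sqrt_of_sq_le ?_
    rw [norm_sq_eq_integral_slice]
    have h1 : ∫ t, ‖slice y t‖ ^ 2 ∂volT T ≤ ∫ _t, D ∂volT T := by
      refine integral_mono_ae ((memLp_slice y).integrable_norm_pow two_ne_zero)
        (integrable_const _) ?_
      filter_upwards [hy', hae] with t h1 h2
      rw [h1]; exact (hs1 _ (hκM t h2)).trans hDle
    refine h1.trans_eq ?_
    rw [integral_const, measureReal_restrict_apply_univ, Real.volume_real_Ioo_of_le hT.le,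
      sub_zero, smul_eq_mul]
  have hgnorm : ‖hL.compLp g0 y‖ ≤ √D₂ := by
    refine Real.le_sqrt_of_sq_le ?_
    rw [norm_sq_eq_integral_slice]
    have h1 : ∫ t, ‖slice (hL.compLp g0 y) t‖ ^ 2 ∂volT T =
        ∫ t, ‖hL.compLp g0 (toL2 Ω (s (κ t)))‖ ^ 2 ∂volT T := by
      refine integral_congr_ae ?_
      filter_upwards [hy', slice_compLp hL g0 y] with t h1 h2
      rw [h2, h1]
    rw [h1, volT_integral_eq hT.le]
    refine hs3.trans ?_
    have h2 := mul_le_mul_of_nonneg_left (mul_le_mul_of_nonneg_left hDle (sq_nonneg Λ)) hT.le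
    rw [hD₂]
    linarith
  refine ⟨fun t => s (κ t), y, hL.compLp g0 y - Λ • y, hYm, hy', ?_, ?_, ?_, ?_, ?_⟩
  · filter_upwards [Lp.coeFn_sub (hL.compLp g0 y) (Λ • y), Lp.coeFn_smul Λ y, hL.coeFn_compLp g0 y]
      with z h1 h2 h3
    rw [h1, Pi.sub_apply, h2, h3]
    rfl
  · filter_upwards [hy', hae] with t h1 h2
    rw [h1]
    exact (hbd _ (hκM t h2)).trans (le_max_left _ _)
  · rw [volT_integral_eq hT.le]
    refine le_trans ?_ ((le_max_left _ _).trans (le_max_right _ _))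
    rw [le_div_iff₀ (by positivity), mul_comm]
    exact hs2.trans hDle
  · refine le_trans ?_ ((le_max_right _ _).trans (le_max_right _ _))
    refine (norm_sub_le _ _).trans (add_le_add hgnorm ?_)
    rw [norm_smul, Real.norm_eq_abs, abs_of_nonneg hΛ]
    exact mul_le_mul_of_nonneg_left hynorm hΛ
  · filter_upwards [hy', hae] with t h1 h2
    obtain ⟨τ, hτ1, hτ2, hτ3, hτ⟩ := hs4 t h2
    refine ⟨τ, hτ1, hτ2, hτ3, fun w => ?_⟩
    have hτ0 : τ ∈ Icc 0 T := ⟨h2.1.le.trans hτ1, hτ3⟩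
    have h0T : (0 : ℝ) ∈ Icc 0 T := ⟨le_rfl, hT.le⟩
    have hi1 : Integrable (fun r => ⟪A (s (κ r)), w⟫_ℝ) (volT T) :=
      ((A.comp_memLp' hYm).integrable one_le_two).inner_const w
    have hi2 : Integrable (fun r => ⟪slice (hL.compLp g0 y - Λ • y) r, toL2 Ω w⟫_ℝ) (volT T) :=
      ((memLp_slice _).integrable one_le_two).inner_const _
    have h3 : (fun r => ⟪A (s (κ r)), w⟫_ℝ +
        ⟪hL.compLp g0 (toL2 Ω (s (κ r))) - Λ • toL2 Ω (s (κ r)), toL2 Ω w⟫_ℝ) =ᵐ[volT T]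
        fun r => ⟪A (s (κ r)), w⟫_ℝ + ⟪slice (hL.compLp g0 y - Λ • y) r, toL2 Ω w⟫_ℝ := by
      filter_upwards [hχs, hy'] with r k1 k2
      rw [k1, k2]
    rw [h1, hτ w, ← intervalIntegral.integral_add
      (intervalIntegrable_of_integrable_volT hi1 h0T hτ0)
      (intervalIntegrable_of_integrable_volT hi2 h0T hτ0)]
    congr 1
    rw [intervalIntegral.integral_of_le hτ0.1, intervalIntegral.integral_of_le hτ0.1]
    refine integral_congr_ae ?_
    rw [← Measure.restrict_congr_set Ioo_ae_eq_Ioc]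
    exact ae_mono (Measure.restrict_mono (Ioo_subset_Ioo le_rfl hτ3) le_rfl) h3

end

/-! ### Solutions in integrated form -/

section

/-- If a sequence converges both weakly in `L²` and almost everywhere, the two limits agree. The
limits are compared on the sets where the sequence is bounded, by dominated convergence. -/
theorem ae_eq_of_tendsto_inner {α : Type*} [MeasurableSpace α] {μ : Measure α} [IsFiniteMeasure μ]
    {χ : ℕ → Lp ℝ 2 μ} {ξ : Lp ℝ 2 μ} {ψ : α → ℝ}
    (hw : ∀ w, Tendsto (fun k => ⟪χ k, w⟫_ℝ) atTop (𝓝 ⟪ξ, w⟫_ℝ))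
    (hae : ∀ᵐ x ∂μ, Tendsto (fun k => χ k x) atTop (𝓝 (ψ x))) : ξ =ᵐ[μ] ψ := by
  let A : ℕ → Set α := fun M => {x | ∀ k, |χ k x| ≤ M}
  have hA : ∀ M, MeasurableSet (A M) := fun M => by
    have : A M = ⋂ k, {x | |χ k x| ≤ M} := by ext x; simp [A]
    rw [this]
    exact MeasurableSet.iInter fun k => measurableSet_le
      (Lp.stronglyMeasurable (χ k)).measurable.abs measurable_const
  have hψm : AEStronglyMeasurable ψ μ :=
    aestronglyMeasurable_of_tendsto_ae atTop (fun k => Lp.aestronglyMeasurable (χ k)) hae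
  have hset : ∀ {s : Set α}, MeasurableSet s →
      Tendsto (fun k => ∫ x in s, χ k x ∂μ) atTop (𝓝 (∫ x in s, ξ x ∂μ)) := by
    intro s hs
    have h1 := hw (indicatorConstLp 2 hs (measure_ne_top μ s) (1 : ℝ))
    simpa only [real_inner_comm (indicatorConstLp 2 hs (measure_ne_top μ s) (1 : ℝ)),
      L2.inner_indicatorConstLp_one] using h1
  have hbd : ∀ M : ℕ, ∀ᵐ x ∂μ.restrict (A M), |ψ x| ≤ M := fun M => by
    filter_upwards [ae_restrict_of_ae hae, ae_restrict_mem (hA M)] with x h1 h2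
    exact le_of_tendsto' h1.abs h2
  have heq : ∀ M : ℕ, ∀ᵐ x ∂μ, x ∈ A M → ξ x = ψ x := by
    intro M
    rw [← ae_restrict_iff' (hA M)]
    have hψi : Integrable ψ (μ.restrict (A M)) :=
      Integrable.of_bound hψm.restrict (M : ℝ) (hbd M)
    refine Integrable.ae_eq_of_forall_setIntegral_eq _ _
      (((Lp.memLp ξ).integrable one_le_two).restrict) hψi fun s hs _ => ?_
    rw [Measure.restrict_restrict hs]
    refine tendsto_nhds_unique (hset (hs.inter (hA M))) ?_
    refine tendsto_integral_of_dominated_convergence (fun _ => (M : ℝ))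
      (fun k => (Lp.aestronglyMeasurable (χ k)).restrict) (integrable_const _) (fun k => ?_)
      (ae_restrict_of_ae hae)
    filter_upwards [ae_restrict_mem (hs.inter (hA M))] with x hx
    exact hx.2 k
  filter_upwards [ae_all_iff.2 heq, hae] with x h1 h2
  obtain ⟨R, hR⟩ := h2.abs.bddAbove_range
  obtain ⟨M, hM⟩ := exists_nat_ge R
  exact h1 M fun k => (hR ⟨k, rfl⟩).trans hM

variable {n : ℕ} {Ω : Set (Space n)} {T : ℝ}

theorem toHm1_eq_toDual (g : L2Ω Ω) :
    toHm1 Ω g = InnerProductSpace.toDual ℝ (H10 Ω) (ContinuousLinearMap.adjoint (toL2 Ω) g) := by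
  ext v
  rw [InnerProductSpace.toDual_apply_apply, ContinuousLinearMap.adjoint_inner_left]
  rfl

theorem toHm1_apply (g : L2Ω Ω) (v : H10 Ω) : toHm1 Ω g v = ⟪g, toL2 Ω v⟫_ℝ := rfl

theorem inner_intervalIntegral {E : Type*} [NormedAddCommGroup E] [InnerProductSpace ℝ E]
    [CompleteSpace E] {F : ℝ → E} {s t : ℝ} (hF : IntervalIntegrable F volume s t) (w : E) :
    ⟪∫ r in s..t, F r, w⟫_ℝ = ∫ r in s..t, ⟪F r, w⟫_ℝ := by
  have h := (innerSL ℝ w).intervalIntegral_comp_comm hF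
  simp only [innerSL_apply_apply] at h
  simp only [real_inner_comm w]
  exact h.symm

theorem integrable_smul_of_hasCompactSupport {E : Type*} [NormedAddCommGroup E] [NormedSpace ℝ E]
    {φ : ℝ → ℝ} (hφ : Continuous φ) (hφs : HasCompactSupport φ) {F : ℝ → E}
    (hF : Integrable F (volT T)) : Integrable (fun t => φ t • F t) (volT T) := by
  obtain ⟨C, hC⟩ := hφs.exists_bound_of_continuous hφ
  exact hF.bdd_smul C hφ.aestronglyMeasurable (Eventually.of_forall hC)

theorem integral_slice_mul {F : L2Q Ω T} : ∀ᵐ t ∂volT T, ∀ v : H10 Ω,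
    ∫ x in Ω, F (x, t) * toL2 Ω v x = ⟪slice F t, toL2 Ω v⟫_ℝ := by
  filter_upwards [slice_coe F] with t h1 v
  rw [L2.inner_def]
  refine integral_congr_ae ?_
  filter_upwards [h1] with x h2
  rw [h2, Real.inner_apply]

variable {a : Fin n → Fin n → Space n → ℝ} {a₀ : Space n → ℝ} {f : ℝ → ℝ} {y₀ : Space n → ℝ}

/-- The representative in `H₀¹(Ω)` of the time derivative prescribed by the equation. -/
noncomputable def timeDeriv (A : H10 Ω →L[ℝ] H10 Ω) (u χ : L2Q Ω T) (Y : ℝ → H10 Ω)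
    (t : ℝ) : H10 Ω :=
  ContinuousLinearMap.adjoint (toL2 Ω) (slice u t - slice χ t) - A (Y t)

theorem inner_timeDeriv (A : H10 Ω →L[ℝ] H10 Ω) (u χ : L2Q Ω T) (Y : ℝ → H10 Ω) (t : ℝ)
    (v : H10 Ω) : ⟪timeDeriv A u χ Y t, v⟫_ℝ =
      ⟪slice u t, toL2 Ω v⟫_ℝ - ⟪slice χ t, toL2 Ω v⟫_ℝ - ⟪A (Y t), v⟫_ℝ := by
  rw [timeDeriv, inner_sub_left, ContinuousLinearMap.adjoint_inner_left, inner_sub_left]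

theorem memLp_timeDeriv (A : H10 Ω →L[ℝ] H10 Ω) (u χ : L2Q Ω T) {Y : ℝ → H10 Ω}
    (hY : MemLp Y 2 (volT T)) : MemLp (timeDeriv A u χ Y) 2 (volT T) :=
  ((ContinuousLinearMap.adjoint (toL2 Ω)).comp_memLp' ((memLp_slice u).sub (memLp_slice χ))).sub
    (A.comp_memLp' hY)

/-- A curve `Y ∈ L²(0,T; H₀¹(Ω))` that satisfies the equation in integrated form is a solution: the
integrand is the representative of its time derivative, and the curve has a continuous
representative with values in `L²(Ω)`. -/
theorem isSolution_of_integral_eq (hΩ : IsOpen Ω) (hT : 0 < T) {A : H10 Ω →L[ℝ] H10 Ω}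
    (hA : ∀ y v, formA Ω a a₀ y v = ⟪A y, v⟫_ℝ) {u y χ : L2Q Ω T} {z₀ : L2Ω Ω}
    (hz₀ : z₀ =ᵐ[volΩ Ω] y₀) {Y : ℝ → H10 Ω} (hY : MemLp Y 2 (volT T))
    (hyY : ∀ᵐ t ∂volT T, slice y t = toL2 Ω (Y t)) (hχ : χ =ᵐ[volQ Ω T] fun z => f (y z))
    (heq : ∀ᵐ t ∂volT T, ∀ w, ⟪toL2 Ω (Y t), toL2 Ω w⟫_ℝ = ⟪z₀, toL2 Ω w⟫_ℝ +
      ⟪∫ r in (0 : ℝ)..t, timeDeriv A u χ Y r, w⟫_ℝ) :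
    IsSolution Ω T a a₀ f y₀ u y := by
  have hZ := memLp_timeDeriv A u χ hY
  have hZi := hZ.integrable one_le_two
  set Z := timeDeriv A u χ Y with hZdef
  let D := InnerProductSpace.toDual ℝ (H10 Ω)
  have hDZ : MemLp (fun t => D (Z t)) 2 (volT T) :=
    D.isometry.lipschitz.comp_memLp (map_zero D) hZ
  have hDι : MemLp (fun t => toHm1 Ω (toL2 Ω (Y t))) 2 (volT T) := by
    simp only [toHm1_eq_toDual]
    exact D.isometry.lipschitz.comp_memLp (map_zero D)
      ((ContinuousLinearMap.adjoint (toL2 Ω)).comp_memLp' ((toL2 Ω).comp_memLp' hY))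
  refine ⟨(Lp.memLp χ).ae_eq hχ, Y, fun t => D (Z t), ⟨hY, hDZ, fun φ h1 h2 h3 => ?_⟩, ?_, ?_, ?_⟩
  · have i1 : Integrable (fun t => deriv φ t • toHm1 Ω (toL2 Ω (Y t))) (volT T) :=
      integrable_smul_of_hasCompactSupport (h1.continuous_deriv (by simp)) h2.deriv
        (hDι.integrable one_le_two)
    have i2 : Integrable (fun t => φ t • D (Z t)) (volT T) :=
      integrable_smul_of_hasCompactSupport h1.continuous h2 (hDZ.integrable one_le_two)
    refine ContinuousLinearMap.ext fun w => ?_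
    rw [ContinuousLinearMap.integral_apply i1, neg_apply,
      ContinuousLinearMap.integral_apply i2]
    simp only [smul_apply, toHm1_apply, smul_eq_mul, D,
      InnerProductSpace.toDual_apply_apply]
    rw [← integral_deriv_mul_primitive hT (hZi.inner_const w) ⟪z₀, toL2 Ω w⟫_ℝ h1 h3]
    refine integral_congr_ae ?_
    filter_upwards [heq, ae_restrict_mem measurableSet_Ioo] with t h4 h5
    rw [h4]
    have i3 := intervalIntegrable_of_integrable_volT hZi (s := 0) (t := t)
      ⟨le_rfl, hT.le⟩ ⟨h5.1.le, h5.2.le⟩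
    rw [inner_intervalIntegral i3]
  · filter_upwards [slice_coe y, hyY] with t h1 h2
    rw [← h2]
    exact h1.symm
  · filter_upwards [integral_slice_mul (F := u), integral_slice_mul (F := χ),
      ae_ae_of_ae_volQ hχ] with t h1 h2 h3 v
    have h4 : ∫ x in Ω, f (y (x, t)) * toL2 Ω v x = ∫ x in Ω, χ (x, t) * toL2 Ω v x := by
      refine integral_congr_ae ?_
      filter_upwards [h3] with x hx
      rw [hx]
    rw [h4, h1, h2, hA]
    simp only [D, InnerProductSpace.toDual_apply_apply, hZdef, inner_timeDeriv]
    ring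
  · obtain ⟨c, hc1, hc2, hc3⟩ := exists_continuous_representative (toL2 Ω) (denseRange_toL2 hΩ) hT
      hY hZ z₀ heq
    exact ⟨c, hc1, hc2, by rw [hc3]; exact hz₀⟩

end

/-! ### Weak convergence of time derivatives -/

section

section Weak

variable {E F : Type*} [NormedAddCommGroup E] [InnerProductSpace ℝ E] [CompleteSpace E]
  [NormedAddCommGroup F] [InnerProductSpace ℝ F] [CompleteSpace F]

theorem tendsto_inner_map (S : E →L[ℝ] F) {x : ℕ → E} {z : E}
    (hx : ∀ w, Tendsto (fun k => ⟪x k, w⟫_ℝ) atTop (𝓝 ⟪z, w⟫_ℝ)) (w : F) :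
    Tendsto (fun k => ⟪S (x k), w⟫_ℝ) atTop (𝓝 ⟪S z, w⟫_ℝ) := by
  simpa only [ContinuousLinearMap.adjoint_inner_right] using hx (ContinuousLinearMap.adjoint S w)

/-- A weak limit of time derivatives can be integrated up to convergent upper limits. -/
theorem tendsto_inner_primitive {T : ℝ} {Z : ℕ → Lp E 2 (volT T)} {Z' : Lp E 2 (volT T)} {C : ℝ}
    (hC : ∀ k, ‖Z k‖ ≤ C) (hZ : ∀ w, Tendsto (fun k => ⟪Z k, w⟫_ℝ) atTop (𝓝 ⟪Z', w⟫_ℝ))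
    {τ : ℕ → ℝ} {t : ℝ} (ht : 0 ≤ t) (hτ : ∀ k, t ≤ τ k) (hτT : ∀ k, τ k ≤ T)
    (hlim : Tendsto τ atTop (𝓝 t)) (w : E) :
    Tendsto (fun k => ⟪∫ r in (0 : ℝ)..τ k, Z k r, w⟫_ℝ) atTop
      (𝓝 ⟪∫ r in (0 : ℝ)..t, Z' r, w⟫_ℝ) := by
  have hμ : ∀ s : Set ℝ, volT T s ≠ ∞ := fun s => measure_ne_top _ s
  have hint : ∀ (W : Lp E 2 (volT T)) (σ : ℝ), 0 ≤ σ → σ ≤ T →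
      ⟪W, indicatorConstLp 2 measurableSet_Iio (hμ (Iio σ)) w⟫_ℝ =
        ⟪∫ r in (0 : ℝ)..σ, W r, w⟫_ℝ := by
    intro W σ h0 h1
    rw [real_inner_comm, L2.inner_indicatorConstLp_eq_inner_setIntegral, real_inner_comm,
      Measure.restrict_restrict measurableSet_Iio, intervalIntegral.integral_of_le h0,
      integral_Ioc_eq_integral_Ioo]
    have : Iio σ ∩ Ioo 0 T = Ioo 0 σ := by
      ext r
      simp only [mem_inter_iff, mem_Iio, mem_Ioo]
      exact ⟨fun h => ⟨h.2.1, h.1⟩, fun h => ⟨h.2, h.1, h.2.trans_le h1⟩⟩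
    rw [this]
  have hind : Tendsto (fun k => indicatorConstLp 2 measurableSet_Iio (hμ (Iio (τ k))) w) atTop
      (𝓝 (indicatorConstLp 2 measurableSet_Iio (hμ (Iio t)) w)) := by
    refine tendsto_indicatorConstLp_set ENNReal.ofNat_ne_top ?_
    have h1 : Tendsto (fun k => ENNReal.ofReal (τ k - t)) atTop (𝓝 0) := by
      have h2 := (ENNReal.continuous_ofReal.tendsto _).comp (hlim.sub_const t)
      rwa [sub_self, ENNReal.ofReal_zero] at h2
    refine tendsto_of_tendsto_of_tendsto_of_le_of_le tendsto_const_nhds h1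
      (fun k => zero_le) fun k => ?_
    have h3 : symmDiff (Iio (τ k)) (Iio t) ⊆ Ico t (τ k) := by
      rintro r (⟨h4, h5⟩ | ⟨h4, h5⟩)
      · exact ⟨not_lt.1 h5, h4⟩
      · exact absurd (lt_of_lt_of_le h4 (hτ k)) h5
    refine (measure_mono h3).trans ((Measure.restrict_apply_le _ _).trans ?_)
    rw [Real.volume_Ico]
  have h := tendsto_inner_of_tendsto hC hZ hind
  rw [hint Z' t ht ((hτ 0).trans (hτT 0))] at h
  refine h.congr fun k => hint _ _ (ht.trans (hτ k)) (hτT k)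

end Weak

variable {n : ℕ} {Ω : Set (Space n)} {T : ℝ}

theorem slice_add (y w : L2Q Ω T) : ∀ᵐ t ∂volT T, slice (y + w) t = slice y t + slice w t := by
  filter_upwards [slice_sub (y + w) w] with t h1
  rw [add_sub_cancel_right] at h1
  rw [h1, sub_add_cancel]

theorem slice_smul (c : ℝ) (y : L2Q Ω T) : ∀ᵐ t ∂volT T, slice (c • y) t = c • slice y t := by
  filter_upwards [slice_coe y, slice_coe (c • y), ae_ae_of_ae_volQ (Lp.coeFn_smul c y)]
    with t h1 h2 h3
  refine Lp.ext ?_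
  filter_upwards [h1, h2, h3, Lp.coeFn_smul c (slice y t)] with x k1 k2 k3 k4
  rw [k2, k3, k4, Pi.smul_apply, Pi.smul_apply, k1]

/-- The embedding of `L²(Q)` into `L²(0,T; L²(Ω))` that maps a function to its time slices. -/
noncomputable def sliceL (Ω : Set (Space n)) (T : ℝ) : L2Q Ω T →L[ℝ] Lp (L2Ω Ω) 2 (volT T) :=
  LinearMap.mkContinuous
    { toFun := fun y => (memLp_slice y).toLp
      map_add' := fun y w => by
        refine Lp.ext ?_
        filter_upwards [slice_add y w, (memLp_slice (y + w)).coeFn_toLp,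
          (memLp_slice y).coeFn_toLp, (memLp_slice w).coeFn_toLp,
          Lp.coeFn_add (memLp_slice y).toLp (memLp_slice w).toLp] with t h1 h2 h3 h4 h5
        rw [h2, h5, Pi.add_apply, h3, h4, h1]
      map_smul' := fun c y => by
        refine Lp.ext ?_
        filter_upwards [slice_smul c y, (memLp_slice (c • y)).coeFn_toLp,
          (memLp_slice y).coeFn_toLp, Lp.coeFn_smul c (memLp_slice y).toLp] with t h1 h2 h3 h4
        rw [h2, RingHom.id_apply, h4, Pi.smul_apply, h3, h1] }
    1 fun y => by
      refine le_of_sq_le_sq ?_ (by positivity)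
      rw [one_mul, norm_sq_eq_integral_slice, norm_sq_eq_integral]
      refine (integral_congr_ae ?_).le
      filter_upwards [(memLp_slice y).coeFn_toLp] with t ht
      simp only [LinearMap.coe_mk, AddHom.coe_mk, ht]

theorem sliceL_coe (y : L2Q Ω T) : sliceL Ω T y =ᵐ[volT T] slice y := (memLp_slice y).coeFn_toLp

/-- `timeDeriv` as a combination of continuous linear maps of `u`, `χ` and `Y`, which makes it
weakly continuous in these arguments. -/
theorem timeDeriv_ae_eq (A : H10 Ω →L[ℝ] H10 Ω) (u χ : L2Q Ω T) (Y : Lp (H10 Ω) 2 (volT T)) :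
    ((ContinuousLinearMap.adjoint (toL2 Ω)).compLpL 2 (volT T) (sliceL Ω T u - sliceL Ω T χ) -
      A.compLpL 2 (volT T) Y : Lp (H10 Ω) 2 (volT T)) =ᵐ[volT T] timeDeriv A u χ Y := by
  filter_upwards [Lp.coeFn_sub ((ContinuousLinearMap.adjoint (toL2 Ω)).compLpL 2 (volT T)
      (sliceL Ω T u - sliceL Ω T χ)) (A.compLpL 2 (volT T) Y),
    (ContinuousLinearMap.adjoint (toL2 Ω)).coeFn_compLpL (sliceL Ω T u - sliceL Ω T χ),
    A.coeFn_compLpL Y, Lp.coeFn_sub (sliceL Ω T u) (sliceL Ω T χ), sliceL_coe u, sliceL_coe χ]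
    with t h1 h2 h3 h4 h5 h6
  rw [h1, Pi.sub_apply, h2, h3, h4, Pi.sub_apply, h5, h6, timeDeriv]

/-- The defining relation of an approximate solution in terms of its time derivative. -/
theorem IsApprox.inner_eq {A : H10 Ω →L[ℝ] H10 Ω} {φ : ℝ → ℝ} {z₀ : L2Ω Ω} {u : L2Q Ω T} {h C : ℝ}
    {Y : ℝ → H10 Ω} {y χ : L2Q Ω T} (hap : IsApprox A φ z₀ u h C Y y χ) :
    ∀ᵐ t ∂volT T, ∃ τ, t ≤ τ ∧ τ ≤ t + h ∧ τ ≤ T ∧ ∀ w,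
      ⟪slice y t, toL2 Ω w⟫_ℝ = ⟪z₀, toL2 Ω w⟫_ℝ +
        ⟪∫ r in (0 : ℝ)..τ, timeDeriv A u χ Y r, w⟫_ℝ := by
  filter_upwards [hap.eq, ae_restrict_mem measurableSet_Ioo] with t ⟨τ, h1, h2, h3, h4⟩ ht
  refine ⟨τ, h1, h2, h3, fun w => ?_⟩
  have h0T : (0 : ℝ) ∈ Icc 0 T := ⟨le_rfl, (ht.1.trans ht.2).le⟩
  have hτ : τ ∈ Icc 0 T := ⟨ht.1.le.trans h1, h3⟩
  have i0 : ∀ {F : ℝ → ℝ}, Integrable F (volT T) → IntervalIntegrable F volume 0 τ := fun hF =>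
    intervalIntegrable_of_integrable_volT hF h0T hτ
  have i1 : IntervalIntegrable (fun r => ⟪slice u r, toL2 Ω w⟫_ℝ) volume 0 τ :=
    i0 (((memLp_slice u).integrable one_le_two).inner_const _)
  have i2 : IntervalIntegrable (fun r => ⟪slice χ r, toL2 Ω w⟫_ℝ) volume 0 τ :=
    i0 (((memLp_slice χ).integrable one_le_two).inner_const _)
  have i3 : IntervalIntegrable (fun r => ⟪A (Y r), w⟫_ℝ) volume 0 τ :=
    i0 (((A.comp_memLp' hap.memLp).integrable one_le_two).inner_const w)
  rw [h4, inner_intervalIntegral (intervalIntegrable_of_integrable_volT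
    ((memLp_timeDeriv A u χ hap.memLp).integrable one_le_two) h0T hτ)]
  simp only [inner_timeDeriv]
  rw [intervalIntegral.integral_sub (i1.sub i2) i3, intervalIntegral.integral_sub i1 i2]
  ring

end

/-! ### Compactness and passage to the limit -/

section

variable {n : ℕ} {Ω : Set (Space n)} {T : ℝ}

theorem isFiniteMeasure_volQ (hb : Bornology.IsBounded Ω) : IsFiniteMeasure (volQ Ω T) := by
  refine ⟨?_⟩
  rw [Measure.restrict_apply_univ]
  exact (hb.prod (Metric.isBounded_Ioo 0 T)).measure_lt_top

/-- Compactness in the manner of Aubin and Lions: bounds in `L²(0,T; H₀¹(Ω))` and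
`L^∞(0,T; L²(Ω))`, together with weak convergence in `L²(Ω)` at almost every time, give strong
convergence in `L²(Q)`. By Friedrichs' inequality, only finitely many functionals of the differences
of the sequence need to be controlled. -/
theorem cauchySeq_of_tendsto_inner_slice (hΩ : IsOpen Ω) (hb : Bornology.IsBounded Ω)
    {Y : ℕ → ℝ → H10 Ω} {y : ℕ → L2Q Ω T} {C : ℝ} (hY : ∀ k, MemLp (Y k) 2 (volT T))
    (hyY : ∀ k, ∀ᵐ t ∂volT T, slice (y k) t = toL2 Ω (Y k t))
    (hC : ∀ k, ∀ᵐ t ∂volT T, ‖slice (y k) t‖ ≤ C) (hYC : ∀ k, ∫ t, ‖Y k t‖ ^ 2 ∂volT T ≤ C)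
    (hlim : ∀ᵐ t ∂volT T, ∀ g, ∃ l, Tendsto (fun k => ⟪slice (y k) t, g⟫_ℝ) atTop (𝓝 l)) :
    CauchySeq y := by
  have hC0 : 0 ≤ C := (integral_nonneg fun t => sq_nonneg _).trans (hYC 0)
  rw [cauchySeq_iff_tendsto_dist_atTop_0, Metric.tendsto_nhds]
  intro ε hε
  set η := ε ^ 2 / (8 * C + 8) with hη_def
  have hη : 0 < η := by positivity
  obtain ⟨K, s, hK, hF⟩ := friedrichs hΩ hb hη
  have hm : ∀ p : ℕ × ℕ, ∀ g : L2Ω Ω, AEStronglyMeasurable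
      (fun t => ⟪g, slice (y p.1) t - slice (y p.2) t⟫_ℝ ^ 2) (volT T) := fun p g =>
    ((aestronglyMeasurable_const (b := g)).inner ((aestronglyMeasurable_slice (y p.1)).sub
      (aestronglyMeasurable_slice (y p.2)))).pow 2
  have hbd : ∀ p : ℕ × ℕ, ∀ g : L2Ω Ω, ∀ᵐ t ∂volT T,
      ‖⟪g, slice (y p.1) t - slice (y p.2) t⟫_ℝ ^ 2‖ ≤ (‖g‖ * (2 * C)) ^ 2 := fun p g => by
    filter_upwards [hC p.1, hC p.2] with t h1 h2
    rw [norm_pow]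
    refine pow_le_pow_left₀ (norm_nonneg _) ((norm_inner_le_norm _ _).trans ?_) 2
    refine mul_le_mul_of_nonneg_left ((norm_sub_le _ _).trans (by linarith)) (norm_nonneg _)
  have hi : ∀ p : ℕ × ℕ, ∀ g : L2Ω Ω, Integrable
      (fun t => ⟪g, slice (y p.1) t - slice (y p.2) t⟫_ℝ ^ 2) (volT T) := fun p g =>
    Integrable.of_bound (hm p g) _ (hbd p g)
  have htend : Tendsto (fun p : ℕ × ℕ => K * ∑ g ∈ s,
      ∫ t, ⟪g, slice (y p.1) t - slice (y p.2) t⟫_ℝ ^ 2 ∂volT T) atTop (𝓝 0) := by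
    have h1 : ∀ g ∈ s, Tendsto (fun p : ℕ × ℕ =>
        ∫ t, ⟪g, slice (y p.1) t - slice (y p.2) t⟫_ℝ ^ 2 ∂volT T) atTop (𝓝 0) := by
      intro g _
      have h2 := tendsto_integral_filter_of_dominated_convergence (μ := volT T)
        (l := (atTop : Filter (ℕ × ℕ)))
        (F := fun p t => ⟪g, slice (y p.1) t - slice (y p.2) t⟫_ℝ ^ 2) (f := fun _ => 0)
        (fun _ => (‖g‖ * (2 * C)) ^ 2) (Eventually.of_forall fun p => hm p g)
        (Eventually.of_forall fun p => hbd p g) (integrable_const _) (by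
          filter_upwards [hlim] with t ht
          obtain ⟨l, hl⟩ := ht g
          have h3 : Tendsto (fun p : ℕ × ℕ => (⟪slice (y p.1) t, g⟫_ℝ - ⟪slice (y p.2) t, g⟫_ℝ) ^ 2)
              atTop (𝓝 ((l - l) ^ 2)) := by
            rw [← prod_atTop_atTop_eq]
            exact ((hl.comp tendsto_fst).sub (hl.comp tendsto_snd)).pow 2
          rw [sub_self, zero_pow two_ne_zero] at h3
          refine h3.congr fun p => ?_
          rw [← inner_sub_left, real_inner_comm])
      simpa using h2
    have h4 := (tendsto_finsetSum s h1).const_mul K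
    simpa using h4
  filter_upwards [(tendsto_order.1 htend).2 (ε ^ 2 / 2) (by positivity)] with p hp
  rw [Real.dist_eq, sub_zero, abs_of_nonneg dist_nonneg, dist_eq_norm]
  refine lt_of_pow_lt_pow_left₀ 2 hε.le ?_
  rw [norm_sub_sq_eq_integral_slice]
  have hY2 : ∀ k, Integrable (fun t => ‖Y k t‖ ^ 2) (volT T) := fun k =>
    (hY k).integrable_norm_pow two_ne_zero
  have hpt : ∀ᵐ t ∂volT T, ‖slice (y p.1) t - slice (y p.2) t‖ ^ 2 ≤
      η * (2 * ‖Y p.1 t‖ ^ 2 + 2 * ‖Y p.2 t‖ ^ 2) +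
        K * ∑ g ∈ s, ⟪g, slice (y p.1) t - slice (y p.2) t⟫_ℝ ^ 2 := by
    filter_upwards [hyY p.1, hyY p.2] with t h1 h2
    have h3 := hF (Y p.1 t - Y p.2 t)
    rw [map_sub, ← h1, ← h2] at h3
    refine h3.trans (add_le_add_left (mul_le_mul_of_nonneg_left ?_ hη.le) _)
    have h4 := pow_le_pow_left₀ (norm_nonneg _) (norm_sub_le (Y p.1 t) (Y p.2 t)) 2
    nlinarith [sq_nonneg (‖Y p.1 t‖ - ‖Y p.2 t‖)]
  have iA : Integrable (fun t => η * (2 * ‖Y p.1 t‖ ^ 2 + 2 * ‖Y p.2 t‖ ^ 2)) (volT T) :=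
    (((hY2 p.1).const_mul 2).add ((hY2 p.2).const_mul 2)).const_mul η
  have iB : Integrable (fun t => K * ∑ g ∈ s, ⟪g, slice (y p.1) t - slice (y p.2) t⟫_ℝ ^ 2)
      (volT T) := (integrable_finsetSum s fun g _ => hi p g).const_mul K
  have h1 := integral_mono_ae
    (((memLp_slice (y p.1)).sub (memLp_slice (y p.2))).integrable_norm_pow two_ne_zero)
    (iA.add iB) hpt
  have h2 : ∫ t, (η * (2 * ‖Y p.1 t‖ ^ 2 + 2 * ‖Y p.2 t‖ ^ 2) +
      K * ∑ g ∈ s, ⟪g, slice (y p.1) t - slice (y p.2) t⟫_ℝ ^ 2) ∂volT T =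
      η * (2 * (∫ t, ‖Y p.1 t‖ ^ 2 ∂volT T) + 2 * ∫ t, ‖Y p.2 t‖ ^ 2 ∂volT T) +
        K * ∑ g ∈ s, ∫ t, ⟪g, slice (y p.1) t - slice (y p.2) t⟫_ℝ ^ 2 ∂volT T := by
    rw [integral_add iA iB, integral_const_mul, integral_const_mul,
      integral_finsetSum s fun g _ => hi p g,
      integral_add ((hY2 p.1).const_mul 2) ((hY2 p.2).const_mul 2), integral_const_mul,
      integral_const_mul]
  have h3 : η * (2 * (∫ t, ‖Y p.1 t‖ ^ 2 ∂volT T) + 2 * ∫ t, ‖Y p.2 t‖ ^ 2 ∂volT T) ≤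
      ε ^ 2 / 2 := by
    have h4 : η * (4 * C) ≤ ε ^ 2 / 2 := by
      rw [hη_def, div_mul_eq_mul_div, div_le_div_iff₀ (by positivity) (by norm_num)]
      nlinarith [sq_nonneg ε]
    refine le_trans (mul_le_mul_of_nonneg_left ?_ hη.le) h4
    linarith [hYC p.1, hYC p.2]
  calc _ ≤ _ := h1
    _ = _ := h2
    _ < ε ^ 2 := by linarith

variable {a : Fin n → Fin n → Space n → ℝ} {a₀ : Space n → ℝ} {f : ℝ → ℝ} {y₀ : Space n → ℝ}

/-- Nonlinearities that converge uniformly on bounded sets may be evaluated along convergent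
sequences. -/
theorem tendsto_eval_of_uniform (hf : Continuous f) {φ : ℕ → ℝ → ℝ}
    (hφ : ∀ (k : ℕ) (s : ℝ), |s| ≤ k → |φ k s - f s| ≤ 1 / (k + 1)) {κ : ℕ → ℕ} (hκ : StrictMono κ)
    {s : ℕ → ℝ} {x : ℝ} (hs : Tendsto s atTop (𝓝 x)) :
    Tendsto (fun k => φ (κ k) (s k)) atTop (𝓝 (f x)) := by
  have h1 : Tendsto (fun k => φ (κ k) (s k) - f (s k)) atTop (𝓝 0) := by
    obtain ⟨R, hR⟩ := hs.abs.bddAbove_range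
    have h2 : ∀ᶠ k in atTop, ‖φ (κ k) (s k) - f (s k)‖ ≤ 1 / ((k : ℝ) + 1) := by
      filter_upwards [eventually_ge_atTop ⌈R⌉₊] with k hk
      have h3 : (k : ℝ) ≤ κ k := by exact_mod_cast hκ.id_le k
      have h4 : R ≤ k := (Nat.le_ceil R).trans (by exact_mod_cast hk)
      refine (hφ _ _ ((hR ⟨k, rfl⟩).trans (h4.trans h3))).trans ?_
      exact one_div_le_one_div_of_le (by positivity) (by linarith)
    exact squeeze_zero_norm' h2 tendsto_one_div_add_atTop_nhds_zero_nat
  have h5 := h1.add ((hf.tendsto x).comp hs)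
  rw [zero_add] at h5
  refine h5.congr fun k => ?_
  simp

/-- Approximate solutions with weakly convergent controls converge strongly in `L²(Q)`, along a
subsequence, to a solution for the limit control. -/
theorem exists_subseq_tendsto_isSolution (hΩ : IsOpen Ω) (hb : Bornology.IsBounded Ω) (hT : 0 < T)
    {A : H10 Ω →L[ℝ] H10 Ω} (hA : ∀ y v, formA Ω a a₀ y v = ⟪A y, v⟫_ℝ) (hf : Continuous f)
    {z₀ : L2Ω Ω} (hz₀ : z₀ =ᵐ[volΩ Ω] y₀) {φ : ℕ → ℝ → ℝ}
    (hφ : ∀ (k : ℕ) (s : ℝ), |s| ≤ k → |φ k s - f s| ≤ 1 / (k + 1)) {u : ℕ → L2Q Ω T} {u' : L2Q Ω T}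
    {B C : ℝ} (huB : ∀ k, ‖u k‖ ≤ B)
    (hu : ∀ w, Tendsto (fun k => ⟪u k, w⟫_ℝ) atTop (𝓝 ⟪u', w⟫_ℝ)) {h : ℕ → ℝ}
    (hh : Tendsto h atTop (𝓝 0)) {Y : ℕ → ℝ → H10 Ω} {y χ : ℕ → L2Q Ω T}
    (hap : ∀ k, IsApprox A (φ k) z₀ (u k) (h k) C (Y k) (y k) (χ k)) :
    ∃ (κ : ℕ → ℕ) (y' : L2Q Ω T), StrictMono κ ∧ Tendsto (fun k => y (κ k)) atTop (𝓝 y') ∧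
      IsSolution Ω T a a₀ f y₀ u' y' := by
  have := isFiniteMeasure_volQ (T := T) hb
  -- weakly convergent subsequences of the curves and of the nonlinear terms
  let W : ℕ → Lp (H10 Ω) 2 (volT T) := fun k => (hap k).memLp.toLp
  have hW : ∀ k, W k =ᵐ[volT T] Y k := fun k => (hap k).memLp.coeFn_toLp
  have hWC : ∀ k, ‖W k‖ ≤ √C := fun k => by
    refine Real.le_sqrt_of_sq_le ?_
    rw [norm_sq_eq_integral]
    refine (integral_congr_ae ?_).trans_le (hap k).integral_le
    filter_upwards [hW k] with t ht
    rw [ht]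
  obtain ⟨W', κ₁, hκ₁, hW'⟩ := exists_subseq_tendsto_inner hWC
  obtain ⟨χ', κ₂, hκ₂, hχ'⟩ := exists_subseq_tendsto_inner fun k => (hap (κ₁ k)).norm_le
  set κ := κ₁ ∘ κ₂ with hκdef
  have hκ : StrictMono κ := hκ₁.comp hκ₂
  have hWw : ∀ w, Tendsto (fun k => ⟪W (κ k), w⟫_ℝ) atTop (𝓝 ⟪W', w⟫_ℝ) := fun w =>
    (hW' w).comp hκ₂.tendsto_atTop
  have huw : ∀ w, Tendsto (fun k => ⟪u (κ k), w⟫_ℝ) atTop (𝓝 ⟪u', w⟫_ℝ) := fun w =>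
    (hu w).comp hκ.tendsto_atTop
  -- the time derivatives converge weakly, so the approximations converge weakly at each time
  let ιs := ContinuousLinearMap.adjoint (toL2 Ω)
  let Z : L2Q Ω T → L2Q Ω T → Lp (H10 Ω) 2 (volT T) → Lp (H10 Ω) 2 (volT T) := fun u χ W =>
    ιs.compLpL 2 (volT T) (sliceL Ω T u - sliceL Ω T χ) - A.compLpL 2 (volT T) W
  have hZw : ∀ w, Tendsto (fun k => ⟪Z (u (κ k)) (χ (κ k)) (W (κ k)), w⟫_ℝ) atTop
      (𝓝 ⟪Z u' χ' W', w⟫_ℝ) := fun w => by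
    simp only [Z, inner_sub_left, map_sub]
    exact ((tendsto_inner_map _ (tendsto_inner_map _ huw) w).sub
      (tendsto_inner_map _ (tendsto_inner_map _ hχ') w)).sub (tendsto_inner_map _ hWw w)
  have hZC : ∀ k, ‖Z (u (κ k)) (χ (κ k)) (W (κ k))‖ ≤
      ‖ιs.compLpL 2 (volT T)‖ * (‖sliceL Ω T‖ * (B + C)) +
        ‖A.compLpL 2 (volT T)‖ * √C := fun k => by
    refine (norm_sub_le _ _).trans (add_le_add ?_ ?_)
    · rw [← map_sub]
      refine (ContinuousLinearMap.le_opNorm _ _).trans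
        (mul_le_mul_of_nonneg_left ?_ (norm_nonneg _))
      refine (ContinuousLinearMap.le_opNorm _ _).trans
        (mul_le_mul_of_nonneg_left ?_ (norm_nonneg _))
      exact (norm_sub_le _ _).trans (add_le_add (huB _) (hap _).norm_le)
    · exact (ContinuousLinearMap.le_opNorm _ _).trans
        (mul_le_mul_of_nonneg_left (hWC _) (norm_nonneg _))
  have hptw : ∀ᵐ t ∂volT T, ∀ w, Tendsto (fun k => ⟪slice (y (κ k)) t, toL2 Ω w⟫_ℝ) atTop
      (𝓝 (⟪z₀, toL2 Ω w⟫_ℝ + ⟪∫ r in (0 : ℝ)..t, Z u' χ' W' r, w⟫_ℝ)) := by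
    filter_upwards [ae_all_iff.2 fun k => (hap (κ k)).inner_eq, ae_restrict_mem measurableSet_Ioo]
      with t h1 ht w
    choose τ hτ1 hτ2 hτ3 hτ4 using h1
    have hτlim : Tendsto τ atTop (𝓝 t) := by
      have h2 : Tendsto (fun k => t + h (κ k)) atTop (𝓝 t) := by
        simpa using (hh.comp hκ.tendsto_atTop).const_add t
      exact tendsto_of_tendsto_of_tendsto_of_le_of_le tendsto_const_nhds h2 hτ1 hτ2
    refine ((tendsto_inner_primitive hZC hZw ht.1.le hτ1 hτ3 hτlim w).const_add _).congr fun k => ?_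
    rw [hτ4]
    congr 2
    refine intervalIntegral_congr_volT ?_ le_rfl (ht.1.le.trans (hτ1 k)) (hτ3 k)
    filter_upwards [timeDeriv_ae_eq A (u (κ k)) (χ (κ k)) (W (κ k)), hW (κ k)] with r h2 h3
    simp only [Z]
    rw [h2, timeDeriv, timeDeriv, h3]
  have hCae : ∀ᵐ t ∂volT T, ∀ k, ‖slice (y (κ k)) t‖ ≤ C := ae_all_iff.2 fun k =>
    (hap (κ k)).norm_slice_le
  -- the range of `toL2` is dense, and a weak cluster point identifies the limit functional
  have hptw' : ∀ᵐ t ∂volT T, ∀ g, ∃ l,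
      Tendsto (fun k => ⟪slice (y (κ k)) t, g⟫_ℝ) atTop (𝓝 l) := by
    filter_upwards [hptw, hCae] with t h1 h2 g
    obtain ⟨z, ν, hν, hz⟩ := exists_subseq_tendsto_inner h2
    refine ⟨⟪z, g⟫_ℝ, tendsto_inner_of_dense h2 (denseRange_toL2 hΩ) ?_ g⟩
    rintro _ ⟨w, rfl⟩
    rw [tendsto_nhds_unique (hz (toL2 Ω w)) ((h1 w).comp hν.tendsto_atTop)]
    exact h1 w
  obtain ⟨y', hy'⟩ := cauchySeq_tendsto_of_complete (cauchySeq_of_tendsto_inner_slice hΩ hb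
    (fun k => (hap (κ k)).memLp) (fun k => (hap (κ k)).slice_eq)
    (fun k => (hap (κ k)).norm_slice_le) (fun k => (hap (κ k)).integral_le) hptw')
  refine ⟨κ, y', hκ, hy', ?_⟩
  -- the limit curve
  have hslice : ∀ᵐ t ∂volT T, slice y' t = toL2 Ω (W' t) := by
    have h1 : sliceL Ω T y' = (toL2 Ω).compLpL 2 (volT T) W' := by
      refine ext_inner_right ℝ fun w => ?_
      have h2 : Tendsto (fun k => ⟪sliceL Ω T (y (κ k)), w⟫_ℝ) atTop (𝓝 ⟪sliceL Ω T y', w⟫_ℝ) :=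
        (((sliceL Ω T).continuous.tendsto y').comp hy').inner tendsto_const_nhds
      refine tendsto_nhds_unique h2 ?_
      refine (tendsto_inner_map ((toL2 Ω).compLpL 2 (volT T)) hWw w).congr fun k => ?_
      congr 1
      refine Lp.ext ?_
      filter_upwards [(toL2 Ω).coeFn_compLpL (W (κ k)), sliceL_coe (y (κ k)), hW (κ k),
        (hap (κ k)).slice_eq] with t h3 h4 h5 h6
      rw [h3, h4, h5, h6]
    filter_upwards [sliceL_coe y', (toL2 Ω).coeFn_compLpL (p := 2) W'] with t h3 h4
    rw [← h3, ← h4, h1]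
  -- the nonlinear term
  have hχf : χ' =ᵐ[volQ Ω T] fun z => f (y' z) := by
    obtain ⟨ν, hν, hae⟩ := (tendstoInMeasure_of_tendsto_Lp hy').exists_seq_tendsto_ae
    refine ae_eq_of_tendsto_inner (χ := fun k => χ (κ (ν k)))
      (fun w => (hχ' w).comp hν.tendsto_atTop) ?_
    filter_upwards [hae, ae_all_iff.2 fun k => (hap (κ (ν k))).coe_eq] with z h1 h2
    simp only [h2]
    exact tendsto_eval_of_uniform hf hφ (hκ.comp hν) h1
  refine isSolution_of_integral_eq hΩ hT hA hz₀ (Lp.memLp W') hslice hχf ?_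
  obtain ⟨ν, hν, hae⟩ := (tendstoInMeasure_of_tendsto_Lp
    (((sliceL Ω T).continuous.tendsto y').comp hy')).exists_seq_tendsto_ae
  filter_upwards [hptw, hae, hslice, sliceL_coe y', ae_all_iff.2 fun k => sliceL_coe (y (κ (ν k))),
    ae_restrict_mem measurableSet_Ioo] with t h1 h2 h3 h4 h5 ht w
  rw [← intervalIntegral_congr_volT (timeDeriv_ae_eq A u' χ' W') le_rfl ht.1.le ht.2.le, ← h3]
  refine tendsto_nhds_unique ?_ ((h1 w).comp hν.tendsto_atTop)
  rw [← h4]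
  refine Tendsto.congr (fun k => ?_) (h2.inner tendsto_const_nhds)
  simp only [Function.comp_apply, h5]

end

/-! ### Uniqueness -/

section

/-- Gronwall's inequality in integral form, with zero initial value. -/
theorem eq_zero_of_le_integral {T K : ℝ} (hT : 0 ≤ T) {e : ℝ → ℝ} (he : ContinuousOn e (Icc 0 T))
    (h0 : ∀ t ∈ Icc 0 T, 0 ≤ e t) (h : ∀ t ∈ Icc 0 T, e t ≤ K * ∫ r in (0 : ℝ)..t, e r) :
    ∀ t ∈ Icc 0 T, e t = 0 := by
  set E : ℝ → ℝ := IccExtend hT ((Icc 0 T).domRestrict e)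
  have hE : Continuous E := he.domRestrict.Icc_extend'
  have hEe : ∀ t ∈ Icc 0 T, E t = e t := fun t ht => by
    simp only [E, IccExtend_of_mem hT _ ht, domRestrict_apply]
  have hint : ∀ t ∈ Icc 0 T, ∫ r in (0 : ℝ)..t, E r = ∫ r in (0 : ℝ)..t, e r := fun t ht => by
    refine intervalIntegral.integral_congr fun r hr => hEe r ?_
    rw [uIcc_of_le ht.1] at hr
    exact ⟨hr.1, hr.2.trans ht.2⟩
  have hder : ∀ t, HasDerivAt (fun t => ∫ r in (0 : ℝ)..t, E r) (E t) t := fun t =>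
    intervalIntegral.integral_hasDerivAt_right (hE.intervalIntegrable _ _)
      (hE.stronglyMeasurableAtFilter _ _) hE.continuousAt
  have hnn : ∀ t ∈ Icc 0 T, 0 ≤ ∫ r in (0 : ℝ)..t, E r := fun t ht =>
    intervalIntegral.integral_nonneg ht.1 fun r hr => by
      rw [hEe r ⟨hr.1, hr.2.trans ht.2⟩]
      exact h0 r ⟨hr.1, hr.2.trans ht.2⟩
  have hg := norm_le_gronwallBound_of_norm_deriv_right_le (f := fun t => ∫ r in (0 : ℝ)..t, E r)
    (f' := E) (δ := 0) (K := K) (ε := 0) (a := 0) (b := T)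
    (fun t _ => (hder t).continuousAt.continuousWithinAt)
    (fun t _ => (hder t).hasDerivWithinAt) (by simp) (fun t ht => by
      have ht' := Ico_subset_Icc_self ht
      rw [hEe t ht', Real.norm_eq_abs, Real.norm_eq_abs, abs_of_nonneg (h0 t ht'),
        abs_of_nonneg (hnn t ht'), hint t ht', add_zero]
      exact h t ht')
  intro t ht
  have h1 := hg t ht
  rw [gronwallBound_ε0_δ0, norm_le_zero_iff, hint t ht] at h1
  have h2 := h t ht
  rw [h1, mul_zero] at h2
  exact le_antisymm h2 (h0 t ht)

theorem monotone_add_mul {f : ℝ → ℝ} (hf : Differentiable ℝ f) {Λ : ℝ} (h : ∀ s, -Λ ≤ deriv f s) :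
    Monotone fun s => f s + Λ * s := by
  refine monotone_of_deriv_nonneg (by fun_prop) fun s => ?_
  have h1 : HasDerivAt (fun s => f s + Λ * s) (deriv f s + Λ * 1) s :=
    (hf s).hasDerivAt.add ((hasDerivAt_id s).const_mul Λ)
  rw [h1.deriv]
  linarith [h s]

variable {n : ℕ} {Ω : Set (Space n)} {T : ℝ} {a : Fin n → Fin n → Space n → ℝ} {a₀ : Space n → ℝ}
  {f : ℝ → ℝ} {y₀ : Space n → ℝ} {A : H10 Ω →L[ℝ] H10 Ω}

/-- A solution satisfies the equation in integrated form, with its continuous representative `c`. -/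
theorem IsSolution.exists_integral_eq (hT : 0 < T) (hA : ∀ y v, formA Ω a a₀ y v = ⟪A y, v⟫_ℝ)
    {u y : L2Q Ω T} (h : IsSolution Ω T a a₀ f y₀ u y) :
    ∃ (Y : ℝ → H10 Ω) (c : ℝ → L2Ω Ω) (χ : L2Q Ω T), MemLp Y 2 (volT T) ∧
      ContinuousOn c (Icc 0 T) ∧ c 0 =ᵐ[volΩ Ω] y₀ ∧ (∀ᵐ t ∂volT T, c t = toL2 Ω (Y t)) ∧
      (∀ᵐ t ∂volT T, slice y t = toL2 Ω (Y t)) ∧ χ =ᵐ[volQ Ω T] (fun z => f (y z)) ∧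
      ∀ t ∈ Ioo 0 T, ∀ w, ⟪c t, toL2 Ω w⟫_ℝ = ⟪c 0, toL2 Ω w⟫_ℝ +
        ⟪∫ r in (0 : ℝ)..t, timeDeriv A u χ Y r, w⟫_ℝ := by
  obtain ⟨hf, Y, Y', hW, hyY, heq, c, hc1, hc2, hc3⟩ := h
  set χ : L2Q Ω T := hf.toLp _
  have hχ : χ =ᵐ[volQ Ω T] fun z => f (y z) := hf.coeFn_toLp
  have hY'i : Integrable Y' (volT T) := hW.memLp_deriv.integrable one_le_two
  have hYi := hW.memLp.integrable one_le_two
  have hZi := (memLp_timeDeriv A u χ hW.memLp).integrable one_le_two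
  refine ⟨Y, c, χ, hW.memLp, hc1, hc3, hc2, ?_, hχ, ?_⟩
  · filter_upwards [slice_coe y, hyY] with t h1 h2
    refine Lp.ext ?_
    filter_upwards [h1, h2] with x h3 h4
    rw [h3, h4]
  · have hder : ∀ᵐ t ∂volT T, ∀ w, Y' t w = ⟪timeDeriv A u χ Y t, w⟫_ℝ := by
      filter_upwards [heq, integral_slice_mul (F := u), integral_slice_mul (F := χ),
        ae_ae_of_ae_volQ hχ] with t h1 h2 h3 h4 w
      have h5 : ∫ x in Ω, f (y (x, t)) * toL2 Ω w x = ∫ x in Ω, χ (x, t) * toL2 Ω w x := by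
        refine integral_congr_ae ?_
        filter_upwards [h4] with x hx
        rw [hx]
      have h6 := h1 w
      rw [h5, h2, h3, hA] at h6
      rw [inner_timeDeriv]
      linarith
    intro t ht w
    have hi1 : Integrable (fun t => ⟪timeDeriv A u χ Y t, w⟫_ℝ) (volT T) := hZi.inner_const w
    rw [eq_add_primitive_of_weak_deriv hT (m := fun t => ⟪c t, toL2 Ω w⟫_ℝ)
      (z := fun t => ⟪timeDeriv A u χ Y t, w⟫_ℝ) (hc1.inner continuousOn_const) hi1
      (fun φ h1 h2 h3 => ?_) t ⟨ht.1.le, ht.2.le⟩,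
      inner_intervalIntegral (intervalIntegrable_of_integrable_volT hZi ⟨le_rfl, hT.le⟩
        ⟨ht.1.le, ht.2.le⟩)]
    have h4 := congrArg (fun F => F w) (hW.weak_deriv φ h1 h2 h3)
    have hi2 : Integrable (fun t => toHm1 Ω (toL2 Ω (Y t))) (volT T) := by
      simp only [toHm1_eq_toDual]
      exact ((InnerProductSpace.toDual ℝ (H10 Ω)).isometry.lipschitz.comp_memLp (map_zero _)
        ((ContinuousLinearMap.adjoint (toL2 Ω)).comp_memLp'
          ((toL2 Ω).comp_memLp' hW.memLp))).integrable one_le_two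
    simp only [neg_apply] at h4
    rw [ContinuousLinearMap.integral_apply (integrable_smul_of_hasCompactSupport
        (h1.continuous_deriv (by simp)) h2.deriv hi2),
      ContinuousLinearMap.integral_apply
        (integrable_smul_of_hasCompactSupport h1.continuous h2 hY'i)] at h4
    simp only [smul_apply, toHm1_apply, smul_eq_mul] at h4
    refine Eq.trans ?_ (h4.trans (congrArg Neg.neg ?_))
    · refine integral_congr_ae ?_
      filter_upwards [hc2] with r hr
      rw [hr]
    · refine integral_congr_ae ?_
      filter_upwards [hder] with r hr
      rw [hr]

/-- The one-sided Lipschitz condition on `f`, for almost every time. -/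
theorem le_inner_slice_sub {Λ : ℝ} (hmono : Monotone fun s => f s + Λ * s) {y₁ y₂ χ₁ χ₂ : L2Q Ω T}
    (h₁ : χ₁ =ᵐ[volQ Ω T] fun z => f (y₁ z)) (h₂ : χ₂ =ᵐ[volQ Ω T] fun z => f (y₂ z)) :
    ∀ᵐ t ∂volT T, -Λ * ‖slice y₁ t - slice y₂ t‖ ^ 2 ≤
      ⟪slice χ₁ t - slice χ₂ t, slice y₁ t - slice y₂ t⟫_ℝ := by
  filter_upwards [slice_coe y₁, slice_coe y₂, slice_coe χ₁, slice_coe χ₂, ae_ae_of_ae_volQ h₁,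
    ae_ae_of_ae_volQ h₂] with t k1 k2 k3 k4 k5 k6
  rw [norm_sq_eq_integral, ← integral_const_mul, L2.inner_def]
  refine integral_mono_ae (((Lp.memLp _).integrable_norm_pow two_ne_zero).const_mul _)
    (L2.integrable_inner _ _) ?_
  filter_upwards [k1, k2, k3, k4, k5, k6, Lp.coeFn_sub (slice y₁ t) (slice y₂ t),
    Lp.coeFn_sub (slice χ₁ t) (slice χ₂ t)] with x l1 l2 l3 l4 l5 l6 l7 l8
  rw [l7, l8, Pi.sub_apply, Pi.sub_apply, l1, l2, l3, l4, l5, l6, Real.inner_apply,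
    Real.norm_eq_abs, sq_abs]
  set p := y₁ (x, t)
  set q := y₂ (x, t)
  have h3 : 0 ≤ (f p + Λ * p - (f q + Λ * q)) * (p - q) := by
    rcases le_total p q with h | h
    · exact mul_nonneg_of_nonpos_of_nonpos (sub_nonpos.2 (hmono h)) (sub_nonpos.2 h)
    · exact mul_nonneg (sub_nonneg.2 (hmono h)) (sub_nonneg.2 h)
  linarith

/-- Solutions are unique: the energy identity for the difference and Gronwall's inequality. -/
theorem IsSolution.unique (hT : 0 < T) (hA : ∀ y v, formA Ω a a₀ y v = ⟪A y, v⟫_ℝ)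
    (hA0 : ∀ v, 0 ≤ ⟪A v, v⟫_ℝ) {Λ : ℝ} (hmono : Monotone fun s => f s + Λ * s)
    {u y₁ y₂ : L2Q Ω T} (h₁ : IsSolution Ω T a a₀ f y₀ u y₁)
    (h₂ : IsSolution Ω T a a₀ f y₀ u y₂) : y₁ = y₂ := by
  obtain ⟨Y₁, c₁, χ₁, hY₁, hc₁, hc0₁, hcY₁, hy₁, hχ₁, he₁⟩ := h₁.exists_integral_eq hT hA
  obtain ⟨Y₂, c₂, χ₂, hY₂, hc₂, hc0₂, hcY₂, hy₂, hχ₂, he₂⟩ := h₂.exists_integral_eq hT hA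
  have h0 : c₁ 0 = c₂ 0 := Lp.ext (hc0₁.trans hc0₂.symm)
  have hZ₁ := memLp_timeDeriv A u χ₁ hY₁
  have hZ₂ := memLp_timeDeriv A u χ₂ hY₂
  have hen := energy_identity (toL2 Ω) hT (hY₁.sub hY₂) (hZ₁.sub hZ₂) (c := fun t => c₁ t - c₂ t)
    (hc₁.sub hc₂) (by
      filter_upwards [hcY₁, hcY₂] with t k1 k2
      rw [k1, k2, Pi.sub_apply, map_sub]) (by
      filter_upwards [ae_restrict_mem measurableSet_Ioo] with t ht w
      have i1 := intervalIntegrable_of_integrable_volT (hZ₁.integrable one_le_two) (s := 0) (t := t)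
        ⟨le_rfl, hT.le⟩ ⟨ht.1.le, ht.2.le⟩
      have i2 := intervalIntegrable_of_integrable_volT (hZ₂.integrable one_le_two) (s := 0) (t := t)
        ⟨le_rfl, hT.le⟩ ⟨ht.1.le, ht.2.le⟩
      simp only [Pi.sub_apply]
      rw [intervalIntegral.integral_sub i1 i2, inner_sub_left, inner_sub_left, inner_sub_left,
        he₁ t ht, he₂ t ht]
      ring)
  have hle : ∀ᵐ t ∂volT T, ⟪(Y₁ - Y₂) t, (timeDeriv A u χ₁ Y₁ - timeDeriv A u χ₂ Y₂) t⟫_ℝ ≤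
      Λ * ‖c₁ t - c₂ t‖ ^ 2 := by
    filter_upwards [hcY₁, hcY₂, hy₁, hy₂, le_inner_slice_sub hmono hχ₁ hχ₂]
      with t k1 k2 k3 k4 k5
    have k6 := hA0 (Y₁ t - Y₂ t)
    rw [k3, k4, ← k1, ← k2] at k5
    rw [Pi.sub_apply, Pi.sub_apply, real_inner_comm, inner_sub_left, inner_timeDeriv,
      inner_timeDeriv]
    have k7 : ⟪slice χ₁ t - slice χ₂ t, c₁ t - c₂ t⟫_ℝ =
        ⟪slice χ₁ t, toL2 Ω (Y₁ t - Y₂ t)⟫_ℝ - ⟪slice χ₂ t, toL2 Ω (Y₁ t - Y₂ t)⟫_ℝ := by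
      rw [map_sub, ← k1, ← k2, inner_sub_left]
    have k8 : ⟪A (Y₁ t - Y₂ t), Y₁ t - Y₂ t⟫_ℝ =
        ⟪A (Y₁ t), Y₁ t - Y₂ t⟫_ℝ - ⟪A (Y₂ t), Y₁ t - Y₂ t⟫_ℝ := by
      rw [map_sub, inner_sub_left]
    linarith
  have hcc : ContinuousOn (fun t => ‖c₁ t - c₂ t‖ ^ 2) (Icc 0 T) := ((hc₁.sub hc₂).norm).pow 2
  have hzero := eq_zero_of_le_integral (K := 2 * Λ) hT.le hcc (fun t _ => sq_nonneg ‖c₁ t - c₂ t‖)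
    fun t ht => by
      have k1 := hen t ht
      simp only [h0, sub_self, norm_zero, zero_pow two_ne_zero, zero_add] at k1
      have hI : Icc 0 t ⊆ Icc 0 T := Icc_subset_Icc le_rfl ht.2
      have hae : ∀ᵐ r ∂volume.restrict (Icc 0 t),
          ⟪(Y₁ - Y₂) r, (timeDeriv A u χ₁ Y₁ - timeDeriv A u χ₂ Y₂) r⟫_ℝ ≤
            Λ * ‖c₁ r - c₂ r‖ ^ 2 := by
        rw [← Measure.restrict_congr_set Ioo_ae_eq_Icc]
        exact ae_mono (Measure.restrict_mono (Ioo_subset_Ioo le_rfl ht.2) le_rfl) hle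
      have k2 : ∫ r in (0 : ℝ)..t, ⟪(Y₁ - Y₂) r, (timeDeriv A u χ₁ Y₁ - timeDeriv A u χ₂ Y₂) r⟫_ℝ ≤
          ∫ r in (0 : ℝ)..t, Λ * ‖c₁ r - c₂ r‖ ^ 2 :=
        intervalIntegral.integral_mono_ae_restrict ht.1
          (intervalIntegrable_of_integrable_volT
            (integrable_inner_of_memLp (hY₁.sub hY₂) (hZ₁.sub hZ₂)) ⟨le_rfl, hT.le⟩ ht)
          ((continuousOn_const.mul (hcc.mono hI)).intervalIntegrable_of_Icc ht.1) hae
      rw [intervalIntegral.integral_const_mul] at k2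
      linarith
  refine eq_of_slice_ae_eq ?_
  filter_upwards [hcY₁, hcY₂, hy₁, hy₂, ae_restrict_mem measurableSet_Ioo] with t k1 k2 k3 k4 ht
  rw [k3, k4, ← k1, ← k2, ← sub_eq_zero, ← norm_eq_zero]
  exact pow_eq_zero_iff two_ne_zero |>.1 (hzero t ⟨ht.1.le, ht.2.le⟩)

end

/-! ### Optimal control -/

section

variable {n : ℕ} {Ω : Set (Space n)} {T : ℝ} {a : Fin n → Fin n → Space n → ℝ} {a₀ : Space n → ℝ}
  {f : ℝ → ℝ} {y₀ : Space n → ℝ} {A : H10 Ω →L[ℝ] H10 Ω}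

/-- Smooth approximations of the nonlinearity, together with approximate solutions whose bounds are
uniform over all controls in a ball. -/
theorem exists_uniform_isApprox (hb : Bornology.IsBounded Ω)
    (ha : ∀ i j, MemLp (a i j) ∞ (volΩ Ω)) (ha₀ : MemLp a₀ ∞ (volΩ Ω)) {lam : ℝ} (hlam : 0 < lam)
    (hell : ∀ᵐ x ∂volΩ Ω, ∀ ξ : Space n, lam * ‖ξ‖ ^ 2 ≤ ∑ i, ∑ j, a i j x * ξ i * ξ j)
    (hnn : ∀ᵐ x ∂volΩ Ω, 0 ≤ a₀ x) (hA : ∀ y v, formA Ω a a₀ y v = ⟪A y, v⟫_ℝ) (hT : 0 < T)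
    (hf : ContDiff ℝ 1 f) (hf0 : f 0 = 0) {Λ : ℝ} (hΛ : 0 ≤ Λ)
    (hmono : Monotone fun s => f s + Λ * s) {z₀ : L2Ω Ω} {R₀ : ℝ}
    (hz₀ : ∀ᵐ x ∂volΩ Ω, |z₀ x| ≤ R₀) (B : ℝ) :
    ∃ (C : ℝ) (φ : ℕ → ℝ → ℝ) (h : ℕ → ℝ),
      (∀ (k : ℕ) (s : ℝ), |s| ≤ k → |φ k s - f s| ≤ 1 / (k + 1)) ∧ Tendsto h atTop (𝓝 0) ∧
      ∀ k (u : L2Q Ω T), ‖u‖ ≤ B → ∃ Y y χ, IsApprox A (φ k) z₀ u (h k) C Y y χ := by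
  have : IsFiniteMeasure (volΩ Ω) := ⟨by simpa using hb.measure_lt_top⟩
  have hg : ContDiff ℝ 1 fun s => f s + Λ * s := hf.add (contDiff_const.mul contDiff_id)
  choose g L hgs hgm hgL hg0 hgapp using fun k : ℕ =>
    exists_smooth_approx hg hmono (by rw [hf0, mul_zero, add_zero]) (R := k + |R₀|)
      (ε := 1 / (k + 1)) (by positivity) (by positivity)
  -- the potentials of the approximations are bounded at the initial value
  obtain ⟨S, hS⟩ : ∃ S, ∀ s ∈ Icc (-|R₀|) |R₀|, ‖f s + Λ * s‖ ≤ S :=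
    isCompact_Icc.exists_bound_of_continuousOn hg.continuous.continuousOn
  have hP : ∀ k, ∫ x in Ω, (∫ r in (0 : ℝ)..z₀ x, g k r) ≤ |R₀| * (S + 1) * volume.real Ω := by
    intro k
    have h1 : ∀ᵐ x ∂volΩ Ω, (∫ r in (0 : ℝ)..z₀ x, g k r) ≤ |R₀| * (S + 1) := by
      filter_upwards [hz₀] with x hx
      have hx' : |z₀ x| ≤ |R₀| := hx.trans (le_abs_self _)
      have h2 := primitive_sub_le (hgL k).continuous (hgm k) (z₀ x) 0
      rw [intervalIntegral.integral_same, sub_zero, sub_zero] at h2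
      have h3 : |g k (z₀ x)| ≤ S + 1 := by
        have h4 := hgapp k (z₀ x) (hx'.trans (by linarith [(Nat.cast_nonneg k : (0 : ℝ) ≤ k)]))
        have h5 := hS (z₀ x) (abs_le.1 hx')
        have h6 : (1 : ℝ) / (k + 1) ≤ 1 := by
          rw [div_le_one (by positivity)]; linarith [(Nat.cast_nonneg k : (0 : ℝ) ≤ k)]
        rw [Real.norm_eq_abs] at h5
        have h7 := abs_sub_abs_le_abs_sub (g k (z₀ x)) (f (z₀ x) + Λ * z₀ x)
        linarith
      refine h2.trans ((le_abs_self _).trans ?_)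
      rw [abs_mul, mul_comm]
      exact mul_le_mul hx' h3 (abs_nonneg _) (abs_nonneg _)
    refine (integral_mono_ae (integrable_primitive_comp (hgL k) (hg0 k) (hgm k) z₀)
      (integrable_const _) h1).trans_eq ?_
    rw [integral_const, measureReal_restrict_apply_univ, smul_eq_mul, mul_comm]
  obtain ⟨C, M₀, hC⟩ := exists_isApprox ha ha₀ hlam hell hnn hA hT hΛ z₀
    (|R₀| * (S + 1) * volume.real Ω) B
  refine ⟨C, fun k s => g k s - Λ * s, fun k => T / ((M₀ + k : ℕ) : ℝ), fun k s hs => ?_, ?_,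
    fun k u hu => hC (g k) (L k) (hgs k) (hgm k) (hgL k) (hg0 k) (hP k) u hu (M₀ + k)
      (Nat.le_add_right _ _)⟩
  · have h1 := hgapp k s (hs.trans (by linarith [abs_nonneg R₀]))
    rwa [sub_sub, add_comm (Λ * s)]
  · exact (tendsto_const_div_atTop_nhds_zero_nat T).comp
      (tendsto_add_atTop_nat M₀ |>.congr fun k => add_comm _ _)

/-- The squared distance to the target and the control cost are the two parts of `2 J`. -/
theorem two_mul_cost_eq {yd : Space n × ℝ → ℝ} (hyd : MemLp yd 2 (volQ Ω T)) (α : ℝ)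
    (u : L2Q Ω T) : 2 * cost Ω T a a₀ f y₀ yd α u =
      ‖state Ω T a a₀ f y₀ u - hyd.toLp yd‖ ^ 2 + α * ‖u‖ ^ 2 := by
  set y := state Ω T a a₀ f y₀ u with hy
  have e1 : ‖y - hyd.toLp yd‖ ^ 2 = ∫ z in Ω ×ˢ Ioo 0 T, (y z - yd z) ^ 2 := by
    rw [norm_sq_eq_integral]
    refine integral_congr_ae ?_
    filter_upwards [Lp.coeFn_sub y (hyd.toLp yd), hyd.coeFn_toLp] with z h1 h2
    rw [h1, Pi.sub_apply, h2, Real.norm_eq_abs, sq_abs]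
  have e2 : ‖u‖ ^ 2 = ∫ z in Ω ×ˢ Ioo 0 T, u z ^ 2 := by
    rw [norm_sq_eq_integral]
    simp only [Real.norm_eq_abs, sq_abs]
  have i1 : Integrable (fun z => (y z - yd z) ^ 2) (volQ Ω T) :=
    ((Lp.memLp y).sub hyd).integrable_sq
  have i2 : Integrable (fun z => α * u z ^ 2) (volQ Ω T) := (Lp.memLp u).integrable_sq.const_mul α
  have e3 : ∫ z in Ω ×ˢ Ioo 0 T, ((y z - yd z) ^ 2 + α * u z ^ 2) =
      (∫ z in Ω ×ˢ Ioo 0 T, (y z - yd z) ^ 2) + ∫ z in Ω ×ˢ Ioo 0 T, α * u z ^ 2 :=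
    integral_add i1 i2
  rw [cost, ← hy, e3, integral_const_mul, e1, e2]
  ring

/-- The direct method: if solutions are unique and arise as limits of approximate solutions, then
the control problem has a solution. The state of each member of a minimizing sequence is replaced by
a nearby approximate solution, to which the compactness result applies. -/
theorem exists_optimal_control (hΩ : IsOpen Ω) (hb : Bornology.IsBounded Ω) (hT : 0 < T)
    (hA : ∀ y v, formA Ω a a₀ y v = ⟪A y, v⟫_ℝ) (hf : Continuous f) {z₀ : L2Ω Ω}
    (hz₀ : z₀ =ᵐ[volΩ Ω] y₀)
    (huniq : ∀ u y₁ y₂ : L2Q Ω T, IsSolution Ω T a a₀ f y₀ u y₁ → IsSolution Ω T a a₀ f y₀ u y₂ →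
      y₁ = y₂)
    (happ : ∀ B : ℝ, ∃ (C : ℝ) (φ : ℕ → ℝ → ℝ) (h : ℕ → ℝ),
      (∀ (k : ℕ) (s : ℝ), |s| ≤ k → |φ k s - f s| ≤ 1 / (k + 1)) ∧ Tendsto h atTop (𝓝 0) ∧
      ∀ k (u : L2Q Ω T), ‖u‖ ≤ B → ∃ Y y χ, IsApprox A (φ k) z₀ u (h k) C Y y χ)
    (hstate : ∀ u : L2Q Ω T, IsSolution Ω T a a₀ f y₀ u (state Ω T a a₀ f y₀ u))
    {yd : Space n × ℝ → ℝ} (hyd : MemLp yd 2 (volQ Ω T)) {α : ℝ} (hα : 0 < α) :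
    ∃ ubar : L2Q Ω T, ∀ u : L2Q Ω T,
      cost Ω T a a₀ f y₀ yd α ubar ≤ cost Ω T a a₀ f y₀ yd α u := by
  set J : L2Q Ω T → ℝ := fun u => cost Ω T a a₀ f y₀ yd α u with hJ
  set y : L2Q Ω T → L2Q Ω T := fun u => state Ω T a a₀ f y₀ u with hy
  set d := hyd.toLp yd
  have hJ2 : ∀ u, 2 * J u = ‖y u - d‖ ^ 2 + α * ‖u‖ ^ 2 := fun u => two_mul_cost_eq hyd α u
  have hJ0 : ∀ u, 0 ≤ J u := fun u => by
    have : 0 ≤ ‖y u - d‖ ^ 2 + α * ‖u‖ ^ 2 := by positivity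
    linarith [hJ2 u]
  have hbdd : BddBelow (range J) := ⟨0, by rintro _ ⟨u, rfl⟩; exact hJ0 u⟩
  obtain ⟨v, -, hv, hvmem⟩ := exists_seq_tendsto_sInf (range_nonempty J) hbdd
  choose u hu using hvmem
  set m := sInf (range J)
  have hum : Tendsto (fun k => J (u k)) atTop (𝓝 m) := by simpa only [hu] using hv
  obtain ⟨B, hB⟩ : ∃ B, ∀ k, ‖u k‖ ≤ B := by
    obtain ⟨R, hR⟩ := hum.bddAbove_range
    refine ⟨√(2 * R / α), fun k => Real.le_sqrt_of_sq_le ?_⟩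
    rw [le_div_iff₀ hα]
    have h1 := hR ⟨k, rfl⟩
    simp only at h1
    linarith [hJ2 (u k), sq_nonneg ‖y (u k) - d‖]
  obtain ⟨u', κ, hκ, hu'⟩ := exists_subseq_tendsto_inner hB
  obtain ⟨C, φ, h, hφ, hh, hap⟩ := happ B
  choose Y w χ hw using fun k i => hap k (u i) (hB i)
  -- for a fixed control the approximate solutions converge to its state, by uniqueness
  have hclose : ∀ k : ℕ, ∃ ν, k ≤ ν ∧ ‖w ν (κ k) - y (u (κ k))‖ ≤ 1 / ((k : ℝ) + 1) := by
    intro k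
    obtain ⟨σ, y', hσ, hlim, hsol⟩ := exists_subseq_tendsto_isSolution hΩ hb hT hA hf hz₀ hφ
      (u := fun _ => u (κ k)) (fun _ => hB (κ k)) (fun _ => tendsto_const_nhds) hh
      (fun i => hw i (κ k))
    rw [huniq _ _ _ hsol (hstate (u (κ k)))] at hlim
    have h1 := (tendsto_iff_norm_sub_tendsto_zero.1 hlim).eventually_le_const
      (show (0 : ℝ) < 1 / ((k : ℝ) + 1) by positivity)
    obtain ⟨i, hi1, hi2⟩ := (h1.and (eventually_ge_atTop k)).exists
    exact ⟨σ i, hi2.trans (hσ.id_le i), hi1⟩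
  choose ν hν1 hν2 using hclose
  have hνtop : Tendsto ν atTop atTop := tendsto_atTop_mono hν1 tendsto_id
  obtain ⟨σ, y', hσ, hlim, hsol⟩ := exists_subseq_tendsto_isSolution hΩ hb hT hA hf hz₀
    (φ := fun k => φ (ν k)) (fun k s hs => by
      have h1 : (k : ℝ) ≤ ν k := by exact_mod_cast hν1 k
      exact (hφ (ν k) s (hs.trans h1)).trans
        (one_div_le_one_div_of_le (by positivity) (by linarith)))
    (u := fun k => u (κ k)) (fun k => hB (κ k)) hu' (hh.comp hνtop) (fun k => hw (ν k) (κ k))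
  have hy' : y' = y u' := huniq _ _ _ hsol (hstate u')
  have hylim : Tendsto (fun k => y (u (κ (σ k)))) atTop (𝓝 (y u')) := by
    have h1 : Tendsto (fun k => w (ν (σ k)) (κ (σ k)) - y (u (κ (σ k)))) atTop (𝓝 0) :=
      squeeze_zero_norm (fun k => hν2 (σ k))
        ((tendsto_one_div_add_atTop_nhds_zero_nat (𝕜 := ℝ)).comp hσ.tendsto_atTop)
    have h2 := hlim.sub h1
    rw [sub_zero, hy'] at h2
    refine h2.congr fun k => ?_
    rw [sub_sub_cancel]
  -- the tracking term converges, so the norms of the controls converge as well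
  have hnorm : Tendsto (fun k => ‖u (κ (σ k))‖) atTop
      (𝓝 (√((2 * m - ‖y u' - d‖ ^ 2) / α))) := by
    have h1 : Tendsto (fun k => (2 * J (u (κ (σ k))) - ‖y (u (κ (σ k))) - d‖ ^ 2) / α) atTop
        (𝓝 ((2 * m - ‖y u' - d‖ ^ 2) / α)) :=
      (((hum.comp (hκ.comp hσ).tendsto_atTop).const_mul 2).sub
        (((hylim.sub_const d).norm).pow 2)).div_const α
    refine h1.sqrt.congr fun k => ?_
    rw [hJ2, add_sub_cancel_left, mul_div_cancel_left₀ _ hα.ne', Real.sqrt_sq (norm_nonneg _)]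
  have hle : ‖u'‖ ≤ √((2 * m - ‖y u' - d‖ ^ 2) / α) :=
    norm_le_of_tendsto_inner ((hu' u').comp hσ.tendsto_atTop) (fun k => le_rfl) hnorm
  have hnn : 0 ≤ (2 * m - ‖y u' - d‖ ^ 2) / α := by
    refine ge_of_tendsto' (((((hum.comp (hκ.comp hσ).tendsto_atTop).const_mul 2).sub
        (((hylim.sub_const d).norm).pow 2)).div_const α)) fun k => ?_
    simp only [Function.comp_apply]
    rw [hJ2, add_sub_cancel_left]
    positivity
  have hfin : J u' ≤ m := by
    have h1 := pow_le_pow_left₀ (norm_nonneg _) hle 2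
    rw [Real.sq_sqrt hnn, le_div_iff₀ hα] at h1
    linarith [hJ2 u']
  exact ⟨u', fun u => hfin.trans (csInf_le hbdd ⟨u, rfl⟩)⟩

end

end ParabolicControl

theorem theorem2p4 {n : ℕ} (hn : 2 ≤ n)
    (Ω : Set (Space n)) (hΩ_open : IsOpen Ω) (hΩ_conn : IsConnected Ω)
    (hΩ_bdd : Bornology.IsBounded Ω) (T : ℝ) (hT : 0 < T)
    (a : Fin n → Fin n → Space n → ℝ) (a₀ : Space n → ℝ)
    (ha : ∀ i j, MemLp (a i j) ∞ (volΩ Ω)) (ha₀ : MemLp a₀ ∞ (volΩ Ω))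
    (ha_ell : ∃ Λ : ℝ, 0 < Λ ∧ ∀ᵐ x ∂volΩ Ω, ∀ ξ : Space n,
      Λ * ‖ξ‖ ^ 2 ≤ ∑ i, ∑ j, a i j x * ξ i * ξ j)
    (ha₀_nonneg : ∀ᵐ x ∂volΩ Ω, 0 ≤ a₀ x)
    (f : ℝ → ℝ) (hf : ContDiff ℝ 1 f) (hf_zero : f 0 = 0)
    (hf_deriv : ∃ Λ : ℝ, 0 ≤ Λ ∧ ∀ s, -Λ ≤ deriv f s)
    (α : ℝ) (hα : 0 < α)
    (y₀ : Space n → ℝ) (hy₀ : MemLp y₀ ∞ (volΩ Ω))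
    (p q : ℝ≥0∞) (hp : 2 ≤ p) (hq : 2 ≤ q) (hpq : 1 / p + (n : ℝ≥0∞) / (2 * q) < 1)
    (yd : Space n × ℝ → ℝ) (hyd : MemMixedLp Ω T p q yd) :
    (∀ u : L2Q Ω T, ∃! y : L2Q Ω T, IsSolution Ω T a a₀ f y₀ u y) ∧
    ∃ ubar : L2Q Ω T, ∀ u : L2Q Ω T,
      cost Ω T a a₀ f y₀ yd α ubar ≤ cost Ω T a a₀ f y₀ yd α u := by
  obtain ⟨lam, hlam, hell⟩ := ha_ell
  obtain ⟨Λ, hΛ, hder⟩ := hf_deriv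
  have hmono := monotone_add_mul (hf.differentiable one_ne_zero) hder
  have : IsFiniteMeasure (volΩ Ω) := ⟨by simpa using hΩ_bdd.measure_lt_top⟩
  obtain ⟨A, hA⟩ := exists_operator ha ha₀
  have hA0 : ∀ v, 0 ≤ ⟪A v, v⟫_ℝ := fun v => by
    rw [← hA]
    exact (by positivity : 0 ≤ lam * ‖grad Ω v‖ ^ 2).trans
      (formA_coercive ha ha₀ hell ha₀_nonneg v)
  have hy₀2 : MemLp y₀ 2 (volΩ Ω) := hy₀.mono_exponent le_top
  have hz₀ := hy₀2.coeFn_toLp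
  have hz₀R : ∀ᵐ x ∂volΩ Ω, |hy₀2.toLp y₀ x| ≤ (eLpNormEssSup y₀ (volΩ Ω)).toReal := by
    have hfin : eLpNormEssSup y₀ (volΩ Ω) ≠ ∞ := by
      rw [← eLpNorm_exponent_top]; exact hy₀.2.ne
    filter_upwards [hz₀, ae_le_eLpNormEssSup (f := y₀) (μ := volΩ Ω)] with x h1 h2
    rw [h1, ← Real.norm_eq_abs, ← toReal_enorm]
    exact ENNReal.toReal_mono hfin h2
  have happ := fun B => exists_uniform_isApprox (T := T) hΩ_bdd ha ha₀ hlam hell ha₀_nonneg hA hT hf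
    hf_zero hΛ hmono hz₀R B
  have huniq : ∀ u y₁ y₂ : L2Q Ω T, IsSolution Ω T a a₀ f y₀ u y₁ →
      IsSolution Ω T a a₀ f y₀ u y₂ → y₁ = y₂ := fun u y₁ y₂ h₁ h₂ =>
    h₁.unique hT hA hA0 hmono h₂
  have hex : ∀ u : L2Q Ω T, ∃ y : L2Q Ω T, IsSolution Ω T a a₀ f y₀ u y := by
    intro u
    obtain ⟨C, φ, h, hφ, hh, hap⟩ := happ ‖u‖
    choose Y w χ hw using fun k => hap k u le_rfl
    obtain ⟨-, y, -, -, hy⟩ := exists_subseq_tendsto_isSolution hΩ_open hΩ_bdd hT hA hf.continuous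
      hz₀ hφ (u := fun _ => u) (fun _ => le_rfl) (fun _ => tendsto_const_nhds) hh hw
    exact ⟨y, hy⟩
  refine ⟨fun u => ?_, exists_optimal_control hΩ_open hΩ_bdd hT hA hf.continuous hz₀ huniq happ
    (fun u => Classical.epsilon_spec (hex u))
    (memLp_of_memMixedLp hΩ_bdd.measure_lt_top.ne hp hq hyd) hα⟩
  obtain ⟨y, hy⟩ := hex u
  exact ⟨y, hy, fun y' hy' => huniq u y' y hy' hy⟩
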